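/- Let $M$ and $N$ be connected Riemannian manifolds with smooth isometric actions of cohomogeneity one of compact Lie groups $G$ on $M$ and $K$ on $N$, and let $A\colon G\to K$ be a homomorphism of Lie groups with differential $dA_e\colon\mathfrak g\to\mathfrak k$. For $X$ in $\mathfrak g$ or $\mathfrak k$ let $X^*$ denote the action field $X^*_p=\frac{d}{ds}\big|_{s=0}\exp(sX)\cdot p$. Let $\gamma\colon\mathbb R\to M$ and $\hat\gamma\colon\mathbb R\to N$ be unit-speed normal geodesics, that is, unit-speed geodesics which pass through all orbits perpendicularly. Let $D\subset\mathbb R$ be an open set such that the orbits $G\cdot\gamma(s)$, $s\in D$, have codimension one (for example, the parameters of the interior of $M/G$), let $r\colon D\to\mathbb R$ be smooth, and let $\psi\colon M\to N$ be a map with $$\psi(g\cdot\gamma(s))=A(g)\cdot\hat\gamma(r(s))\qquad\text{for all } g\in G,\ s\in D.$$ Let $\tau=\operatorname{Tr}\nabla d\psi$ be the tension field of $\psi$. Let $t\in D$ be such that the orbit $K\cdot\hat\gamma(t)$ has codimension one. Choose $E_1,\dots,E_n\in\mathfrak g$ such that $E^*_{1|\gamma(t)},\dots,E^*_{n|\gamma(t)}$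 is an orthonormal basis of $T_{\gamma(t)}(G\cdot\gamma(t))$, and an orthonormal basis $f_1,\dots,f_m$ of $T_{\hat\gamma(t)}(K\cdot\hat\gamma(t))$, and put $c_{\mu,i}=\langle (dA_eE_\mu)^*,f_i\rangle_{|\hat\gamma(t)}$. Then $$\langle\tau_{|\gamma(t)},\dot{\hat\gamma}(r(t))\rangle=\ddot r(t)-\dot r(t)\operatorname{Tr}S_{|\gamma(t)}+\sum_{\mu=1}^n\sum_{i,j=1}^m c_{\mu,i}\,c_{\mu,j}\,\big\langle (J_t^{r(t)})^*\,(\Pi_t^{r(t)})^{-1}\,\hat S_{|\hat\gamma(r(t))}\,\Pi_t^{r(t)}\,J_t^{r(t)}f_i,\,f_j\big\rangle_{|\hat\gamma(t)}.$$ Here $S_{|\gamma(t)}$ and $\hat S_{|\hat\gamma(s)}$ are the shape operators of the orbits $G\cdot\gamma(t)$ and $K\cdot\hat\gamma(s)$ in the directions $\dot\gamma(t)$ and $\dot{\hat\gamma}(s)$, that is, $S v=-(\nabla_vT)^{\top}$ for the normal field $T_{|g\cdot\gamma(t)}=g\cdot\dot\gamma(t)$ of the orbit, where $\top$ denotes the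 tangential component, and similarly for $\hat S$. $\Pi_t^{s}\colon T_{\hat\gamma(t)}(K\cdot\hat\gamma(t))\to T_{\hat\gamma(s)}(K\cdot\hat\gamma(s))$ is parallel transport along $\hat\gamma$, $(\Pi_t^{s})^{-1}=\Pi_s^t$ is parallel transport in the opposite direction, $J_t^{s}$ is the endomorphism of $T_{\hat\gamma(t)}(K\cdot\hat\gamma(t))$ given by the action field homomorphism $X^*_{|\hat\gamma(t)}\mapsto X^*_{|\hat\gamma(s)}$ followed by $(\Pi_t^{s})^{-1}$, and $(J_t^s)^*$ is its adjoint. If the orbit $K\cdot\hat\gamma(s)$ has codimension greater than one, $\Pi_t^{s}$ and $\Pi_s^t$ are understood to be followed by the orthogonal projection onto the tangent space of the orbit; for orbits of codimension one this projection changes nothing. -/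

import Mathlib

open Bundle Manifold VectorField FiberBundle
open scoped ContDiff InnerProductSpace

noncomputable section

section LeviCivita

variable {E : Type*} [NormedAddCommGroup E] [NormedSpace ℝ E] [FiniteDimensional ℝ E]
  {M : Type*} [TopologicalSpace M] [ChartedSpace E M] [IsManifold 𝓘(ℝ, E) ∞ M]
  [RiemannianBundle (fun x : M ↦ TangentSpace 𝓘(ℝ, E) x)]
  [IsContMDiffRiemannianBundle 𝓘(ℝ, E) ∞ E (fun x : M ↦ TangentSpace 𝓘(ℝ, E) x)]

instance tangentSpace_finiteDimensional (x : M) : FiniteDimensional ℝ (TangentSpace 𝓘(ℝ, E) x) :=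
  inferInstanceAs (FiniteDimensional ℝ E)

theorem mdifferentiableAt_inner {Y Z : Π x : M, TangentSpace 𝓘(ℝ, E) x} {x : M}
    (hY : MDiffAt (T% Y) x) (hZ : MDiffAt (T% Z) x) :
    MDiffAt (fun y ↦ ⟪Y y, Z y⟫_ℝ) x :=
  MDifferentiableAt.inner_bundle (E := fun x : M ↦ TangentSpace 𝓘(ℝ, E) x) (F := E)
    (IB := 𝓘(ℝ, E)) hY hZ

/-- The right-hand side of the Koszul formula for `⟪∇_X Y, Z⟫` at `x`. -/
def koszul (Y X Z : Π x : M, TangentSpace 𝓘(ℝ, E) x) (x : M) : ℝ :=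
  1 / 2 * (mvfderiv 𝓘(ℝ, E) (fun y ↦ ⟪Y y, Z y⟫_ℝ) x (X x)
    + mvfderiv 𝓘(ℝ, E) (fun y ↦ ⟪Z y, X y⟫_ℝ) x (Y x)
    - mvfderiv 𝓘(ℝ, E) (fun y ↦ ⟪X y, Y y⟫_ℝ) x (Z x)
    + ⟪mlieBracket 𝓘(ℝ, E) X Y x, Z x⟫_ℝ
    - ⟪mlieBracket 𝓘(ℝ, E) X Z x, Y x⟫_ℝ
    - ⟪mlieBracket 𝓘(ℝ, E) Y Z x, X x⟫_ℝ)

theorem koszul_tensorial_left {Y Z : Π x : M, TangentSpace 𝓘(ℝ, E) x} {x : M}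
    (hY : MDiffAt (T% Y) x) (hZ : MDiffAt (T% Z) x) :
    TensorialAt 𝓘(ℝ, E) E (fun X ↦ koszul Y X Z x) x where
  smul {f X} hf hX := by
    simp only [koszul, Pi.smul_apply', inner_smul_right, inner_smul_left,
      mlieBracket_smul_left hf hX, mvfderiv_fun_mul hf (mdifferentiableAt_inner hZ hX),
      RCLike.conj_to_real, mvfderiv_fun_mul hf (mdifferentiableAt_inner hX hY), map_smul,
      inner_add_left, neg_smul, inner_neg_left]
    simp
    rw [real_inner_comm (Y x) (X x), real_inner_comm (Z x) (X x)]
    ring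
  add {X X'} hX hX' := by
    simp only [koszul, Pi.add_apply, inner_add_right, inner_add_left, mlieBracket_add_left hX hX',
      mvfderiv_fun_add (mdifferentiableAt_inner hZ hX) (mdifferentiableAt_inner hZ hX'),
      mvfderiv_fun_add (mdifferentiableAt_inner hX hY) (mdifferentiableAt_inner hX' hY), map_add]
    simp
    ring

theorem koszul_tensorial_right {Y X : Π x : M, TangentSpace 𝓘(ℝ, E) x} {x : M}
    (hY : MDiffAt (T% Y) x) (hX : MDiffAt (T% X) x) :
    TensorialAt 𝓘(ℝ, E) E (fun Z ↦ koszul Y X Z x) x where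
  smul {f Z} hf hZ := by
    simp only [koszul, Pi.smul_apply', inner_smul_right, inner_smul_left,
      mlieBracket_smul_right hf hZ, mvfderiv_fun_mul hf (mdifferentiableAt_inner hY hZ),
      RCLike.conj_to_real,
      mvfderiv_fun_mul hf (mdifferentiableAt_inner hZ hX), map_smul, inner_add_left]
    simp
    rw [real_inner_comm (Y x) (Z x)]
    ring
  add {Z Z'} hZ hZ' := by
    simp only [koszul, Pi.add_apply, inner_add_right, inner_add_left, mlieBracket_add_right hZ hZ',
      mvfderiv_fun_add (mdifferentiableAt_inner hY hZ) (mdifferentiableAt_inner hY hZ'),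
      mvfderiv_fun_add (mdifferentiableAt_inner hZ hX) (mdifferentiableAt_inner hZ' hX), map_add]
    simp
    ring

open Classical in
/-- `∇Y` at `x`, as the linear map `v ↦ ∇_v Y`, where `∇_X Y = ∑ᵢ ⟪∇_X Y, bᵢ⟫ bᵢ` in an orthonormal
basis and `⟪∇_X Y, bᵢ⟫` is given by the Koszul formula; it has the value zero where `Y` is not
differentiable. -/
def leviCivitaFun (Y : Π x : M, TangentSpace 𝓘(ℝ, E) x) (x : M) :
    TangentSpace 𝓘(ℝ, E) x →L[ℝ] TangentSpace 𝓘(ℝ, E) x :=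
  if hY : MDiffAt (T% Y) x then
    ∑ i, (TensorialAt.mkHom (fun X ↦ koszul Y X
        (extend E (stdOrthonormalBasis ℝ (TangentSpace 𝓘(ℝ, E) x) i)) x) x
      (koszul_tensorial_left hY (mdifferentiableAt_extend ..))).smulRight
        (stdOrthonormalBasis ℝ (TangentSpace 𝓘(ℝ, E) x) i)
  else 0

theorem inner_leviCivitaFun {X Y Z : Π x : M, TangentSpace 𝓘(ℝ, E) x} {x : M}
    (hX : MDiffAt (T% X) x) (hY : MDiffAt (T% Y) x) (hZ : MDiffAt (T% Z) x) :
    ⟪leviCivitaFun Y x (X x), Z x⟫_ℝ = koszul Y X Z x := by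
  have hT := koszul_tensorial_right hY hX
  have h1 := TensorialAt.mkHom_apply hT hZ
  rw [← h1, leviCivitaFun, dif_pos hY]
  simp only [sum_apply, ContinuousLinearMap.smulRight_apply, sum_inner,
    inner_smul_left, RCLike.conj_to_real]
  conv_rhs => rw [← (stdOrthonormalBasis ℝ (TangentSpace 𝓘(ℝ, E) x)).sum_repr' (Z x)]
  rw [map_sum]
  refine Finset.sum_congr rfl fun i _ ↦ ?_
  rw [TensorialAt.mkHom_apply _ hX, map_smul, TensorialAt.mkHom_apply_eq_extend, smul_eq_mul,
    mul_comm]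

theorem ext_extend_inner {x : M} {v w : TangentSpace 𝓘(ℝ, E) x}
    (h : ∀ Z : Π x : M, TangentSpace 𝓘(ℝ, E) x, MDiffAt (T% Z) x → ⟪v, Z x⟫_ℝ = ⟪w, Z x⟫_ℝ) :
    v = w := by
  refine ext_inner_right ℝ fun z ↦ ?_
  simpa using h (extend E z) (mdifferentiableAt_extend ..)

/-- The Levi-Civita connection of a Riemannian manifold. In Mathlib's argument order,
`leviCivita Y x v` is `∇_v Y` at `x`. -/
def leviCivita : CovariantDerivative 𝓘(ℝ, E) E (fun x : M ↦ TangentSpace 𝓘(ℝ, E) x) where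
  toFun := leviCivitaFun
  isCovariantDerivativeOnUniv :=
    { add {Y Y' x} hY hY' _ := by
        ext v
        refine ext_extend_inner fun Z hZ ↦ ?_
        have hX : MDiffAt (T% (extend E v : Π x : M, TangentSpace 𝓘(ℝ, E) x)) x :=
          mdifferentiableAt_extend ..
        have e : v = (extend E v : Π x : M, TangentSpace 𝓘(ℝ, E) x) x := by simp
        have hs : MDiffAt (T% (Y + Y')) x := mdifferentiableAt_add_section hY hY'
        rw [e, add_apply, inner_add_left, inner_leviCivitaFun hX hs hZ,
          inner_leviCivitaFun hX hY hZ, inner_leviCivitaFun hX hY' hZ]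
        simp only [koszul, Pi.add_apply, inner_add_right, inner_add_left,
          mlieBracket_add_right hY hY', mlieBracket_add_left hY hY',
          mvfderiv_fun_add (mdifferentiableAt_inner hY hZ) (mdifferentiableAt_inner hY' hZ),
          mvfderiv_fun_add (mdifferentiableAt_inner hX hY) (mdifferentiableAt_inner hX hY'),
          map_add]
        simp
        ring
      leibniz {Y f x} hY hf _ := by
        ext v
        refine ext_extend_inner fun Z hZ ↦ ?_
        have hX : MDiffAt (T% (extend E v : Π x : M, TangentSpace 𝓘(ℝ, E) x)) x :=
          mdifferentiableAt_extend ..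
        have e : v = (extend E v : Π x : M, TangentSpace 𝓘(ℝ, E) x) x := by simp
        have hs : MDiffAt (T% (f • Y)) x := hf.smul_section hY
        rw [e, add_apply, smul_apply, inner_add_left,
          inner_smul_left, inner_leviCivitaFun hX hs hZ, inner_leviCivitaFun hX hY hZ,
          ContinuousLinearMap.smulRight_apply, inner_smul_left]
        generalize (extend E v : Π x : M, TangentSpace 𝓘(ℝ, E) x) = X at *
        simp only [koszul, Pi.smul_apply', inner_smul_right, inner_smul_left,
          mlieBracket_smul_right hf hY, mlieBracket_smul_left hf hY,
          mvfderiv_fun_mul hf (mdifferentiableAt_inner hY hZ), RCLike.conj_to_real,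
          mvfderiv_fun_mul hf (mdifferentiableAt_inner hX hY), map_smul, inner_add_left]
        simp
        rw [real_inner_comm (X x) (Y x)]
        ring }

theorem inner_leviCivita {X Y Z : Π x : M, TangentSpace 𝓘(ℝ, E) x} {x : M}
    (hX : MDiffAt (T% X) x) (hY : MDiffAt (T% Y) x) (hZ : MDiffAt (T% Z) x) :
    ⟪leviCivita Y x (X x), Z x⟫_ℝ = koszul Y X Z x :=
  inner_leviCivitaFun hX hY hZ

/-- The Levi-Civita connection is torsion-free. -/
theorem leviCivita_torsion :
    CovariantDerivative.torsion (leviCivita (E := E) (M := M)) = 0 := by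
  rw [CovariantDerivative.torsion_eq_zero_iff]
  intro X Y x hX hY
  refine ext_extend_inner fun Z hZ ↦ ?_
  rw [inner_sub_left, inner_leviCivita hX hY hZ, inner_leviCivita hY hX hZ, koszul, koszul,
    mlieBracket_swap_apply (V := Y) (W := X), inner_neg_left]
  simp only [funext fun y ↦ real_inner_comm (X y) (Y y),
    funext fun y ↦ real_inner_comm (Z y) (Y y), funext fun y ↦ real_inner_comm (X y) (Z y)]
  ring

/-- The Levi-Civita connection is compatible with the metric. -/
theorem leviCivita_metric {X Y Z : Π x : M, TangentSpace 𝓘(ℝ, E) x} {x : M}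
    (hX : MDiffAt (T% X) x) (hY : MDiffAt (T% Y) x) (hZ : MDiffAt (T% Z) x) :
    mvfderiv 𝓘(ℝ, E) (fun y ↦ ⟪Y y, Z y⟫_ℝ) x (X x) =
      ⟪leviCivita Y x (X x), Z x⟫_ℝ + ⟪Y x, leviCivita Z x (X x)⟫_ℝ := by
  rw [real_inner_comm (leviCivita Z x (X x)), inner_leviCivita hX hY hZ,
    inner_leviCivita hX hZ hY, koszul, koszul, mlieBracket_swap_apply (V := Z) (W := Y),
    inner_neg_left]
  simp only [funext fun y ↦ real_inner_comm (X y) (Y y),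
    funext fun y ↦ real_inner_comm (Z y) (Y y), funext fun y ↦ real_inner_comm (X y) (Z y)]
  ring


/-- The covariant derivative, for the Levi-Civita connection of `M`, of a vector field `V` along a
map `f : P → M` at `y : P` in the direction `v`. In the trivialization of `TM` given by the chart
at `f y`, it is the sum of the derivative of the coordinate expression of `V` and of the covariant
derivative, in the direction `df v`, of the vector field around `f y` which has constant coordinates
and takes the value `V y` at `f y`. -/
def covDerivAlong {F : Type*} [NormedAddCommGroup F] [NormedSpace ℝ F]
    {P : Type*} [TopologicalSpace P] [ChartedSpace F P]
    (f : P → M) (V : Π z : P, TangentSpace 𝓘(ℝ, E) (f z)) (y : P) (v : TangentSpace 𝓘(ℝ, F) y) :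
    TangentSpace 𝓘(ℝ, E) (f y) :=
  (trivializationAt E (TangentSpace 𝓘(ℝ, E)) (f y)).symmL ℝ (f y)
      (mvfderiv 𝓘(ℝ, F) (fun z ↦
        (trivializationAt E (TangentSpace 𝓘(ℝ, E)) (f y) ⟨f z, V z⟩).2) y v)
    + leviCivita (extend E (V y)) (f y) (mfderiv 𝓘(ℝ, F) 𝓘(ℝ, E) f y v)

/-- The velocity of a curve `γ : ℝ → M` at time `t`. -/
def velocity (γ : ℝ → M) (t : ℝ) : TangentSpace 𝓘(ℝ, E) (γ t) :=
  mfderiv 𝓘(ℝ, ℝ) 𝓘(ℝ, E) γ t (1 : ℝ)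

/-- The vector field `V` along the curve `γ` is differentiable at `s` and its covariant derivative
vanishes there. -/
def IsParallelAt (γ : ℝ → M) (V : Π s : ℝ, TangentSpace 𝓘(ℝ, E) (γ s)) (s : ℝ) : Prop :=
  MDifferentiableAt 𝓘(ℝ, ℝ) 𝓘(ℝ, E).tangent
      (fun s' ↦ (⟨γ s', V s'⟩ : TangentBundle 𝓘(ℝ, E) M)) s ∧
    covDerivAlong γ V s (1 : ℝ) = 0

/-- Parallel transport along the curve `γ` from `γ a` to `γ b`: the linear map which sends `V a` to
`V b` for every vector field `V` along `γ` that is parallel between `a` and `b`. -/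
def parallelTransport (γ : ℝ → M) (a b : ℝ) :
    TangentSpace 𝓘(ℝ, E) (γ a) →ₗ[ℝ] TangentSpace 𝓘(ℝ, E) (γ b) :=
  Classical.epsilon fun T : TangentSpace 𝓘(ℝ, E) (γ a) →ₗ[ℝ] TangentSpace 𝓘(ℝ, E) (γ b) ↦
    ∀ v, ∃ V : Π s : ℝ, TangentSpace 𝓘(ℝ, E) (γ s),
      (∀ s ∈ Set.uIcc a b, IsParallelAt γ V s) ∧ V a = v ∧ V b = T v

end LeviCivita

section Tension

variable {E : Type*} [NormedAddCommGroup E] [NormedSpace ℝ E] [FiniteDimensional ℝ E]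
  {M : Type*} [TopologicalSpace M] [ChartedSpace E M] [IsManifold 𝓘(ℝ, E) ∞ M]
  [RiemannianBundle (fun x : M ↦ TangentSpace 𝓘(ℝ, E) x)]
  [IsContMDiffRiemannianBundle 𝓘(ℝ, E) ∞ E (fun x : M ↦ TangentSpace 𝓘(ℝ, E) x)]
  {F : Type*} [NormedAddCommGroup F] [NormedSpace ℝ F] [FiniteDimensional ℝ F]
  {N : Type*} [TopologicalSpace N] [ChartedSpace F N] [IsManifold 𝓘(ℝ, F) ∞ N]
  [RiemannianBundle (fun x : N ↦ TangentSpace 𝓘(ℝ, F) x)]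
  [IsContMDiffRiemannianBundle 𝓘(ℝ, F) ∞ F (fun x : N ↦ TangentSpace 𝓘(ℝ, F) x)]

/-- The second fundamental form `∇dψ(v, v) = ∇_v (dψ X) - dψ (∇_v X)` of `ψ : M → N` at `p`, where
`X` is a vector field around `p` with `X p = v`. -/
def hessianMap (ψ : M → N) (p : M) (v : TangentSpace 𝓘(ℝ, E) p) : TangentSpace 𝓘(ℝ, F) (ψ p) :=
  covDerivAlong ψ (fun x ↦ mfderiv 𝓘(ℝ, E) 𝓘(ℝ, F) ψ x
      ((extend E v : Π x : M, TangentSpace 𝓘(ℝ, E) x) x)) p v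
    - mfderiv 𝓘(ℝ, E) 𝓘(ℝ, F) ψ p
      (leviCivita (extend E v : Π x : M, TangentSpace 𝓘(ℝ, E) x) p v)

/-- The tension field `τ(ψ) = Tr ∇dψ` of `ψ : M → N`. -/
def tensionField (ψ : M → N) (p : M) : TangentSpace 𝓘(ℝ, F) (ψ p) :=
  ∑ i, hessianMap ψ p (stdOrthonormalBasis ℝ (TangentSpace 𝓘(ℝ, E) p) i)

end Tension

section Cohomogeneity

variable (E : Type*) [NormedAddCommGroup E] [NormedSpace ℝ E] [FiniteDimensional ℝ E]
  {M : Type*} [TopologicalSpace M] [ChartedSpace E M] [IsManifold 𝓘(ℝ, E) ∞ M]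
  [RiemannianBundle (fun x : M ↦ TangentSpace 𝓘(ℝ, E) x)]
  [IsContMDiffRiemannianBundle 𝓘(ℝ, E) ∞ E (fun x : M ↦ TangentSpace 𝓘(ℝ, E) x)]
  (EG : Type*) [NormedAddCommGroup EG] [NormedSpace ℝ EG]
  (G : Type*) [TopologicalSpace G] [ChartedSpace EG G] [Group G] [MulAction G M]

/-- The value at `p` of the action field of `X` in the Lie algebra of `G`, that is
`X^*_p = d/ds (exp (s X) • p)` at `s = 0`. -/
def actionField (p : M) : GroupLieAlgebra 𝓘(ℝ, EG) G →L[ℝ] TangentSpace 𝓘(ℝ, E) p :=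
  mfderiv 𝓘(ℝ, EG) 𝓘(ℝ, E) (fun g : G ↦ g • p) 1

/-- The tangent space `T_p (G • p)` of the orbit through `p`. -/
def orbitTangent (p : M) : Submodule ℝ (TangentSpace 𝓘(ℝ, E) p) :=
  LinearMap.range (actionField E EG G p).toLinearMap

/-- The value at `p` of the action field, as an element of the tangent space of the orbit. -/
def orbitField (p : M) : GroupLieAlgebra 𝓘(ℝ, EG) G →ₗ[ℝ] orbitTangent E EG G p :=
  (actionField E EG G p).toLinearMap.rangeRestrict

/-- The orbit through `p` has codimension one in `M`. -/
def IsHypersurfaceOrbit (p : M) : Prop :=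
  Module.finrank ℝ (orbitTangent E EG G p) + 1 = Module.finrank ℝ E

variable (M) in
/-- The action of `G` on `M` is isometric and of cohomogeneity one: the smallest codimension of an
orbit, which is the codimension of the principal orbits and the dimension of the orbit space, is
one. -/
structure IsCohomogeneityOne : Prop where
  isometric (g : G) (x : M) (v w : TangentSpace 𝓘(ℝ, E) x) :
    ⟪mfderiv 𝓘(ℝ, E) 𝓘(ℝ, E) (fun y : M ↦ g • y) x v,
      mfderiv 𝓘(ℝ, E) 𝓘(ℝ, E) (fun y : M ↦ g • y) x w⟫_ℝ = ⟪v, w⟫_ℝ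
  one_le_codim (p : M) :
    Module.finrank ℝ (orbitTangent E EG G p) + 1 ≤ Module.finrank ℝ E
  exists_codim_eq_one : ∃ p : M, IsHypersurfaceOrbit E EG G p

/-- `γ` is a unit-speed geodesic which passes through all orbits perpendicularly. -/
structure IsNormalGeodesic (γ : ℝ → M) : Prop where
  contMDiff : ContMDiff 𝓘(ℝ, ℝ) 𝓘(ℝ, E) ∞ γ
  geodesic (t : ℝ) : covDerivAlong (E := E) γ (velocity γ) t (1 : ℝ) = 0
  unit_speed (t : ℝ) : ⟪velocity (E := E) γ t, velocity γ t⟫_ℝ = 1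
  meets_orbit (p : M) : ∃ (t : ℝ) (g : G), g • γ t = p
  perpendicular (t : ℝ) (X : GroupLieAlgebra 𝓘(ℝ, EG) G) :
    ⟪velocity γ t, actionField E EG G (γ t) X⟫_ℝ = 0

/-- The shape operator at `p` of the orbit `G • p` in the direction of the normal vector `ξ`: the
endomorphism `v ↦ -(∇_v T)^⊤` of `T_p (G • p)`, where `T` is the normal field of the orbit given by
`T (g • p) = g • ξ`. The vector `∇_v T` with `v = X^*_p` is the covariant derivative, in the
direction `X` at `1`, of the vector field `g ↦ g • ξ` along the orbit map `g ↦ g • p`. -/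
def shapeOperator (p : M) (ξ : TangentSpace 𝓘(ℝ, E) p) :
    orbitTangent E EG G p →ₗ[ℝ] orbitTangent E EG G p :=
  Classical.epsilon fun S : orbitTangent E EG G p →ₗ[ℝ] orbitTangent E EG G p ↦
    ∀ X : GroupLieAlgebra 𝓘(ℝ, EG) G, S (orbitField E EG G p X) =
      -(orbitTangent E EG G p).orthogonalProjectionOnto (covDerivAlong (fun g : G ↦ g • p)
        (fun g ↦ mfderiv 𝓘(ℝ, E) 𝓘(ℝ, E) (fun y : M ↦ g • y) p ξ) 1 X)

/-- The action field homomorphism: the linear map with `X^*_{γ a} ↦ X^*_{γ b}` for all `X` in the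
Lie algebra of `G`. -/
def actionFieldHom (γ : ℝ → M) (a b : ℝ) :
    orbitTangent E EG G (γ a) →ₗ[ℝ] orbitTangent E EG G (γ b) :=
  Classical.epsilon fun L : orbitTangent E EG G (γ a) →ₗ[ℝ] orbitTangent E EG G (γ b) ↦
    ∀ X : GroupLieAlgebra 𝓘(ℝ, EG) G, L (orbitField E EG G (γ a) X) = orbitField E EG G (γ b) X

/-- Parallel transport `T_{γ a} (G • γ a) → T_{γ b} (G • γ b)` along `γ`. For a normal geodesic `γ`
and orbits of codimension one, parallel transport preserves the tangent spaces of the orbits, and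
the orthogonal projection only adjusts the codomain. -/
def orbitTransport (γ : ℝ → M) (a b : ℝ) :
    orbitTangent E EG G (γ a) →ₗ[ℝ] orbitTangent E EG G (γ b) :=
  (orbitTangent E EG G (γ b)).orthogonalProjectionOnto.toLinearMap ∘ₗ parallelTransport γ a b ∘ₗ
    (orbitTangent E EG G (γ a)).subtype

/-- The endomorphism `J_a^b` of `T_{γ a} (G • γ a)`: the action field homomorphism from `γ a` to
`γ b`, followed by parallel transport back to `γ a`. -/
def actionEndomorphism (γ : ℝ → M) (a b : ℝ) :
    orbitTangent E EG G (γ a) →ₗ[ℝ] orbitTangent E EG G (γ a) :=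
  orbitTransport E EG G γ b a ∘ₗ actionFieldHom E EG G γ a b

end Cohomogeneity

/-- The differential `dA_e` of a homomorphism of Lie groups, as a map of Lie algebras. -/
def lieDifferential (EG EK : Type*) [NormedAddCommGroup EG] [NormedSpace ℝ EG]
    [NormedAddCommGroup EK] [NormedSpace ℝ EK]
    {G : Type*} [TopologicalSpace G] [ChartedSpace EG G] [Group G]
    {K : Type*} [TopologicalSpace K] [ChartedSpace EK K] [Group K] (A : G →* K) :
    GroupLieAlgebra 𝓘(ℝ, EG) G →L[ℝ] GroupLieAlgebra 𝓘(ℝ, EK) K :=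
  mfderiv 𝓘(ℝ, EG) 𝓘(ℝ, EK) A 1

/-- A tangent vector at `x`, viewed at a point `y` which is equal to `x`. -/
def tangentCast {E : Type*} [NormedAddCommGroup E] [NormedSpace ℝ E]
    {M : Type*} [TopologicalSpace M] [ChartedSpace E M] {x y : M} (h : x = y)
    (v : TangentSpace 𝓘(ℝ, E) x) : TangentSpace 𝓘(ℝ, E) y :=
  h ▸ v

theorem equivariant_apply_geodesic {G K M N : Type*} [Group G] [Group K] [MulAction G M]
    [MulAction K N] {A : G →* K} {ψ : M → N} {γ : ℝ → M} {γN : ℝ → N} {r : ℝ → ℝ} {D : Set ℝ}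
    (h : ∀ g : G, ∀ s ∈ D, ψ (g • γ s) = A g • γN (r s)) {t : ℝ} (ht : t ∈ D) :
    ψ (γ t) = γN (r t) := by
  simpa using h 1 t ht

end

set_option linter.unusedSectionVars false

/-! The tension field at `γ t` is the trace of the second fundamental form `∇dψ`. Since the orbit
has codimension one, the trace can be taken over `e 1, …, e n` and the unit normal `γ'(t)`.

Normal direction: `ψ ∘ γ = γN ∘ r` near `t`, and both curves are geodesics, so `∇dψ(γ', γ')` is the
covariant derivative of `r' γN'(r)`, namely `r'' γN'(r)` (`hessianForm_velocity`).

Orbit directions: for `X` in the Lie algebra of `G` and `p = γ t`, the field `g ↦ g • X^*_p` along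
the orbit map is sent by `dψ` to `A(g) • (dA X)^*`. The product rule `covAlong_mfderiv` expresses
`∇dψ(X^*, X^*)` as the derivative of the image field minus `dψ` of the derivative of the original
field (`hessianForm_actionFieldModel`). Two facts extract the `γN'`-component. Isometric actions
make the derivative of transported vectors skew (`IsCohomogeneityOne.orbitCov_skew`), so that the
normal component of the derivative of `g • X^*_p` is `⟪S X^*, X^*⟫`. Moreover `dψ` respects the
splitting into orbit and normal directions, with factor `r'` on the normal one
(`IsNormalGeodesic.tangentInner_mfderivModel`). The result is `⟪Ŝ (dA X)^*, (dA X)^*⟫ - r' ⟪S X^*,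
X^*⟫`, and summation over `X = Ev μ` gives the trace of `S`.

The quadratic form of `Ŝ` lives at `γN (r t)`. It is moved to `γN t` by parallel transport, an
isometry inverse to transport in the opposite direction; the factors `Π` and `J` cancel on action
fields (`IsNormalGeodesic.inner_actionEndomorphism`). This needs only `γN t` on an orbit of
codimension one: every vector involved comes from the orbit at `γN (r t)`, so the projections never
act.

The operators defined by a choice must be shown to exist. For parallel transport this is the theory
of linear differential equations, which requires `C¹` Christoffel symbols. For the action field
homomorphism and the shape operator it is the behaviour of the isotropy group: its elements near the
identity fix the normal vector and, being isometries, the whole normal geodesic. Smoothness of `ψ`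
near `γ t` follows from a local section of `(g, s) ↦ g • γ s`.

All tangent spaces are identified with the model space `E`, so fields along maps become plain
functions; the norm of `E` is unrelated to the metric, which enters through `tangentInner`. -/

noncomputable section

/-! ### Coordinates of tangent vectors in a trivialization of the tangent bundle. -/

section TangentCoordinates

variable {E : Type*} [NormedAddCommGroup E] [NormedSpace ℝ E]
  {M : Type*} [TopologicalSpace M] [ChartedSpace E M] [IsManifold 𝓘(ℝ, E) ∞ M]

variable (E) in
/-- The coordinates of a tangent vector at `x` in the trivialization of `TM` at `x₀`. -/
def tangentCoord (x₀ x : M) : E →L[ℝ] E := tangentCoordChange 𝓘(ℝ, E) x x₀ x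

variable (E) in
/-- The vector field around `x₀` which has constant coordinates `w` in the trivialization at `x₀`. -/
def constField (x₀ : M) (w : E) (x : M) : TangentSpace 𝓘(ℝ, E) x :=
  (trivializationAt E (TangentSpace 𝓘(ℝ, E)) x₀).symm x w

theorem tangentCoord_self (x : M) (v : E) : tangentCoord E x x v = v :=
  tangentCoordChange_self (by simp)

theorem tangentCoord_constField {x₀ x : M} (hx : x ∈ (chartAt E x₀).source) (w : E) :
    tangentCoord E x₀ x (constField E x₀ w x) = w := by
  have h := (trivializationAt E (TangentSpace 𝓘(ℝ, E)) x₀).apply_mk_symm (b := x) hx w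
  have h2 := congrArg Prod.snd h
  exact h2

theorem constField_tangentCoord {x₀ x : M} (hx : x ∈ (chartAt E x₀).source)
    (v : TangentSpace 𝓘(ℝ, E) x) : constField E x₀ (tangentCoord E x₀ x v) x = v :=
  (trivializationAt E (TangentSpace 𝓘(ℝ, E)) x₀).symm_apply_apply_mk (b := x) hx v

/-- The coordinate change from `x` to itself is the identity at `x`. This makes definitions phrased
with `extend` accessible to coordinate computations. -/
theorem extend_eq_constField (x : M) (v : TangentSpace 𝓘(ℝ, E) x) :
    (extend E v : Π y : M, TangentSpace 𝓘(ℝ, E) y) = constField E x v := by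
  ext y
  exact congrArg (fun w : E ↦ (trivializationAt E (TangentSpace 𝓘(ℝ, E)) x).symm y w)
    (tangentCoord_self (E := E) x v)

theorem constField_self (x : M) (w : E) : constField E x w x = w := by
  have h := constField_tangentCoord (mem_chart_source E x) w
  rwa [tangentCoord_self] at h

theorem tangentCoord_injective {x₀ x : M} (hx : x ∈ (chartAt E x₀).source) {v w : E}
    (h : tangentCoord E x₀ x v = tangentCoord E x₀ x w) : v = w := by
  have := constField_tangentCoord hx v
  rw [h, constField_tangentCoord hx w] at this
  exact this.symm

theorem contMDiffAt_constField {x₀ x : M} (hx : x ∈ (chartAt E x₀).source) (w : E) :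
    ContMDiffAt 𝓘(ℝ, E) 𝓘(ℝ, E).tangent ∞ (T% (constField E x₀ w)) x := by
  rw [(trivializationAt E (TangentSpace 𝓘(ℝ, E)) x₀).contMDiffAt_section_iff hx]
  refine (contMDiffAt_const (c := w)).congr_of_eventuallyEq ?_
  filter_upwards [(chartAt E x₀).open_source.mem_nhds hx] with y hy
  exact tangentCoord_constField hy w

theorem mdifferentiableAt_constField {x₀ x : M} (hx : x ∈ (chartAt E x₀).source) (w : E) :
    MDiffAt (T% (constField E x₀ w)) x :=
  (contMDiffAt_constField hx w).mdifferentiableAt (by simp)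

theorem constField_add {x₀ x : M} (hx : x ∈ (chartAt E x₀).source) (w w' : E) :
    constField E x₀ (w + w') x = constField E x₀ w x + constField E x₀ w' x := by
  refine tangentCoord_injective hx ?_
  erw [map_add]
  rw [tangentCoord_constField hx, tangentCoord_constField hx, tangentCoord_constField hx]

theorem constField_smul {x₀ x : M} (hx : x ∈ (chartAt E x₀).source) (a : ℝ) (w : E) :
    constField E x₀ (a • w) x = a • constField E x₀ w x := by
  refine tangentCoord_injective hx ?_
  erw [map_smul]
  rw [tangentCoord_constField hx, tangentCoord_constField hx]

section Along

variable {F : Type*} [NormedAddCommGroup F] [NormedSpace ℝ F]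
    {P : Type*} [TopologicalSpace P] [ChartedSpace F P]

variable (E F) in
/-- The vector field `V` along the map `f` is differentiable at `y`. -/
def MDiffAlong (f : P → M) (V : P → E) (y : P) : Prop :=
  MDifferentiableAt 𝓘(ℝ, F) 𝓘(ℝ, E).tangent
    (fun z ↦ (⟨f z, V z⟩ : TangentBundle 𝓘(ℝ, E) M)) y

/-- The trivialization at `x₀` is arbitrary here; this freedom is needed because `covDerivAlong`
uses a different chart at every point of a curve. -/
theorem mdiffAlong_iff {f : P → M} {V : P → E} {y : P} {x₀ : M}
    (hx : f y ∈ (chartAt E x₀).source) :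
    MDiffAlong E F f V y ↔ MDifferentiableAt 𝓘(ℝ, F) 𝓘(ℝ, E) f y ∧
      MDifferentiableAt 𝓘(ℝ, F) 𝓘(ℝ, E) (fun z ↦ tangentCoord E x₀ (f z) (V z)) y := by
  have := (trivializationAt E (TangentSpace 𝓘(ℝ, E)) x₀).mdifferentiableAt_totalSpace_iff
    (IM := 𝓘(ℝ, F)) (IB := 𝓘(ℝ, E)) (fun z ↦ (⟨f z, V z⟩ : TangentBundle 𝓘(ℝ, E) M)) (x₀ := y) hx
  exact this

theorem MDiffAlong.base {f : P → M} {V : P → E} {y : P} (h : MDiffAlong E F f V y) :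
    MDifferentiableAt 𝓘(ℝ, F) 𝓘(ℝ, E) f y :=
  ((mdiffAlong_iff (mem_chart_source E (f y))).1 h).1

theorem MDiffAlong.coord {f : P → M} {V : P → E} {y : P} (h : MDiffAlong E F f V y) {x₀ : M}
    (hx : f y ∈ (chartAt E x₀).source) :
    MDifferentiableAt 𝓘(ℝ, F) 𝓘(ℝ, E) (fun z ↦ tangentCoord E x₀ (f z) (V z)) y :=
  ((mdiffAlong_iff hx).1 h).2

/-- The coordinate change of tangent vectors from the trivialization at `x₁` to the one at `x₀`. -/
theorem contMDiffAt_tangentCoordChange {x₀ x₁ x : M} (h₀ : x ∈ (chartAt E x₀).source)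
    (h₁ : x ∈ (chartAt E x₁).source) :
    ContMDiffAt 𝓘(ℝ, E) 𝓘(ℝ, E →L[ℝ] E) ∞ (tangentCoordChange 𝓘(ℝ, E) x₁ x₀) x := by
  have h := contMDiffAt_coordChangeL (IB := 𝓘(ℝ, E)) (n := ∞)
    (e := trivializationAt E (TangentSpace 𝓘(ℝ, E)) x₁)
    (e' := trivializationAt E (TangentSpace 𝓘(ℝ, E)) x₀) (x := x) h₁ h₀
  refine h.congr_of_eventuallyEq ?_
  filter_upwards [(chartAt E x₀).open_source.mem_nhds h₀,
    (chartAt E x₁).open_source.mem_nhds h₁] with y hy₀ hy₁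
  ext v
  have := Trivialization.coordChangeL_apply (R := ℝ)
    (trivializationAt E (TangentSpace 𝓘(ℝ, E)) x₁)
    (trivializationAt E (TangentSpace 𝓘(ℝ, E)) x₀) (b := y) ⟨hy₁, hy₀⟩ v
  refine .trans ?_ this.symm
  change _ = tangentCoord E x₀ y (constField E x₁ v y)
  have e : v = tangentCoord E x₁ y (constField E x₁ v y) := (tangentCoord_constField hy₁ v).symm
  conv_lhs => rw [e]
  refine tangentCoordChange_comp ?_
  simp [hy₀, hy₁]

theorem tangentCoordChange_tangentCoord {x₀ x₁ x : M} (h₀ : x ∈ (chartAt E x₀).source)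
    (h₁ : x ∈ (chartAt E x₁).source) (v : E) :
    tangentCoordChange 𝓘(ℝ, E) x₁ x₀ x (tangentCoord E x₁ x v) = tangentCoord E x₀ x v :=
  tangentCoordChange_comp (by simp [h₀, h₁])

end Along

end TangentCoordinates

/-! ### The Levi-Civita derivative in coordinates. -/

section CovariantCalculus

variable {E : Type*} [NormedAddCommGroup E] [NormedSpace ℝ E] [FiniteDimensional ℝ E]
  {M : Type*} [TopologicalSpace M] [ChartedSpace E M] [IsManifold 𝓘(ℝ, E) ∞ M]
  [RiemannianBundle (fun x : M ↦ TangentSpace 𝓘(ℝ, E) x)]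
  [IsContMDiffRiemannianBundle 𝓘(ℝ, E) ∞ E (fun x : M ↦ TangentSpace 𝓘(ℝ, E) x)]

variable (E) in
/-- The inner product of two tangent vectors at `x`, given as elements of the model space. -/
def tangentInner (x : M) (v w : E) : ℝ :=
  inner ℝ (show TangentSpace 𝓘(ℝ, E) x from v) (show TangentSpace 𝓘(ℝ, E) x from w)

variable (E) in
/-- The Levi-Civita derivative as an element of the model space. -/
def leviCivitaModel (σ : Π x : M, TangentSpace 𝓘(ℝ, E) x) (x : M) : E →L[ℝ] E :=
  leviCivita σ x

variable (E) in
/-- The derivative, in the direction `u`, of the field with constant coordinates `w`. -/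
def christoffel (x₀ x : M) (u w : E) : E :=
  tangentCoord E x₀ x (leviCivitaModel E (constField E x₀ w) x u)

theorem christoffel_add_left (x₀ x : M) (u u' w : E) :
    christoffel E x₀ x (u + u') w = christoffel E x₀ x u w + christoffel E x₀ x u' w := by
  simp [christoffel]

theorem christoffel_smul_left (x₀ x : M) (a : ℝ) (u w : E) :
    christoffel E x₀ x (a • u) w = a • christoffel E x₀ x u w := by
  simp [christoffel]

theorem leviCivitaModel_congr {σ σ' : Π x : M, TangentSpace 𝓘(ℝ, E) x} {x : M}
    (hσ : MDiffAt (T% σ) x) (hσ' : MDiffAt (T% σ') x) (h : ∀ᶠ y in nhds x, σ y = σ' y) :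
    leviCivitaModel E σ x = leviCivitaModel E σ' x :=
  leviCivita.isCovariantDerivativeOnUniv.congr_of_eventuallyEq hσ hσ' Filter.univ_mem h

theorem leviCivitaModel_add {σ σ' : Π x : M, TangentSpace 𝓘(ℝ, E) x} {x : M}
    (hσ : MDiffAt (T% σ) x) (hσ' : MDiffAt (T% σ') x) :
    leviCivitaModel E (σ + σ') x = leviCivitaModel E σ x + leviCivitaModel E σ' x :=
  leviCivita.isCovariantDerivativeOnUniv.add hσ hσ'

theorem leviCivitaModel_smul {σ : Π x : M, TangentSpace 𝓘(ℝ, E) x} {g : M → ℝ} {x : M}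
    (hσ : MDiffAt (T% σ) x) (hg : MDiffAt g x) (v : E) :
    leviCivitaModel E (g • σ) x v = g x • leviCivitaModel E σ x v
      + (mvfderiv 𝓘(ℝ, E) g x v) • (show E from σ x) :=
  congrArg (fun L : TangentSpace 𝓘(ℝ, E) x →L[ℝ] TangentSpace 𝓘(ℝ, E) x ↦ (L v : E))
    (leviCivita.isCovariantDerivativeOnUniv.leibniz hσ hg)

/-- Additivity of `constField` holds only over the chart domain, so this rests on the locality of
the connection. In the slot `u` linearity needs no such condition. -/
theorem christoffel_add_right {x₀ x : M} (hx : x ∈ (chartAt E x₀).source) (u w w' : E) :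
    christoffel E x₀ x u (w + w') = christoffel E x₀ x u w + christoffel E x₀ x u w' := by
  have h1 := mdifferentiableAt_constField hx w
  have h2 := mdifferentiableAt_constField hx w'
  unfold christoffel
  rw [leviCivitaModel_congr (mdifferentiableAt_constField hx (w + w'))
    (mdifferentiableAt_add_section h1 h2), leviCivitaModel_add h1 h2]
  · simp
  · filter_upwards [(chartAt E x₀).open_source.mem_nhds hx] with y hy using constField_add hy w w'

theorem christoffel_smul_right {x₀ x : M} (hx : x ∈ (chartAt E x₀).source) (a : ℝ) (u w : E) :
    christoffel E x₀ x u (a • w) = a • christoffel E x₀ x u w := by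
  have h1 := mdifferentiableAt_constField hx w
  have ha : MDiffAt (fun _ : M ↦ a) x := mdifferentiableAt_const
  unfold christoffel
  rw [leviCivitaModel_congr (mdifferentiableAt_constField hx (a • w))
    (ha.smul_section h1), leviCivitaModel_smul h1 ha]
  · have h0 : mvfderiv 𝓘(ℝ, E) (fun _ : M ↦ a) x u = 0 := by rw [mvfderiv_const]; rfl
    rw [h0, zero_smul, add_zero, map_smul]
  · filter_upwards [(chartAt E x₀).open_source.mem_nhds hx] with y hy using constField_smul hy a w

theorem mdifferentiableAt_sum_smul_section {ι : Type*} (s : Finset ι) {g : ι → M → ℝ}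
    {σ : ι → Π x : M, TangentSpace 𝓘(ℝ, E) x} {x : M} (hg : ∀ i, MDiffAt (g i) x)
    (hσ : ∀ i, MDiffAt (T% (σ i)) x) : MDiffAt (T% (∑ i ∈ s, g i • σ i)) x := by
  classical
  induction s using Finset.induction_on with
  | empty => exact mdifferentiableAt_zeroSection (F := E) ℝ (TangentSpace 𝓘(ℝ, E))
  | insert i s hi ih =>
    rw [Finset.sum_insert hi]
    exact mdifferentiableAt_add_section ((hg i).smul_section (hσ i)) ih

theorem leviCivitaModel_sum_smul {ι : Type*} (s : Finset ι) {g : ι → M → ℝ}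
    {σ : ι → Π x : M, TangentSpace 𝓘(ℝ, E) x} {x : M} (hg : ∀ i, MDiffAt (g i) x)
    (hσ : ∀ i, MDiffAt (T% (σ i)) x) (v : E) :
    leviCivitaModel E (∑ i ∈ s, g i • σ i) x v = ∑ i ∈ s, (g i x • leviCivitaModel E (σ i) x v
      + (mvfderiv 𝓘(ℝ, E) (g i) x v) • (show E from σ i x)) := by
  classical
  induction s using Finset.induction_on with
  | empty =>
    have : leviCivitaModel E (0 : Π x : M, TangentSpace 𝓘(ℝ, E) x) x = 0 :=
      congrFun leviCivita.zero x
    simp [this]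
  | insert i s hi ih =>
    rw [Finset.sum_insert hi, Finset.sum_insert hi, leviCivitaModel_add
      ((hg i).smul_section (hσ i)) (mdifferentiableAt_sum_smul_section s hg hσ),
      add_apply, ih, leviCivitaModel_smul (hσ i) (hg i)]

theorem mvfderiv_clm_comp {F F' : Type*} [NormedAddCommGroup F] [NormedSpace ℝ F]
    [NormedAddCommGroup F'] [NormedSpace ℝ F'] {H : Type*} [NormedAddCommGroup H] [NormedSpace ℝ H]
    {P : Type*} [TopologicalSpace P] [ChartedSpace H P]
    (L : F →L[ℝ] F') {g : P → F} {x : P} (hg : MDifferentiableAt 𝓘(ℝ, H) 𝓘(ℝ, F) g x) (v : H) :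
    mvfderiv 𝓘(ℝ, H) (fun y ↦ L (g y)) x v = L (mvfderiv 𝓘(ℝ, H) g x v) := by
  have h := (L.hasMFDerivAt (x := g x)).comp x hg.hasMFDerivAt
  change mfderiv 𝓘(ℝ, H) 𝓘(ℝ, F') (fun y ↦ L (g y)) x v = _
  erw [h.mfderiv]
  rfl

theorem mdifferentiableAt_clm_comp {F F' : Type*} [NormedAddCommGroup F] [NormedSpace ℝ F]
    [NormedAddCommGroup F'] [NormedSpace ℝ F'] {H : Type*} [NormedAddCommGroup H] [NormedSpace ℝ H]
    {P : Type*} [TopologicalSpace P] [ChartedSpace H P]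
    (L : F →L[ℝ] F') {g : P → F} {x : P} (hg : MDifferentiableAt 𝓘(ℝ, H) 𝓘(ℝ, F) g x) :
    MDifferentiableAt 𝓘(ℝ, H) 𝓘(ℝ, F') (fun y ↦ L (g y)) x :=
  L.mdifferentiableAt.comp x hg

/-- The Levi-Civita derivative in the coordinates of the trivialization at `x₀`. -/
theorem tangentCoord_leviCivita {x₀ x : M} (hx : x ∈ (chartAt E x₀).source)
    {σ : Π x : M, TangentSpace 𝓘(ℝ, E) x} (hσ : MDiffAt (T% σ) x) (v : E) :
    tangentCoord E x₀ x (leviCivitaModel E σ x v)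
      = mvfderiv 𝓘(ℝ, E) (fun y ↦ tangentCoord E x₀ y (σ y)) x v
        + christoffel E x₀ x v (tangentCoord E x₀ x (σ x)) := by
  let b := Module.finBasis ℝ E
  let c : E → Fin (Module.finrank ℝ E) → ℝ := fun w i ↦ b.repr w i
  let φ : M → E := fun y ↦ tangentCoord E x₀ y (σ y)
  have hφ : MDifferentiableAt 𝓘(ℝ, E) 𝓘(ℝ, E) φ x := MDiffAlong.coord (V := σ) hσ hx
  let L : Fin (Module.finrank ℝ E) → E →L[ℝ] ℝ := fun i ↦ (b.coord i).toContinuousLinearMap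
  have hb : ∀ w : E, ∑ i, L i w • b i = w := fun w ↦ b.sum_repr w
  have hg : ∀ i, MDiffAt (fun y ↦ L i (φ y)) x := fun i ↦ mdifferentiableAt_clm_comp (L i) hφ
  have hσ' := fun i ↦ mdifferentiableAt_constField hx (b i)
  have hsum : ∀ y ∈ (chartAt E x₀).source, ∀ w : Fin (Module.finrank ℝ E) → ℝ,
      constField E x₀ (∑ i, w i • b i) y = ∑ i, w i • constField E x₀ (b i) y := by
    intro y hy w
    let T : E →ₗ[ℝ] TangentSpace 𝓘(ℝ, E) y :=
      { toFun := fun w ↦ constField E x₀ w y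
        map_add' := constField_add hy
        map_smul' := constField_smul hy }
    exact (map_sum T (fun i ↦ w i • b i) Finset.univ).trans
      (Finset.sum_congr rfl fun i _ ↦ T.map_smul (w i) (b i))
  -- Near `x` the section is a combination of constant-coordinate fields with differentiable
  -- coefficients; the Leibniz rule then separates derivatives of coefficients from Christoffel
  -- terms.
  have hev : ∀ᶠ y in nhds x, σ y = (∑ i, (fun y ↦ L i (φ y)) • constField E x₀ (b i)) y := by
    filter_upwards [(chartAt E x₀).open_source.mem_nhds hx] with y hy
    rw [← constField_tangentCoord hy (σ y), Finset.sum_apply]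
    change constField E x₀ (φ y) y = _
    rw [← hb (φ y), hsum y hy]
    rfl
  rw [leviCivitaModel_congr hσ (mdifferentiableAt_sum_smul_section _ hg hσ') hev,
    leviCivitaModel_sum_smul _ hg hσ', map_sum]
  have hchr : christoffel E x₀ x v (φ x) = ∑ i, L i (φ x) • christoffel E x₀ x v (b i) := by
    let T : E →ₗ[ℝ] E :=
      { toFun := fun w ↦ christoffel E x₀ x v w
        map_add' := christoffel_add_right hx v
        map_smul' := fun a w ↦ christoffel_smul_right hx a v w }
    refine (congrArg T (hb (φ x)).symm).trans ?_
    exact (map_sum T (fun i ↦ L i (φ x) • b i) Finset.univ).trans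
      (Finset.sum_congr rfl fun i _ ↦ T.map_smul (L i (φ x)) (b i))
  change _ = mvfderiv 𝓘(ℝ, E) φ x v + christoffel E x₀ x v (φ x)
  rw [hchr, ← hb (mvfderiv 𝓘(ℝ, E) φ x v), ← Finset.sum_add_distrib]
  refine Finset.sum_congr rfl fun i _ ↦ ?_
  rw [map_add, map_smul, map_smul, mvfderiv_clm_comp _ hφ]
  erw [tangentCoord_constField hx (b i)]
  exact add_comm _ _

section Along

variable {F : Type*} [NormedAddCommGroup F] [NormedSpace ℝ F]
    {P : Type*} [TopologicalSpace P] [ChartedSpace F P]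

variable (E F) in
/-- The covariant derivative along a map, with values in the model space. -/
def covAlong (f : P → M) (V : P → E) (y : P) : F →L[ℝ] E :=
  (mvfderiv 𝓘(ℝ, F) (fun z ↦ tangentCoord E (f y) (f z) (V z)) y : F →L[ℝ] E)
    + leviCivitaModel E (constField E (f y) (V y)) (f y) ∘L
      (mfderiv 𝓘(ℝ, F) 𝓘(ℝ, E) f y : F →L[ℝ] E)

/-- The trivialization is centred at `f y` itself, where it is the identity on the fibre, so `symmL`
disappears. -/
theorem covDerivAlong_eq_covAlong (f : P → M) (V : P → E) (y : P) (v : F) :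
    (covDerivAlong f V y v : E) = covAlong E F f V y v := by
  have h : ∀ w : E, ((trivializationAt E (TangentSpace 𝓘(ℝ, E)) (f y)).symmL ℝ (f y) w : E) = w :=
    fun w ↦ (Trivialization.symmL_apply _ (mem_chart_source E (f y)) w).trans
      (constField_self (E := E) (f y) w)
  refine congrArg₂ (fun a b : E ↦ a + b) (h _) ?_
  exact congrArg (fun σ ↦ leviCivitaModel E σ (f y) _) (extend_eq_constField (f y) (V y))

end Along

end CovariantCalculus

/-! ### Product and chain rules for functions on a manifold with values in a normed space. -/

section ModelDerivatives

variable {H : Type*} [NormedAddCommGroup H] [NormedSpace ℝ H]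
  {P : Type*} [TopologicalSpace P] [ChartedSpace H P]
  {F F' : Type*} [NormedAddCommGroup F] [NormedSpace ℝ F] [NormedAddCommGroup F'] [NormedSpace ℝ F']

theorem mdifferentiableAt_clm_apply {A : P → F →L[ℝ] F'} {a : P → F} {y : P}
    (hA : MDifferentiableAt 𝓘(ℝ, H) 𝓘(ℝ, F →L[ℝ] F') A y)
    (ha : MDifferentiableAt 𝓘(ℝ, H) 𝓘(ℝ, F) a y) :
    MDifferentiableAt 𝓘(ℝ, H) 𝓘(ℝ, F') (fun z ↦ A z (a z)) y :=
  hA.clm_apply ha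

theorem mvfderiv_clm_apply {A : P → F →L[ℝ] F'} {a : P → F} {y : P}
    (hA : MDifferentiableAt 𝓘(ℝ, H) 𝓘(ℝ, F →L[ℝ] F') A y)
    (ha : MDifferentiableAt 𝓘(ℝ, H) 𝓘(ℝ, F) a y) (v : H) :
    mvfderiv 𝓘(ℝ, H) (fun z ↦ A z (a z)) y v
      = (mvfderiv 𝓘(ℝ, H) A y v) (a y) + A y (mvfderiv 𝓘(ℝ, H) a y v) := by
  have h1 : HasMFDerivAt 𝓘(ℝ, H) 𝓘(ℝ, (F →L[ℝ] F') × F) (fun z ↦ (A z, a z)) y _ :=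
    ⟨hA.hasMFDerivAt.1.prodMk ha.hasMFDerivAt.1,
      HasFDerivWithinAt.prodMk hA.hasMFDerivAt.2 ha.hasMFDerivAt.2⟩
  have h2 : HasFDerivAt (fun p : (F →L[ℝ] F') × F ↦ p.1 p.2) _ (A y, a y) :=
    (isBoundedBilinearMap_apply (𝕜 := ℝ) (E := F) (F := F')).hasFDerivAt (A y, a y)
  have h := h2.hasMFDerivAt.comp y h1
  change mfderiv 𝓘(ℝ, H) 𝓘(ℝ, F') (fun z ↦ A z (a z)) y v = _
  erw [h.mfderiv]
  exact add_comm _ _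

theorem mvfderiv_congr {a a' : P → F} {y : P} (h : a =ᶠ[nhds y] a') :
    mvfderiv 𝓘(ℝ, H) a y = mvfderiv 𝓘(ℝ, H) a' y := by
  ext v
  have := h.mfderiv_eq (I := 𝓘(ℝ, H)) (I' := 𝓘(ℝ, F))
  exact congrArg (fun L : H →L[ℝ] F ↦ L v) this

theorem mvfderiv_fun_comp {H' : Type*} [NormedAddCommGroup H'] [NormedSpace ℝ H']
    {Q : Type*} [TopologicalSpace Q] [ChartedSpace H' Q] {a : P → F} {c : Q → P} {y : Q}
    (ha : MDifferentiableAt 𝓘(ℝ, H) 𝓘(ℝ, F) a (c y))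
    (hc : MDifferentiableAt 𝓘(ℝ, H') 𝓘(ℝ, H) c y) (v : H') :
    mvfderiv 𝓘(ℝ, H') (fun z ↦ a (c z)) y v
      = mvfderiv 𝓘(ℝ, H) a (c y) (mfderiv 𝓘(ℝ, H') 𝓘(ℝ, H) c y v) := by
  have h := ha.hasMFDerivAt.comp y hc.hasMFDerivAt
  change mfderiv 𝓘(ℝ, H') 𝓘(ℝ, F) (fun z ↦ a (c z)) y v = _
  erw [h.mfderiv]
  rfl

end ModelDerivatives

/-! ### Covariant derivatives along maps: independence of the chart and chain rule. -/

section CovariantCalculus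

variable {E : Type*} [NormedAddCommGroup E] [NormedSpace ℝ E] [FiniteDimensional ℝ E]
  {M : Type*} [TopologicalSpace M] [ChartedSpace E M] [IsManifold 𝓘(ℝ, E) ∞ M]
  [RiemannianBundle (fun x : M ↦ TangentSpace 𝓘(ℝ, E) x)]
  [IsContMDiffRiemannianBundle 𝓘(ℝ, E) ∞ E (fun x : M ↦ TangentSpace 𝓘(ℝ, E) x)]
  {F : Type*} [NormedAddCommGroup F] [NormedSpace ℝ F]
  {P : Type*} [TopologicalSpace P] [ChartedSpace F P]

/-- The covariant derivative along a map, in the coordinates of the trivialization at `x₀`. -/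
theorem tangentCoord_covAlong {f : P → M} {V : P → E} {y : P} {x₀ : M}
    (hx : f y ∈ (chartAt E x₀).source) (hV : MDiffAlong E F f V y) (v : F) :
    tangentCoord E x₀ (f y) (covAlong E F f V y v)
      = mvfderiv 𝓘(ℝ, F) (fun z ↦ tangentCoord E x₀ (f z) (V z)) y v
        + christoffel E x₀ (f y) (mfderiv 𝓘(ℝ, F) 𝓘(ℝ, E) f y v) (tangentCoord E x₀ (f y) (V y)) := by
  have hx' := mem_chart_source E (f y)
  have hf := hV.base
  have hT := (contMDiffAt_tangentCoordChange hx hx').mdifferentiableAt (by simp)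
  have hφ := hV.coord hx'
  have hTf : MDifferentiableAt 𝓘(ℝ, F) 𝓘(ℝ, E →L[ℝ] E)
    (fun z ↦ tangentCoordChange 𝓘(ℝ, E) (f y) x₀ (f z)) y := hT.comp y hf
  have hev : (fun z ↦ tangentCoord E x₀ (f z) (V z)) =ᶠ[nhds y]
      fun z ↦ tangentCoordChange 𝓘(ℝ, E) (f y) x₀ (f z) (tangentCoord E (f y) (f z) (V z)) := by
    filter_upwards [hf.continuousAt ((chartAt E x₀).open_source.mem_nhds hx),
      hf.continuousAt ((chartAt E (f y)).open_source.mem_nhds hx')] with z hz hz'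
    exact (tangentCoordChange_tangentCoord hz hz' _).symm
  rw [mvfderiv_congr hev, mvfderiv_clm_apply hTf hφ, mvfderiv_fun_comp hT hf]
  set u : E := mfderiv 𝓘(ℝ, F) 𝓘(ℝ, E) f y v with hu
  -- The product rule has produced the derivative of the transition map. The same derivative appears
  -- in the connection formula for the field that is constant in the chart at `f y`, which has
  -- coordinates `T x (V y)` in the chart at `x₀`; this trades it for Christoffel terms.
  have hL := tangentCoord_leviCivita hx (mdifferentiableAt_constField hx' (V y)) u
  have hev2 : (fun x ↦ tangentCoord E x₀ x (constField E (f y) (V y) x)) =ᶠ[nhds (f y)]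
      fun x ↦ tangentCoordChange 𝓘(ℝ, E) (f y) x₀ x (V y) := by
    filter_upwards [(chartAt E x₀).open_source.mem_nhds hx,
      (chartAt E (f y)).open_source.mem_nhds hx'] with z hz hz'
    refine (tangentCoordChange_tangentCoord hz hz' _).symm.trans ?_
    exact congrArg _ (tangentCoord_constField hz' _)
  rw [mvfderiv_congr hev2, mvfderiv_clm_apply hT mdifferentiableAt_const] at hL
  have h0 : mvfderiv 𝓘(ℝ, E) (fun _ : M ↦ V y) (f y) u = 0 := by rw [mvfderiv_const]; rfl
  rw [h0, map_zero, add_zero] at hL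
  have h1 : covAlong E F f V y v = mvfderiv 𝓘(ℝ, F) (fun z ↦ tangentCoord E (f y) (f z) (V z)) y v
    + leviCivitaModel E (constField E (f y) (V y)) (f y) u := rfl
  rw [h1, map_add, hL, constField_self, tangentCoord_self]
  have h2 : ∀ w : E, tangentCoordChange 𝓘(ℝ, E) (f y) x₀ (f y) w = tangentCoord E x₀ (f y) w :=
    fun w ↦ rfl
  rw [h2]
  abel

theorem covAlong_congr {f f' : P → M} {V V' : P → E} {y : P} (hf : f =ᶠ[nhds y] f')
    (hV : V =ᶠ[nhds y] V') : covAlong E F f V y = covAlong E F f' V' y := by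
  unfold covAlong
  rw [hf.mfderiv_eq, hf.self_of_nhds, hV.self_of_nhds]
  congr 1
  refine mvfderiv_congr ?_
  filter_upwards [hf, hV] with z h1 h2
  rw [h1, h2]

theorem MDiffAlong.congr {f f' : P → M} {V V' : P → E} {y : P} (h : MDiffAlong E F f V y)
    (hf : f =ᶠ[nhds y] f') (hV : V =ᶠ[nhds y] V') : MDiffAlong E F f' V' y := by
  refine MDifferentiableAt.congr_of_eventuallyEq h ?_
  filter_upwards [hf, hV] with z h1 h2
  rw [h1, h2]

theorem MDiffAlong.comp {H : Type*} [NormedAddCommGroup H] [NormedSpace ℝ H]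
    {Q : Type*} [TopologicalSpace Q] [ChartedSpace H Q] {f : P → M} {V : P → E} {c : Q → P} {y : Q}
    (hV : MDiffAlong E F f V (c y)) (hc : MDifferentiableAt 𝓘(ℝ, H) 𝓘(ℝ, F) c y) :
    MDiffAlong E H (fun z ↦ f (c z)) (fun z ↦ V (c z)) y :=
  MDifferentiableAt.comp y hV hc

/-- The chain rule for covariant derivatives along maps. -/
theorem covAlong_comp {H : Type*} [NormedAddCommGroup H] [NormedSpace ℝ H]
    {Q : Type*} [TopologicalSpace Q] [ChartedSpace H Q] {f : P → M} {V : P → E} {c : Q → P} {y : Q}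
    (hV : MDiffAlong E F f V (c y)) (hc : MDifferentiableAt 𝓘(ℝ, H) 𝓘(ℝ, F) c y) (v : H) :
    covAlong E H (fun z ↦ f (c z)) (fun z ↦ V (c z)) y v
      = covAlong E F f V (c y) (mfderiv 𝓘(ℝ, H) 𝓘(ℝ, F) c y v) := by
  have h1 := mvfderiv_fun_comp (hV.coord (mem_chart_source E (f (c y)))) hc v
  have h2 : (mfderiv 𝓘(ℝ, H) 𝓘(ℝ, E) (fun z ↦ f (c z)) y v : E)
      = mfderiv 𝓘(ℝ, F) 𝓘(ℝ, E) f (c y) (mfderiv 𝓘(ℝ, H) 𝓘(ℝ, F) c y v) :=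
    congrArg (fun L : H →L[ℝ] E ↦ L v) (mfderiv_comp y hV.base hc)
  exact congrArg₂ (fun a b : E ↦ a + leviCivitaModel E (constField E (f (c y)) (V (c y))) _ b) h1 h2

theorem covAlong_section {σ : Π x : M, TangentSpace 𝓘(ℝ, E) x} {x : M} (hσ : MDiffAt (T% σ) x)
    (v : E) : covAlong E E (fun x : M ↦ x) σ x v = leviCivitaModel E σ x v := by
  refine tangentCoord_injective (mem_chart_source E x) ?_
  rw [tangentCoord_leviCivita (mem_chart_source E x) hσ]
  refine (tangentCoord_covAlong (f := fun x : M ↦ x) (mem_chart_source E x) hσ v).trans ?_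
  have : (mfderiv 𝓘(ℝ, E) 𝓘(ℝ, E) (fun x : M ↦ x) x v : E) = v :=
    congrArg (fun L : E →L[ℝ] E ↦ L v) mfderiv_id
  rw [this]

theorem covAlong_section_comp {σ : Π x : M, TangentSpace 𝓘(ℝ, E) x} {f : P → M}
    {y : P} (hσ : MDiffAt (T% σ) (f y)) (hf : MDifferentiableAt 𝓘(ℝ, F) 𝓘(ℝ, E) f y) (v : F) :
    covAlong E F f (fun z ↦ σ (f z)) y v
      = leviCivitaModel E σ (f y) (mfderiv 𝓘(ℝ, F) 𝓘(ℝ, E) f y v) :=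
  (covAlong_comp (f := fun x : M ↦ x) (V := σ) hσ hf v).trans (covAlong_section hσ _)

end CovariantCalculus

/-- This justifies bundling the metric and the Christoffel symbols as finite sums over a basis,
whose smoothness can be checked coefficient by coefficient, although bilinearity itself holds only
over a chart domain. -/
theorem sum_basis_bilinear {E F ι : Type*} [AddCommGroup E] [Module ℝ E] [AddCommGroup F] [Module ℝ F]
    [Fintype ι] (b : Module.Basis ι ℝ E) (B : E → E → F)
    (add_left : ∀ u u' w, B (u + u') w = B u w + B u' w)
    (smul_left : ∀ (a : ℝ) u w, B (a • u) w = a • B u w)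
    (add_right : ∀ u w w', B u (w + w') = B u w + B u w')
    (smul_right : ∀ (a : ℝ) u w, B u (a • w) = a • B u w) (u w : E) :
    ∑ i, ∑ j, b.repr u i • b.repr w j • B (b i) (b j) = B u w := by
  have h : B u w = LinearMap.mk₂ ℝ B add_left smul_left add_right smul_right
    (∑ i, b.repr u i • b i) (∑ j, b.repr w j • b j) := by
    rw [b.sum_repr, b.sum_repr]; rfl
  rw [h]
  simp only [map_sum, LinearMap.sum_apply, map_smul, LinearMap.smul_apply, LinearMap.mk₂_apply,
    Finset.smul_sum]
  rw [Finset.sum_comm]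
  exact Finset.sum_congr rfl fun i _ ↦ Finset.sum_congr rfl fun j _ ↦ smul_comm ..

/-! ### The metric in coordinates and its compatibility with derivatives along maps. -/

section Metric

variable {E : Type*} [NormedAddCommGroup E] [NormedSpace ℝ E] [FiniteDimensional ℝ E]
  {M : Type*} [TopologicalSpace M] [ChartedSpace E M] [IsManifold 𝓘(ℝ, E) ∞ M]
  [RiemannianBundle (fun x : M ↦ TangentSpace 𝓘(ℝ, E) x)]

theorem tangentInner_comm (x : M) (v w : E) : tangentInner E x v w = tangentInner E x w v :=
  real_inner_comm _ _

theorem tangentInner_add_left (x : M) (v v' w : E) :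
    tangentInner E x (v + v') w = tangentInner E x v w + tangentInner E x v' w :=
  inner_add_left (E := TangentSpace 𝓘(ℝ, E) x) _ _ _

theorem tangentInner_add_right (x : M) (v w w' : E) :
    tangentInner E x v (w + w') = tangentInner E x v w + tangentInner E x v w' :=
  inner_add_right (E := TangentSpace 𝓘(ℝ, E) x) _ _ _

theorem tangentInner_smul_left (x : M) (a : ℝ) (v w : E) :
    tangentInner E x (a • v) w = a * tangentInner E x v w :=
  real_inner_smul_left (F := TangentSpace 𝓘(ℝ, E) x) _ _ _

theorem tangentInner_smul_right (x : M) (a : ℝ) (v w : E) :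
    tangentInner E x v (a • w) = a * tangentInner E x v w :=
  real_inner_smul_right (F := TangentSpace 𝓘(ℝ, E) x) _ _ _

theorem tangentInner_zero_left (x : M) (w : E) : tangentInner E x 0 w = 0 :=
  inner_zero_left (E := TangentSpace 𝓘(ℝ, E) x) _

theorem tangentInner_zero_right (x : M) (w : E) : tangentInner E x w 0 = 0 :=
  inner_zero_right (E := TangentSpace 𝓘(ℝ, E) x) _

theorem tangentInner_neg_right (x : M) (v w : E) :
    tangentInner E x v (-w) = -tangentInner E x v w :=
  inner_neg_right (E := TangentSpace 𝓘(ℝ, E) x) _ _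

theorem tangentInner_sub_left (x : M) (v v' w : E) :
    tangentInner E x (v - v') w = tangentInner E x v w - tangentInner E x v' w :=
  inner_sub_left (E := TangentSpace 𝓘(ℝ, E) x) _ _ _

theorem tangentInner_self_eq_zero {x : M} {v : E} : tangentInner E x v v = 0 ↔ v = 0 :=
  inner_self_eq_zero (𝕜 := ℝ) (E := TangentSpace 𝓘(ℝ, E) x)

theorem ext_tangentInner {x : M} {v w : E}
    (h : ∀ z, tangentInner E x v z = tangentInner E x w z) : v = w :=
  ext_inner_right (E := TangentSpace 𝓘(ℝ, E) x) ℝ h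

/-- The metric in the coordinates of the trivialization at `x₀`. -/
def metricCoord (x₀ x : M) : E →L[ℝ] E →L[ℝ] ℝ :=
  ∑ i, ∑ j, tangentInner E x (constField E x₀ (Module.finBasis ℝ E i) x)
      (constField E x₀ (Module.finBasis ℝ E j) x) •
    ((Module.finBasis ℝ E).coord i).toContinuousLinearMap.smulRight
      ((Module.finBasis ℝ E).coord j).toContinuousLinearMap

theorem metricCoord_apply {x₀ x : M} (hx : x ∈ (chartAt E x₀).source) (a c : E) :
    metricCoord x₀ x a c = tangentInner E x (constField E x₀ a x) (constField E x₀ c x) := by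
  rw [← sum_basis_bilinear (Module.finBasis ℝ E)
    (fun a c : E ↦ tangentInner E x (constField E x₀ a x) (constField E x₀ c x))
    (fun u u' w ↦ (congrArg (fun z ↦ tangentInner E x z (constField E x₀ w x))
      (constField_add hx u u')).trans (tangentInner_add_left x _ _ _))
    (fun a u w ↦ (congrArg (fun z ↦ tangentInner E x z (constField E x₀ w x))
      (constField_smul hx a u)).trans (tangentInner_smul_left x _ _ _))
    (fun w u u' ↦ (congrArg (fun z ↦ tangentInner E x (constField E x₀ w x) z)
      (constField_add hx u u')).trans (tangentInner_add_right x _ _ _))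
    (fun a w u ↦ (congrArg (fun z ↦ tangentInner E x (constField E x₀ w x) z)
      (constField_smul hx a u)).trans (tangentInner_smul_right x _ _ _)) a c]
  simp only [metricCoord, sum_apply, smul_apply,
    ContinuousLinearMap.smulRight_apply, smul_eq_mul, LinearMap.coe_toContinuousLinearMap',
    Module.Basis.coord_apply]
  exact Finset.sum_congr rfl fun i _ ↦ Finset.sum_congr rfl fun j _ ↦ by ring

variable [IsContMDiffRiemannianBundle 𝓘(ℝ, E) ∞ E (fun x : M ↦ TangentSpace 𝓘(ℝ, E) x)]

theorem contMDiffAt_metricCoord {x₀ x : M} (hx : x ∈ (chartAt E x₀).source) :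
    ContMDiffAt 𝓘(ℝ, E) 𝓘(ℝ, E →L[ℝ] E →L[ℝ] ℝ) ∞ (metricCoord (E := E) x₀) x := by
  have h : ∀ i j, ContMDiffAt 𝓘(ℝ, E) 𝓘(ℝ, ℝ) ∞ (fun x : M ↦ tangentInner E x
      (constField E x₀ (Module.finBasis ℝ E i) x) (constField E x₀ (Module.finBasis ℝ E j) x)) x :=
    fun i j ↦ ContMDiffAt.inner_bundle (E := fun x : M ↦ TangentSpace 𝓘(ℝ, E) x) (F := E)
      (IB := 𝓘(ℝ, E)) (contMDiffAt_constField hx _) (contMDiffAt_constField hx _)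
  unfold metricCoord
  refine contMDiffAt_finsetSum fun i _ ↦ contMDiffAt_finsetSum fun j _ ↦ ?_
  exact (h i j).smul contMDiffAt_const

/-- Metric compatibility of the connection, applied to two constant-coordinate fields. It is what
turns the derivative of the coefficients of the metric into covariant derivatives along an arbitrary
map. -/
theorem mvfderiv_metricCoord {x₀ x : M} (hx : x ∈ (chartAt E x₀).source) (u a c : E) :
    mvfderiv 𝓘(ℝ, E) (metricCoord (E := E) x₀) x u a c
      = tangentInner E x (leviCivitaModel E (constField E x₀ a) x u) (constField E x₀ c x)
        + tangentInner E x (constField E x₀ a x) (leviCivitaModel E (constField E x₀ c) x u) := by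
  have hm := (contMDiffAt_metricCoord hx).mdifferentiableAt (by simp)
  have h1 := mvfderiv_clm_apply hm (mdifferentiableAt_const (c := a)) u
  have h2 := mvfderiv_clm_apply (mdifferentiableAt_clm_apply hm (mdifferentiableAt_const (c := a)))
    (mdifferentiableAt_const (c := c)) u
  have h0 : ∀ a : E, mvfderiv 𝓘(ℝ, E) (fun _ : M ↦ a) x u = 0 := fun a ↦ by
    rw [mvfderiv_const]; rfl
  rw [h1, h0, h0, map_zero, map_zero, add_zero, add_zero] at h2
  rw [← h2]
  have hev : (fun z ↦ metricCoord x₀ z a c) =ᶠ[nhds x]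
      fun z ↦ inner ℝ (constField E x₀ a z) (constField E x₀ c z) := by
    filter_upwards [(chartAt E x₀).open_source.mem_nhds hx] with z hz using metricCoord_apply hz a c
  rw [mvfderiv_congr hev]
  have := leviCivita_metric (X := extend E (show TangentSpace 𝓘(ℝ, E) x from u))
    (mdifferentiableAt_extend ..) (mdifferentiableAt_constField hx a)
    (mdifferentiableAt_constField hx c)
  rw [extend_apply_self] at this
  exact this

section Along

variable {F : Type*} [NormedAddCommGroup F] [NormedSpace ℝ F]
  {P : Type*} [TopologicalSpace P] [ChartedSpace F P]

theorem covAlong_apply (f : P → M) (V : P → E) (y : P) (v : F) :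
    covAlong E F f V y v = mvfderiv 𝓘(ℝ, F) (fun z ↦ tangentCoord E (f y) (f z) (V z)) y v
      + leviCivitaModel E (constField E (f y) (V y)) (f y) (mfderiv 𝓘(ℝ, F) 𝓘(ℝ, E) f y v) := rfl

theorem MDiffAlong.add {f : P → M} {V W : P → E} {y : P} (hV : MDiffAlong E F f V y)
    (hW : MDiffAlong E F f W y) : MDiffAlong E F f (fun z ↦ V z + W z) y := by
  have hx := mem_chart_source E (f y)
  refine (mdiffAlong_iff hx).2 ⟨hV.base, ?_⟩
  simp only [map_add]
  exact (hV.coord hx).add (hW.coord hx)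

theorem MDiffAlong.smul {f : P → M} {V : P → E} {a : P → ℝ} {y : P} (hV : MDiffAlong E F f V y)
    (ha : MDifferentiableAt 𝓘(ℝ, F) 𝓘(ℝ, ℝ) a y) : MDiffAlong E F f (fun z ↦ a z • V z) y := by
  have hx := mem_chart_source E (f y)
  refine (mdiffAlong_iff hx).2 ⟨hV.base, ?_⟩
  simp only [map_smul]
  exact ha.smul (hV.coord hx)

theorem covAlong_add {f : P → M} {V W : P → E} {y : P} (hV : MDiffAlong E F f V y)
    (hW : MDiffAlong E F f W y) (v : F) : covAlong E F f (fun z ↦ V z + W z) y v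
      = covAlong E F f V y v + covAlong E F f W y v := by
  have hx := mem_chart_source E (f y)
  refine tangentCoord_injective hx ?_
  rw [map_add, tangentCoord_covAlong hx hV, tangentCoord_covAlong hx hW,
    tangentCoord_covAlong hx (hV.add hW)]
  simp only [map_add]
  have hd : mvfderiv 𝓘(ℝ, F) (fun z ↦ tangentCoord E (f y) (f z) (V z)
      + tangentCoord E (f y) (f z) (W z)) y v = mvfderiv 𝓘(ℝ, F)
      (fun z ↦ tangentCoord E (f y) (f z) (V z)) y v + mvfderiv 𝓘(ℝ, F)
      (fun z ↦ tangentCoord E (f y) (f z) (W z)) y v :=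
    congrArg (fun L : F →L[ℝ] E ↦ L v) (mvfderiv_fun_add (hV.coord hx) (hW.coord hx))
  rw [hd]
  erw [christoffel_add_right hx]
  abel

theorem covAlong_smul {f : P → M} {V : P → E} {a : P → ℝ} {y : P} (hV : MDiffAlong E F f V y)
    (ha : MDifferentiableAt 𝓘(ℝ, F) 𝓘(ℝ, ℝ) a y) (v : F) : covAlong E F f (fun z ↦ a z • V z) y v
      = a y • covAlong E F f V y v + mvfderiv 𝓘(ℝ, F) a y v • V y := by
  have hx := mem_chart_source E (f y)
  refine tangentCoord_injective hx ?_
  rw [map_add, map_smul, map_smul, tangentCoord_covAlong hx hV,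
    tangentCoord_covAlong hx (hV.smul ha)]
  simp only [map_smul]
  have hd : mvfderiv 𝓘(ℝ, F) (fun z ↦ a z • tangentCoord E (f y) (f z) (V z)) y v
      = a y • mvfderiv 𝓘(ℝ, F) (fun z ↦ tangentCoord E (f y) (f z) (V z)) y v
        + mvfderiv 𝓘(ℝ, F) a y v • tangentCoord E (f y) (f y) (V y) :=
    congrArg (fun L : F →L[ℝ] E ↦ L v) (mvfderiv_fun_smul ha (hV.coord hx))
  rw [hd, smul_add]
  erw [christoffel_smul_right hx]
  abel

theorem covAlong_const_smul {f : P → M} {V : P → E} {y : P} (a : ℝ) (hV : MDiffAlong E F f V y)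
    (v : F) : covAlong E F f (fun z ↦ a • V z) y v = a • covAlong E F f V y v := by
  have h0 : mvfderiv 𝓘(ℝ, F) (fun _ : P ↦ a) y v = 0 := by rw [mvfderiv_const]; rfl
  rw [covAlong_smul (a := fun _ ↦ a) hV mdifferentiableAt_const, h0, zero_smul, add_zero]

theorem tangentInner_eventuallyEq_metricCoord {f : P → M} {V W : P → E} {y : P}
    (hf : ContinuousAt f y) : (fun z ↦ tangentInner E (f z) (V z) (W z)) =ᶠ[nhds y]
      fun z ↦ metricCoord (f y) (f z) (tangentCoord E (f y) (f z) (V z))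
        (tangentCoord E (f y) (f z) (W z)) := by
  filter_upwards [hf ((chartAt E (f y)).open_source.mem_nhds (mem_chart_source E (f y)))] with z hz
  rw [metricCoord_apply hz]
  have h1 := constField_tangentCoord hz (V z)
  have h2 := constField_tangentCoord hz (W z)
  exact (congrArg₂ (tangentInner E (f z)) h1 h2).symm

theorem mdifferentiableAt_tangentInner {f : P → M} {V W : P → E} {y : P}
    (hV : MDiffAlong E F f V y) (hW : MDiffAlong E F f W y) :
    MDifferentiableAt 𝓘(ℝ, F) 𝓘(ℝ, ℝ) (fun z ↦ tangentInner E (f z) (V z) (W z)) y := by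
  have hx := mem_chart_source E (f y)
  have hm := ((contMDiffAt_metricCoord hx).mdifferentiableAt (by simp)).comp y hV.base
  exact (mdifferentiableAt_clm_apply (mdifferentiableAt_clm_apply hm (hV.coord hx))
    (hW.coord hx)).congr_of_eventuallyEq
      (tangentInner_eventuallyEq_metricCoord hV.base.continuousAt)

/-- The covariant derivative along a map is compatible with the metric. -/
theorem mvfderiv_tangentInner {f : P → M} {V W : P → E} {y : P}
    (hV : MDiffAlong E F f V y) (hW : MDiffAlong E F f W y) (v : F) :
    mvfderiv 𝓘(ℝ, F) (fun z ↦ tangentInner E (f z) (V z) (W z)) y v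
      = tangentInner E (f y) (covAlong E F f V y v) (W y)
        + tangentInner E (f y) (V y) (covAlong E F f W y v) := by
  have hx := mem_chart_source E (f y)
  have hm := (contMDiffAt_metricCoord hx).mdifferentiableAt (by simp)
  have hmf : MDifferentiableAt 𝓘(ℝ, F) 𝓘(ℝ, E →L[ℝ] E →L[ℝ] ℝ)
    (fun z ↦ metricCoord (f y) (f z)) y := hm.comp y hV.base
  rw [mvfderiv_congr (tangentInner_eventuallyEq_metricCoord hV.base.continuousAt),
    mvfderiv_clm_apply (mdifferentiableAt_clm_apply hmf (hV.coord hx)) (hW.coord hx),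
    mvfderiv_clm_apply hmf (hV.coord hx), mvfderiv_fun_comp hm hV.base]
  have hm2 := fun a c ↦ metricCoord_apply hx a c
  simp only [constField_self] at hm2
  rw [add_apply]
  erw [mvfderiv_metricCoord hx]
  rw [hm2, hm2, tangentCoord_self, tangentCoord_self, constField_self, constField_self]
  rw [covAlong_apply, covAlong_apply, tangentInner_add_left, tangentInner_add_right]
  abel

end Along

end Metric

/-! ### The differential of a map in coordinates. -/

section Differential

variable {E : Type*} [NormedAddCommGroup E] [NormedSpace ℝ E]
  {M : Type*} [TopologicalSpace M] [ChartedSpace E M] [IsManifold 𝓘(ℝ, E) ∞ M]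
  {F : Type*} [NormedAddCommGroup F] [NormedSpace ℝ F]
  {N : Type*} [TopologicalSpace N] [ChartedSpace F N] [IsManifold 𝓘(ℝ, F) ∞ N]

variable (E F) in
/-- The differential of a map, between the model spaces. -/
def mfderivModel (ψ : M → N) (x : M) : E →L[ℝ] F := mfderiv 𝓘(ℝ, E) 𝓘(ℝ, F) ψ x

/-- The differential of a map, in the coordinates at `p` and `ψ p`. -/
def mfderivCoord (ψ : M → N) (p x : M) : E →L[ℝ] F :=
  tangentCoord F (ψ p) (ψ x) ∘L mfderivModel E F ψ x ∘L tangentCoordChange 𝓘(ℝ, E) p x x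

theorem mfderivCoord_apply (ψ : M → N) {p x : M} (hx : x ∈ (chartAt E p).source) (v : E) :
    mfderivCoord ψ p x (tangentCoord E p x v) = tangentCoord F (ψ p) (ψ x) (mfderivModel E F ψ x v) := by
  have h : tangentCoordChange 𝓘(ℝ, E) p x x (tangentCoord E p x v) = v :=
    (tangentCoordChange_tangentCoord (mem_chart_source E x) hx v).trans (tangentCoord_self x v)
  simp only [mfderivCoord, ContinuousLinearMap.comp_apply, h]

theorem contMDiffAt_mfderivCoord {ψ : M → N} {p : M}
    (hψ : ContMDiffAt 𝓘(ℝ, E) 𝓘(ℝ, F) ∞ ψ p) :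
    ContMDiffAt 𝓘(ℝ, E) 𝓘(ℝ, E →L[ℝ] F) 1 (mfderivCoord (E := E) (F := F) ψ p) p := by
  refine (hψ.mfderiv_const (m := 1) (by norm_cast)).congr_of_eventuallyEq ?_
  filter_upwards [(chartAt E p).open_source.mem_nhds (mem_chart_source E p),
    hψ.continuousAt ((chartAt F (ψ p)).open_source.mem_nhds (mem_chart_source F (ψ p)))] with x hx hx'
  exact (inTangentCoordinates_eq (f := id) (g := ψ) _ hx hx').symm

theorem mdifferentiableAt_mfderivCoord {ψ : M → N} {p : M}
    (hψ : ContMDiffAt 𝓘(ℝ, E) 𝓘(ℝ, F) ∞ ψ p) :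
    MDifferentiableAt 𝓘(ℝ, E) 𝓘(ℝ, E →L[ℝ] F) (mfderivCoord (E := E) (F := F) ψ p) p :=
  (contMDiffAt_mfderivCoord hψ).mdifferentiableAt (by simp)

variable {H : Type*} [NormedAddCommGroup H] [NormedSpace ℝ H]
  {P : Type*} [TopologicalSpace P] [ChartedSpace H P]

theorem mfderiv_comp_model {ψ : M → N} {f : P → M} {y : P}
    (hψ : MDifferentiableAt 𝓘(ℝ, E) 𝓘(ℝ, F) ψ (f y))
    (hf : MDifferentiableAt 𝓘(ℝ, H) 𝓘(ℝ, E) f y) (v : H) :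
    mfderivModel H F (fun z ↦ ψ (f z)) y v = mfderivModel E F ψ (f y) (mfderivModel H E f y v) :=
  congrArg (fun L : H →L[ℝ] F ↦ L v) (mfderiv_comp y hψ hf)

end Differential

/-! ### The second fundamental form of a map. -/

section Hessian

variable {E : Type*} [NormedAddCommGroup E] [NormedSpace ℝ E] [FiniteDimensional ℝ E]
  {M : Type*} [TopologicalSpace M] [ChartedSpace E M] [IsManifold 𝓘(ℝ, E) ∞ M]
  [RiemannianBundle (fun x : M ↦ TangentSpace 𝓘(ℝ, E) x)]
  [IsContMDiffRiemannianBundle 𝓘(ℝ, E) ∞ E (fun x : M ↦ TangentSpace 𝓘(ℝ, E) x)]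
  {F : Type*} [NormedAddCommGroup F] [NormedSpace ℝ F] [FiniteDimensional ℝ F]
  {N : Type*} [TopologicalSpace N] [ChartedSpace F N] [IsManifold 𝓘(ℝ, F) ∞ N]
  [RiemannianBundle (fun x : N ↦ TangentSpace 𝓘(ℝ, F) x)]
  [IsContMDiffRiemannianBundle 𝓘(ℝ, F) ∞ F (fun x : N ↦ TangentSpace 𝓘(ℝ, F) x)]

variable (E F) in
/-- The second fundamental form `∇dψ(u, w)`. -/
def hessianForm (ψ : M → N) (p : M) (u w : E) : F :=
  covAlong F E ψ (fun x ↦ mfderivModel E F ψ x (constField E p w x)) p u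
    - mfderivModel E F ψ p (leviCivitaModel E (constField E p w) p u)

theorem hessianMap_eq_hessianForm (ψ : M → N) (p : M) (v : E) :
    (hessianMap (F := F) ψ p v : F) = hessianForm E F ψ p v v := by
  have h := covDerivAlong_eq_covAlong ψ
    (fun x ↦ mfderivModel E F ψ x (constField E p v x)) p v
  have he := extend_eq_constField p (show TangentSpace 𝓘(ℝ, E) p from v)
  refine .trans ?_ (congrArg (fun z : F ↦ z -
    mfderivModel E F ψ p (leviCivitaModel E (constField E p v) p v)) h)
  exact congrArg (fun σ : Π x : M, TangentSpace 𝓘(ℝ, E) x ↦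
    (show F from covDerivAlong ψ (fun x ↦ mfderiv 𝓘(ℝ, E) 𝓘(ℝ, F) ψ x (σ x)) p v)
      - mfderivModel E F ψ p (leviCivitaModel E σ p v)) he

section Along

variable {H : Type*} [NormedAddCommGroup H] [NormedSpace ℝ H]
  {P : Type*} [TopologicalSpace P] [ChartedSpace H P]

theorem tangentCoord_mfderiv_eventuallyEq {ψ : M → N} {f : P → M} {V : P → E} {y : P}
    (hf : ContinuousAt f y) :
    (fun z ↦ tangentCoord F (ψ (f y)) (ψ (f z)) (mfderivModel E F ψ (f z) (V z))) =ᶠ[nhds y]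
      fun z ↦ mfderivCoord ψ (f y) (f z) (tangentCoord E (f y) (f z) (V z)) := by
  filter_upwards [hf ((chartAt E (f y)).open_source.mem_nhds (mem_chart_source E (f y)))] with z hz
  exact (mfderivCoord_apply ψ hz (V z)).symm

theorem MDiffAlong.mfderiv_comp {ψ : M → N} {f : P → M} {V : P → E} {y : P}
    (hψ : ContMDiffAt 𝓘(ℝ, E) 𝓘(ℝ, F) ∞ ψ (f y)) (hV : MDiffAlong E H f V y) :
    MDiffAlong F H (fun z ↦ ψ (f z)) (fun z ↦ mfderivModel E F ψ (f z) (V z)) y := by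
  refine (mdiffAlong_iff (F := H) (f := fun z ↦ ψ (f z)) (y := y) (x₀ := ψ (f y))
    (mem_chart_source F _)).2
    ⟨(hψ.mdifferentiableAt (by simp)).comp y hV.base, ?_⟩
  exact (mdifferentiableAt_clm_apply ((mdifferentiableAt_mfderivCoord hψ).comp y hV.base)
    (hV.coord (mem_chart_source E _))).congr_of_eventuallyEq
      (tangentCoord_mfderiv_eventuallyEq hV.base.continuousAt)

/-- The covariant derivative of `dψ V`, for a vector field `V` along a map into `M`. -/
theorem covAlong_mfderiv {ψ : M → N} {f : P → M} {V : P → E} {y : P}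
    (hψ : ContMDiffAt 𝓘(ℝ, E) 𝓘(ℝ, F) ∞ ψ (f y)) (hV : MDiffAlong E H f V y) (v : H) :
    covAlong F H (fun z ↦ ψ (f z)) (fun z ↦ mfderivModel E F ψ (f z) (V z)) y v
      = hessianForm E F ψ (f y) (mfderivModel H E f y v) (V y)
        + mfderivModel E F ψ (f y) (covAlong E H f V y v) := by
  have hx := mem_chart_source E (f y)
  have hD := mdifferentiableAt_mfderivCoord hψ
  have hDf : MDifferentiableAt 𝓘(ℝ, H) 𝓘(ℝ, E →L[ℝ] F)
    (fun z ↦ mfderivCoord ψ (f y) (f z)) y := hD.comp y hV.base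
  have hψ' := hψ.mdifferentiableAt (by simp)
  have hself : ∀ w : E, mfderivCoord ψ (f y) (f y) w = mfderivModel E F ψ (f y) w := by
    intro w
    have := mfderivCoord_apply (F := F) ψ hx w
    rwa [tangentCoord_self, tangentCoord_self] at this
  have hcomp : (mfderiv 𝓘(ℝ, H) 𝓘(ℝ, F) (fun z ↦ ψ (f z)) y v : F)
      = mfderivModel E F ψ (f y) (mfderivModel H E f y v) := mfderiv_comp_model hψ' hV.base v
  set u : E := mfderivModel H E f y v with hu
  rw [covAlong_apply]
  rw [mvfderiv_congr (tangentCoord_mfderiv_eventuallyEq hV.base.continuousAt),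
    mvfderiv_clm_apply hDf (hV.coord hx), mvfderiv_fun_comp hD hV.base, hself, tangentCoord_self]
  have hC := mdifferentiableAt_constField hx (V y)
  -- The second fundamental form is computed with the constant-coordinate field through `V y`. Its
  -- coordinates have derivative zero, so only the derivative of `dψ` and the connection terms
  -- remain, to be matched with the left-hand side.
  have h2 := tangentCoord_mfderiv_eventuallyEq (F := F) (ψ := ψ) (f := fun x : M ↦ x)
    (V := constField E (f y) (V y)) (y := f y) continuousAt_id
  unfold hessianForm
  rw [covAlong_apply, mvfderiv_congr h2, mvfderiv_clm_apply hD (MDiffAlong.coord hC hx)]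
  have h3 : (fun x ↦ tangentCoord E (f y) x (constField E (f y) (V y) x)) =ᶠ[nhds (f y)]
      fun _ ↦ V y := by
    filter_upwards [(chartAt E (f y)).open_source.mem_nhds hx] with z hz
    exact tangentCoord_constField hz _
  have h4 : mvfderiv 𝓘(ℝ, E) (fun x ↦ tangentCoord E (f y) x (constField E (f y) (V y) x)) (f y) u
      = 0 := by
    rw [mvfderiv_congr h3, mvfderiv_const]; rfl
  rw [h4, map_zero, add_zero, constField_self, tangentCoord_self, covAlong_apply, map_add]
  erw [hcomp]
  change _ + _ + leviCivitaModel F _ _ (mfderivModel E F ψ (f y) u) =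
    (_ + leviCivitaModel F _ _ (mfderivModel E F ψ (f y) u) - _) + (_ + mfderivModel E F ψ (f y)
      (leviCivitaModel E (constField E (f y) (V y)) (f y) u))
  change mvfderiv 𝓘(ℝ, E) (mfderivCoord ψ (f y)) (f y) u (V y) + _ + _ = _
  abel

theorem hessianForm_add_left (ψ : M → N) (p : M) (u u' w : E) :
    hessianForm E F ψ p (u + u') w = hessianForm E F ψ p u w + hessianForm E F ψ p u' w := by
  unfold hessianForm
  rw [map_add, map_add, map_add]
  abel

theorem hessianForm_smul_left (ψ : M → N) (p : M) (a : ℝ) (u w : E) :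
    hessianForm E F ψ p (a • u) w = a • hessianForm E F ψ p u w := by
  unfold hessianForm
  rw [map_smul, map_smul, map_smul, smul_sub]

/-- The second fundamental form, in terms of any vector field with the given value. -/
theorem hessianForm_eq {ψ : M → N} {p : M} (hψ : ContMDiffAt 𝓘(ℝ, E) 𝓘(ℝ, F) ∞ ψ p)
    {σ : Π x : M, TangentSpace 𝓘(ℝ, E) x} (hσ : MDiffAt (T% σ) p) (u : E) :
    hessianForm E F ψ p u (σ p) = covAlong F E ψ (fun x ↦ mfderivModel E F ψ x (σ x)) p u
      - mfderivModel E F ψ p (leviCivitaModel E σ p u) := by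
  have h := covAlong_mfderiv (f := fun x : M ↦ x) (V := σ) hψ hσ u
  have h1 : mfderivModel E E (fun x : M ↦ x) p u = u :=
    congrArg (fun L : E →L[ℝ] E ↦ L u) mfderiv_id
  rw [h1, covAlong_section hσ] at h
  rw [h]
  abel

/-- In contrast to the slot `u`, the extending field depends on `w`. Smoothness of `ψ` allows the
extension to be replaced by the sum of the two extensions, by `hessianForm_eq`. -/
theorem hessianForm_add_right {ψ : M → N} {p : M} (hψ : ContMDiffAt 𝓘(ℝ, E) 𝓘(ℝ, F) ∞ ψ p)
    (u w w' : E) :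
    hessianForm E F ψ p u (w + w') = hessianForm E F ψ p u w + hessianForm E F ψ p u w' := by
  have hx := mem_chart_source E p
  have h1 := mdifferentiableAt_constField hx w
  have h2 := mdifferentiableAt_constField hx w'
  have h := hessianForm_eq hψ (mdifferentiableAt_add_section h1 h2) u
  have h3 : (constField E p w + constField E p w') p = w + w' :=
    congrArg₂ (fun a b : E ↦ a + b) (constField_self p w) (constField_self p w')
  rw [h3, leviCivitaModel_add h1 h2] at h
  refine h.trans ?_
  have h4 : (fun x ↦ mfderivModel E F ψ x ((constField E p w + constField E p w') x))
      = fun x ↦ mfderivModel E F ψ x (constField E p w x)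
        + mfderivModel E F ψ x (constField E p w' x) := by
    ext x
    exact map_add (mfderivModel E F ψ x) _ _
  rw [h4, covAlong_add (MDiffAlong.mfderiv_comp (f := fun x : M ↦ x) hψ h1)
    (MDiffAlong.mfderiv_comp (f := fun x : M ↦ x) hψ h2), add_apply, map_add]
  unfold hessianForm
  abel

theorem hessianForm_smul_right {ψ : M → N} {p : M} (hψ : ContMDiffAt 𝓘(ℝ, E) 𝓘(ℝ, F) ∞ ψ p)
    (a : ℝ) (u w : E) : hessianForm E F ψ p u (a • w) = a • hessianForm E F ψ p u w := by
  have hx := mem_chart_source E p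
  have h1 := mdifferentiableAt_constField hx w
  have ha : MDiffAt (fun _ : M ↦ a) p := mdifferentiableAt_const
  have h := hessianForm_eq hψ (ha.smul_section h1) u
  have h3 : ((fun _ : M ↦ a) • constField E p w) p = a • w :=
    congrArg (fun b : E ↦ a • b) (constField_self p w)
  have h0 : mvfderiv 𝓘(ℝ, E) (fun _ : M ↦ a) p u = 0 := by rw [mvfderiv_const]; rfl
  rw [h3, leviCivitaModel_smul h1 ha, h0, zero_smul, add_zero] at h
  refine h.trans ?_
  have h4 : (fun x ↦ mfderivModel E F ψ x (((fun _ : M ↦ a) • constField E p w) x))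
      = fun x ↦ a • mfderivModel E F ψ x (constField E p w x) := by
    ext x
    exact map_smul (mfderivModel E F ψ x) _ _
  rw [h4, covAlong_const_smul a (MDiffAlong.mfderiv_comp (f := fun x : M ↦ x) hψ h1), map_smul]
  unfold hessianForm
  rw [smul_sub]

end Along
end Hessian

/-! ### Regularity of the Christoffel symbols. -/

section Christoffel

variable {E : Type*} [NormedAddCommGroup E] [NormedSpace ℝ E]
  {M : Type*} [TopologicalSpace M] [ChartedSpace E M] [IsManifold 𝓘(ℝ, E) ∞ M]

theorem tangentCoord_model (x y v : E) : tangentCoord E (M := E) x y v = v := by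
  have := congrArg (fun L : E →L[ℝ] E ↦ L v) (TangentBundle.coordChange_model_space (𝕜 := ℝ) y x y)
  exact this

theorem contMDiffAt_mvfderiv_section {f : M → ℝ} {x : M} (hf : ContMDiffAt 𝓘(ℝ, E) 𝓘(ℝ, ℝ) ∞ f x)
    {σ : Π x : M, TangentSpace 𝓘(ℝ, E) x} (hσ : ContMDiffAt 𝓘(ℝ, E) 𝓘(ℝ, E).tangent ∞ (T% σ) x) :
    ContMDiffAt 𝓘(ℝ, E) 𝓘(ℝ, ℝ) 1 (fun y ↦ mvfderiv 𝓘(ℝ, E) f y (σ y)) x := by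
  have h1 := contMDiffAt_mfderivCoord (F := ℝ) hf
  have h2 : ContMDiffAt 𝓘(ℝ, E) 𝓘(ℝ, E) 1 (fun y ↦ tangentCoord E x y (σ y)) x :=
    (((trivializationAt E (TangentSpace 𝓘(ℝ, E)) x).contMDiffAt_section_iff
      (mem_chart_source E x)).1 hσ).of_le (by norm_cast)
  refine (h1.clm_apply h2).congr_of_eventuallyEq ?_
  filter_upwards [(chartAt E x).open_source.mem_nhds (mem_chart_source E x)] with y hy
  exact ((mfderivCoord_apply f hy (σ y)).trans (tangentCoord_model _ _ _)).symm

variable [FiniteDimensional ℝ E] [RiemannianBundle (fun x : M ↦ TangentSpace 𝓘(ℝ, E) x)]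
  [IsContMDiffRiemannianBundle 𝓘(ℝ, E) ∞ E (fun x : M ↦ TangentSpace 𝓘(ℝ, E) x)]

/-- The Koszul expression involves one derivative of the metric and of the fields; `C¹` is all that
the existence and uniqueness theorems for differential equations require. -/
theorem contMDiffAt_koszul {X Y Z : Π x : M, TangentSpace 𝓘(ℝ, E) x} {x : M}
    (hX : ContMDiffAt 𝓘(ℝ, E) 𝓘(ℝ, E).tangent ∞ (T% X) x)
    (hY : ContMDiffAt 𝓘(ℝ, E) 𝓘(ℝ, E).tangent ∞ (T% Y) x)
    (hZ : ContMDiffAt 𝓘(ℝ, E) 𝓘(ℝ, E).tangent ∞ (T% Z) x) :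
    ContMDiffAt 𝓘(ℝ, E) 𝓘(ℝ, ℝ) 1 (koszul Y X Z) x := by
  have hin : ∀ {n : ℕ∞ω} [ENat.LEInfty n] {U V : Π x : M, TangentSpace 𝓘(ℝ, E) x},
      ContMDiffAt 𝓘(ℝ, E) 𝓘(ℝ, E).tangent n (T% U) x →
      ContMDiffAt 𝓘(ℝ, E) 𝓘(ℝ, E).tangent n (T% V) x →
      ContMDiffAt 𝓘(ℝ, E) 𝓘(ℝ, ℝ) n (fun y ↦ ⟪U y, V y⟫_ℝ) x := fun hU hV ↦
    ContMDiffAt.inner_bundle (E := fun x : M ↦ TangentSpace 𝓘(ℝ, E) x) (F := E)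
      (IB := 𝓘(ℝ, E)) hU hV
  have h1 : ∀ {U : Π x : M, TangentSpace 𝓘(ℝ, E) x},
      ContMDiffAt 𝓘(ℝ, E) 𝓘(ℝ, E).tangent ∞ (T% U) x →
      ContMDiffAt 𝓘(ℝ, E) 𝓘(ℝ, E).tangent 1 (T% U) x := fun h ↦ h.of_le (by norm_cast)
  have hbr : ∀ {U V : Π x : M, TangentSpace 𝓘(ℝ, E) x},
      ContMDiffAt 𝓘(ℝ, E) 𝓘(ℝ, E).tangent ∞ (T% U) x →
      ContMDiffAt 𝓘(ℝ, E) 𝓘(ℝ, E).tangent ∞ (T% V) x →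
      ContMDiffAt 𝓘(ℝ, E) 𝓘(ℝ, E).tangent 1 (T% (mlieBracket 𝓘(ℝ, E) U V)) x := by
    intro U V hU hV
    have : IsManifold 𝓘(ℝ, E) (((2 : ℕ∞) : ℕ∞ω) + 1) M :=
      IsManifold.of_le (n := ∞) (by norm_cast)
    have : IsManifold 𝓘(ℝ, E) (minSmoothness ℝ 2) M :=
      IsManifold.of_le (n := ∞) (by simp only [minSmoothness_of_isRCLikeNormedField]; norm_cast)
    exact ContMDiffAt.mlieBracket_vectorField (m := 1) (n := 2) (hU.of_le (by norm_cast))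
      (hV.of_le (by norm_cast)) (by simp; norm_num)
  unfold koszul
  refine contMDiffAt_const.mul (((((?_ : ContMDiffAt _ _ _ _ _).add ?_).sub ?_).add ?_).sub ?_ |>.sub ?_)
  · exact contMDiffAt_mvfderiv_section (hin hY hZ) hX
  · exact contMDiffAt_mvfderiv_section (hin hZ hX) hY
  · exact contMDiffAt_mvfderiv_section (hin hX hY) hZ
  · exact hin (hbr hX hY) (h1 hZ)
  · exact hin (hbr hX hZ) (h1 hY)
  · exact hin (hbr hY hZ) (h1 hX)

/-- Positive definiteness gives injectivity, and `E` and its dual have the same dimension. -/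
theorem isInvertible_metricCoord {x₀ x : M} (hx : x ∈ (chartAt E x₀).source) :
    (metricCoord (E := E) x₀ x).IsInvertible := by
  have hinj : Function.Injective (metricCoord (E := E) x₀ x).toLinearMap := by
    rw [← LinearMap.ker_eq_bot, LinearMap.ker_eq_bot']
    intro a ha
    have h : metricCoord x₀ x a a = 0 := congrArg (fun L : E →L[ℝ] ℝ ↦ L a) ha
    rw [metricCoord_apply hx] at h
    have h2 := tangentInner_self_eq_zero.1 h
    rw [← tangentCoord_constField hx a]
    exact (congrArg (tangentCoord E x₀ x) h2).trans (map_zero _)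
  have hdim : Module.finrank ℝ E = Module.finrank ℝ (E →L[ℝ] ℝ) := by
    rw [← (LinearMap.toContinuousLinearMap (𝕜 := ℝ) (E := E) (F' := ℝ)).finrank_eq]
    exact (Subspace.dual_finrank_eq (K := ℝ) (V := E)).symm
  let e := LinearEquiv.ofInjectiveOfFinrankEq _ hinj hdim
  exact ⟨e.toContinuousLinearEquiv, by ext; rfl⟩

theorem inner_leviCivitaModel {X Y Z : Π x : M, TangentSpace 𝓘(ℝ, E) x} {x : M}
    (hX : MDiffAt (T% X) x) (hY : MDiffAt (T% Y) x) (hZ : MDiffAt (T% Z) x) :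
    tangentInner E x (leviCivitaModel E Y x (X x)) (Z x) = koszul Y X Z x :=
  inner_leviCivita hX hY hZ

/-- The connection was built pointwise from orthonormal bases chosen without any continuity.
Regularity is recovered by writing the Christoffel symbol as the inverse metric applied to the
Koszul functional, since inversion of operators is smooth. -/
theorem contMDiffAt_christoffel {x₀ x : M} (hx : x ∈ (chartAt E x₀).source) (u w : E) :
    ContMDiffAt 𝓘(ℝ, E) 𝓘(ℝ, E) 1 (fun y ↦ christoffel E x₀ y (constField E x₀ u y) w) x := by
  let b := Module.finBasis ℝ E
  let κ : M → E →L[ℝ] ℝ := fun y ↦ ∑ k, koszul (constField E x₀ w) (constField E x₀ u)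
    (constField E x₀ (b k)) y • (b.coord k).toContinuousLinearMap
  have hκ : ContMDiffAt 𝓘(ℝ, E) 𝓘(ℝ, E →L[ℝ] ℝ) 1 κ x :=
    contMDiffAt_finsetSum fun k _ ↦ (contMDiffAt_koszul (contMDiffAt_constField hx u)
      (contMDiffAt_constField hx w) (contMDiffAt_constField hx (b k))).smul contMDiffAt_const
  have hm : ContMDiffAt 𝓘(ℝ, E) 𝓘(ℝ, E →L[ℝ] E →L[ℝ] ℝ) 1 (metricCoord (E := E) x₀) x :=
    (contMDiffAt_metricCoord hx).of_le (by norm_cast)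
  have hinv : ContMDiffAt 𝓘(ℝ, E) 𝓘(ℝ, (E →L[ℝ] ℝ) →L[ℝ] E) 1
      (fun y ↦ (metricCoord (E := E) x₀ y).inverse) x :=
    ContMDiffAt.comp x (I' := 𝓘(ℝ, E →L[ℝ] E →L[ℝ] ℝ))
      (g := ContinuousLinearMap.inverse)
      (isInvertible_metricCoord hx).contDiffAt_map_inverse.contMDiffAt hm
  refine (hinv.clm_apply hκ).congr_of_eventuallyEq ?_
  filter_upwards [(chartAt E x₀).open_source.mem_nhds hx] with y hy
  set c := christoffel E x₀ y (constField E x₀ u y) w with hc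
  have hc' : constField E x₀ c y = leviCivitaModel E (constField E x₀ w) y (constField E x₀ u y) :=
    constField_tangentCoord hy _
  have hcκ : metricCoord x₀ y c = κ y := by
    ext z
    have hb : z = ∑ k, b.repr z k • b k := (b.sum_repr z).symm
    have hk : ∀ k, metricCoord x₀ y c (b k) = koszul (constField E x₀ w) (constField E x₀ u)
        (constField E x₀ (b k)) y := fun k ↦ by
      rw [metricCoord_apply hy, ← inner_leviCivitaModel (mdifferentiableAt_constField hy u)
        (mdifferentiableAt_constField hy w) (mdifferentiableAt_constField hy (b k))]
      exact congrArg (fun a : E ↦ tangentInner E y a (constField E x₀ (b k) y)) hc'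
    conv_lhs => rw [hb]
    simp only [map_sum, map_smul, hk, κ, sum_apply, smul_apply, smul_eq_mul,
      LinearMap.coe_toContinuousLinearMap', Module.Basis.coord_apply]
    exact Finset.sum_congr rfl fun k _ ↦ mul_comm _ _
  rw [← hcκ, (isInvertible_metricCoord hy).inverse_apply_self]

/-- The Christoffel symbols in the trivialization at `x₀`. -/
def christoffelCoord (x₀ x : M) : E →L[ℝ] E →L[ℝ] E :=
  ∑ i, ∑ j, ((Module.finBasis ℝ E).coord i).toContinuousLinearMap.smulRight
    (((Module.finBasis ℝ E).coord j).toContinuousLinearMap.smulRight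
      (christoffel E x₀ x (constField E x₀ (Module.finBasis ℝ E i) x) (Module.finBasis ℝ E j)))

theorem christoffelCoord_apply {x₀ x : M} (hx : x ∈ (chartAt E x₀).source) (u w : E) :
    christoffelCoord x₀ x u w = christoffel E x₀ x (constField E x₀ u x) w := by
  rw [← sum_basis_bilinear (Module.finBasis ℝ E)
    (fun u w : E ↦ christoffel E x₀ x (constField E x₀ u x) w)
    (fun u u' w ↦ (congrArg (fun z ↦ christoffel E x₀ x z w)
      (constField_add hx u u')).trans (christoffel_add_left x₀ x _ _ _))
    (fun a u w ↦ (congrArg (fun z ↦ christoffel E x₀ x z w)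
      (constField_smul hx a u)).trans (christoffel_smul_left x₀ x _ _ _))
    (fun w u u' ↦ christoffel_add_right hx _ _ _)
    (fun a w u ↦ christoffel_smul_right hx _ _ _) u w]
  simp only [christoffelCoord, sum_apply, smul_apply,
    ContinuousLinearMap.smulRight_apply, LinearMap.coe_toContinuousLinearMap',
    Module.Basis.coord_apply]

set_option synthInstance.maxHeartbeats 200000 in
theorem contMDiffAt_christoffelCoord {x₀ x : M} (hx : x ∈ (chartAt E x₀).source) :
    ContMDiffAt 𝓘(ℝ, E) 𝓘(ℝ, E →L[ℝ] E →L[ℝ] E) 1 (christoffelCoord (E := E) x₀) x := by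
  unfold christoffelCoord
  refine contMDiffAt_finsetSum fun i _ ↦ contMDiffAt_finsetSum fun j _ ↦ ?_
  let L (i) : E →L[ℝ] ℝ := ((Module.finBasis ℝ E).coord i).toContinuousLinearMap
  have hT : ContDiff ℝ 1 (fun c : E ↦ (L i).smulRight ((L j).smulRight c)) :=
    contDiff_const.smulRight (contDiff_const.smulRight contDiff_id)
  exact ContMDiffAt.comp x (I' := 𝓘(ℝ, E)) hT.contMDiff.contMDiffAt
    (contMDiffAt_christoffel hx (Module.finBasis ℝ E i) (Module.finBasis ℝ E j))

end Christoffel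

/-! ### Linear differential equations. -/

/-- Local solutions of a linear differential equation, on an interval which depends neither on the
initial value nor on the initial time. -/
theorem exists_linearODE_solution {E : Type*} [NormedAddCommGroup E] [NormedSpace ℝ E]
    [CompleteSpace E] {A : ℝ → E →L[ℝ] E} {s₀ : ℝ} (hA : ContDiffAt ℝ 1 A s₀) :
    ∃ δ > 0, ∀ s₁ ∈ Metric.ball s₀ δ, ∀ w : E, ∃ a : ℝ → E, a s₁ = w ∧
      ∀ s ∈ Metric.ball s₀ δ, HasDerivAt a (A s (a s)) s := by
  -- Time is added as a coordinate, so that the autonomous local flow theorem applies and the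
  -- initial time `s₁` becomes part of the initial value.
  have hF : ContDiffAt ℝ 1 (fun p : ℝ × E ↦ ((1 : ℝ), A p.1 p.2)) (s₀, (0 : E)) := by
    refine contDiffAt_const.prodMk (ContDiffAt.clm_apply ?_ contDiffAt_snd)
    exact ContDiffAt.comp (s₀, (0 : E)) hA contDiffAt_fst
  obtain ⟨r, hr, ε, hε, h⟩ :=
    hF.exists_forall_mem_closedBall_exists_eq_forall_mem_Ioo_hasDerivAt s₀
  -- With `ε / 2`, two times in the ball differ by less than `ε`, so the shifted time `t - s₁ + s₀`
  -- stays in the interval of the flow.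
  refine ⟨min r (ε / 2), lt_min hr (by linarith), fun s₁ hs₁ w ↦ ?_⟩
  rw [Metric.mem_ball, Real.dist_eq] at hs₁
  -- The flow is available only for small initial values. By linearity `w` is scaled into the ball
  -- of radius `r` and the solution is scaled back by `c⁻¹`.
  set c : ℝ := r / (‖w‖ + 1) with hc
  have hcpos : 0 < c := by positivity
  have hcw : ‖c • w‖ ≤ r := by
    rw [norm_smul, Real.norm_of_nonneg hcpos.le, hc, div_mul_eq_mul_div]
    rw [div_le_iff₀ (by positivity)]
    nlinarith [norm_nonneg w]
  obtain ⟨α, hα0, hα⟩ := h (s₁, c • w) (by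
    rw [Metric.mem_closedBall, Prod.dist_eq, max_le_iff, Real.dist_eq, dist_zero_right]
    exact ⟨(hs₁.le.trans (min_le_left _ _)), hcw⟩)
  have h1 : ∀ t ∈ Set.Ioo (s₀ - ε) (s₀ + ε), HasDerivAt (fun t ↦ (α t).1) 1 t := fun t ht ↦
    (hα t ht).fst
  have h2 : ∀ t ∈ Set.Ioo (s₀ - ε) (s₀ + ε), HasDerivAt (fun t ↦ (α t).2)
    (A (α t).1 (α t).2) t := fun t ht ↦ (hα t ht).snd
  have hmem : s₀ ∈ Set.Ioo (s₀ - ε) (s₀ + ε) := ⟨by linarith, by linarith⟩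
  have h3 : ∀ t ∈ Set.Ioo (s₀ - ε) (s₀ + ε), (α t).1 = s₁ + (t - s₀) := by
    intro t ht
    have hd : ∀ t ∈ Set.Ioo (s₀ - ε) (s₀ + ε), HasDerivAt (fun t ↦ (α t).1 - t) 0 t :=
      fun t ht ↦ by
        have := (h1 t ht).sub (hasDerivAt_id t)
        rw [sub_self] at this
        exact this
    have := isOpen_Ioo.is_const_of_deriv_eq_zero isPreconnected_Ioo
      (fun t ht ↦ (hd t ht).differentiableAt.differentiableWithinAt)
      (fun t ht ↦ (hd t ht).deriv) ht hmem
    simp only [hα0] at this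
    linarith
  refine ⟨fun t ↦ c⁻¹ • (α (t - s₁ + s₀)).2, ?_, fun t ht ↦ ?_⟩
  · simp [hα0, smul_smul, inv_mul_cancel₀ hcpos.ne']
  · rw [Metric.mem_ball, Real.dist_eq] at ht
    have a1 := abs_lt.1 (ht.trans_le (min_le_right _ _))
    have a2 := abs_lt.1 (hs₁.trans_le (min_le_right _ _))
    have ht' : t - s₁ + s₀ ∈ Set.Ioo (s₀ - ε) (s₀ + ε) := ⟨by linarith, by linarith⟩
    have hd := (h2 _ ht').scomp t (((hasDerivAt_id t).sub_const s₁).add_const s₀)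
    have e : (α (t - s₁ + s₀)).1 = t := by rw [h3 _ ht']; ring
    rw [e] at hd
    have hd' := hd.const_smul c⁻¹
    rw [one_smul] at hd'
    rw [map_smul]
    exact hd'

/-! ### Velocities of curves in a chart. -/

section Curves

variable {E : Type*} [NormedAddCommGroup E] [NormedSpace ℝ E]
  {M : Type*} [TopologicalSpace M] [ChartedSpace E M] [IsManifold 𝓘(ℝ, E) ∞ M]

variable (E) in
/-- The velocity of a curve as an element of the model space. -/
def velocityModel (γ : ℝ → M) (t : ℝ) : E := mfderivModel ℝ E γ t 1

theorem mvfderiv_eq_deriv (a : ℝ → E) (s : ℝ) : mvfderiv 𝓘(ℝ, ℝ) a s (1 : ℝ) = deriv a s := by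
  rw [← fderiv_apply_one_eq_deriv]
  exact congrArg (fun L : ℝ →L[ℝ] E ↦ L 1) mfderiv_eq_fderiv

theorem tangentCoord_velocity {γ : ℝ → M} {s : ℝ} {x₀ : M} (hx : γ s ∈ (chartAt E x₀).source)
    (hγ : MDifferentiableAt 𝓘(ℝ, ℝ) 𝓘(ℝ, E) γ s) :
    HasDerivAt (fun s ↦ chartAt E x₀ (γ s)) (tangentCoord E x₀ (γ s) (velocityModel E γ s)) s := by
  have hc : MDifferentiableAt 𝓘(ℝ, E) 𝓘(ℝ, E) (chartAt E x₀) (γ s) :=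
    mdifferentiableAt_atlas (chart_mem_atlas E x₀) hx
  have hcomp : MDifferentiableAt 𝓘(ℝ, ℝ) 𝓘(ℝ, E) (fun s ↦ chartAt E x₀ (γ s)) s := hc.comp s hγ
  have h := mfderiv_comp_model hc hγ (1 : ℝ)
  have h2 : mfderivModel E E (chartAt E x₀) (γ s) = tangentCoord E x₀ (γ s) :=
    mfderiv_chartAt_eq_tangentCoordChange hx
  rw [h2] at h
  have hd := hcomp.differentiableAt.hasDerivAt
  rw [← mvfderiv_eq_deriv] at hd
  exact h ▸ hd

end Curves

/-! ### Parallel fields and parallel transport. -/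

section Parallel

variable {E : Type*} [NormedAddCommGroup E] [NormedSpace ℝ E] [FiniteDimensional ℝ E]
  {M : Type*} [TopologicalSpace M] [ChartedSpace E M] [IsManifold 𝓘(ℝ, E) ∞ M]
  [RiemannianBundle (fun x : M ↦ TangentSpace 𝓘(ℝ, E) x)]
  [IsContMDiffRiemannianBundle 𝓘(ℝ, E) ∞ E (fun x : M ↦ TangentSpace 𝓘(ℝ, E) x)]

variable (E) in
/-- The field `V` along `γ` is differentiable at `s`, with covariant derivative zero. -/
def ParallelAlong (γ : ℝ → M) (V : ℝ → E) (s : ℝ) : Prop :=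
  MDiffAlong E ℝ γ V s ∧ covAlong E ℝ γ V s 1 = 0

theorem isParallelAt_iff (γ : ℝ → M) (V : Π s : ℝ, TangentSpace 𝓘(ℝ, E) (γ s)) (s : ℝ) :
    IsParallelAt γ V s ↔ ParallelAlong E γ V s := by
  have h := covDerivAlong_eq_covAlong γ V s (1 : ℝ)
  exact ⟨fun H ↦ ⟨H.1, h.symm.trans H.2⟩, fun H ↦ ⟨H.1, h.trans H.2⟩⟩

theorem covAlong_one_eq {γ : ℝ → M} {V : ℝ → E} {s : ℝ} {x₀ : M}
    (hx : γ s ∈ (chartAt E x₀).source) (hV : MDiffAlong E ℝ γ V s) :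
    tangentCoord E x₀ (γ s) (covAlong E ℝ γ V s 1)
      = deriv (fun s ↦ tangentCoord E x₀ (γ s) (V s)) s
        + christoffelCoord x₀ (γ s) (tangentCoord E x₀ (γ s) (velocityModel E γ s))
          (tangentCoord E x₀ (γ s) (V s)) := by
  rw [tangentCoord_covAlong hx hV, mvfderiv_eq_deriv, christoffelCoord_apply hx]
  have h := constField_tangentCoord hx (velocityModel E γ s)
  exact congrArg (fun u : E ↦ _ + christoffel E x₀ (γ s) u _) h.symm

/-- In a fixed chart parallelism is a linear differential equation, and the differentiability
demanded of a parallel field is already part of `HasDerivAt`. -/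
theorem parallelAlong_iff {γ : ℝ → M} {V : ℝ → E} {s : ℝ} {x₀ : M}
    (hγ : MDifferentiableAt 𝓘(ℝ, ℝ) 𝓘(ℝ, E) γ s) (hx : γ s ∈ (chartAt E x₀).source) :
    ParallelAlong E γ V s ↔ HasDerivAt (fun s ↦ tangentCoord E x₀ (γ s) (V s))
      (-christoffelCoord x₀ (γ s) (tangentCoord E x₀ (γ s) (velocityModel E γ s))
          (tangentCoord E x₀ (γ s) (V s))) s := by
  constructor
  · rintro ⟨h1, h2⟩
    have h := covAlong_one_eq hx h1
    rw [h2, map_zero] at h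
    have hd := (h1.coord hx).differentiableAt.hasDerivAt
    rwa [eq_neg_of_add_eq_zero_left h.symm] at hd
  · intro h
    have h1 : MDiffAlong E ℝ γ V s := (mdiffAlong_iff hx).2
      ⟨hγ, mdifferentiableAt_iff_differentiableAt.2 h.differentiableAt⟩
    refine ⟨h1, tangentCoord_injective hx ?_⟩
    rw [covAlong_one_eq hx h1, h.deriv, map_zero, neg_add_cancel]

theorem contDiffAt_chart_comp {γ : ℝ → M} (hγ : ContMDiff 𝓘(ℝ, ℝ) 𝓘(ℝ, E) ∞ γ) {s₀ : ℝ} {x₀ : M}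
    (hx : γ s₀ ∈ (chartAt E x₀).source) : ContDiffAt ℝ ∞ (fun s ↦ chartAt E x₀ (γ s)) s₀ := by
  have hc : ContMDiffAt 𝓘(ℝ, E) 𝓘(ℝ, E) ∞ (chartAt E x₀) (γ s₀) :=
    contMDiffAt_of_mem_maximalAtlas (IsManifold.chart_mem_maximalAtlas x₀) hx
  exact (ContMDiffAt.comp s₀ hc hγ.contMDiffAt).contDiffAt

theorem eventually_mem_chart {γ : ℝ → M} {s₀ : ℝ} (hγ : ContinuousAt γ s₀) {x₀ : M}
    (hx : γ s₀ ∈ (chartAt E x₀).source) : ∀ᶠ s in nhds s₀, γ s ∈ (chartAt E x₀).source :=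
  hγ ((chartAt E x₀).open_source.mem_nhds hx)

theorem contDiffAt_christoffelCoord_velocity {γ : ℝ → M} (hγ : ContMDiff 𝓘(ℝ, ℝ) 𝓘(ℝ, E) ∞ γ)
    {s₀ : ℝ} {x₀ : M} (hx : γ s₀ ∈ (chartAt E x₀).source) :
    ContDiffAt ℝ 1 (fun s ↦ -christoffelCoord x₀ (γ s)
      (tangentCoord E x₀ (γ s) (velocityModel E γ s))) s₀ := by
  have h1 : ContDiffAt ℝ 1 (fun s ↦ christoffelCoord (E := E) x₀ (γ s)) s₀ :=
    (ContMDiffAt.comp s₀ (contMDiffAt_christoffelCoord hx)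
      (hγ.contMDiffAt.of_le (by norm_cast))).contDiffAt
  have h2 : ContDiffAt ℝ 1 (deriv (fun s ↦ chartAt E x₀ (γ s))) s₀ :=
    (contDiffAt_chart_comp hγ hx).derivWithin (by norm_cast)
  refine (h1.clm_apply (h2.congr_of_eventuallyEq ?_)).neg
  filter_upwards [eventually_mem_chart hγ.continuous.continuousAt hx] with s hs
  exact (tangentCoord_velocity hs (hγ.mdifferentiableAt (by simp))).deriv.symm

/-- Parallel fields exist on an interval which does not depend on the initial condition. -/
theorem exists_parallelAlong_ball {γ : ℝ → M} (hγ : ContMDiff 𝓘(ℝ, ℝ) 𝓘(ℝ, E) ∞ γ) (s₀ : ℝ) :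
    ∃ δ > 0, ∀ s₁ ∈ Metric.ball s₀ δ, ∀ w : E, ∃ V : ℝ → E, V s₁ = w ∧
      ∀ s ∈ Metric.ball s₀ δ, ParallelAlong E γ V s := by
  have hx := mem_chart_source E (γ s₀)
  obtain ⟨δ, hδ, h⟩ := exists_linearODE_solution (contDiffAt_christoffelCoord_velocity hγ hx)
  obtain ⟨δ', hδ', h'⟩ := Metric.eventually_nhds_iff_ball.1
    (eventually_mem_chart hγ.continuous.continuousAt hx)
  refine ⟨min δ δ', lt_min hδ hδ', fun s₁ hs₁ w ↦ ?_⟩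
  have b1 := Metric.ball_subset_ball (x := s₀) (min_le_left δ δ')
  have b2 := Metric.ball_subset_ball (x := s₀) (min_le_right δ δ')
  obtain ⟨a, ha, hd⟩ := h s₁ (b1 hs₁) (tangentCoord E (γ s₀) (γ s₁) w)
  refine ⟨fun s ↦ constField E (γ s₀) (a s) (γ s), ?_, fun s hs ↦ ?_⟩
  · simp only [ha]
    exact constField_tangentCoord (h' s₁ (b2 hs₁)) w
  · refine (parallelAlong_iff (hγ.mdifferentiableAt (by simp)) (h' s (b2 hs))).2 ?_
    have he : (fun s ↦ tangentCoord E (γ s₀) (γ s) (constField E (γ s₀) (a s) (γ s)))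
        =ᶠ[nhds s] a := by
      filter_upwards [Metric.isOpen_ball.mem_nhds hs] with u hu
      exact tangentCoord_constField (h' u (b2 hu)) _
    have := (hd s (b1 hs)).congr_of_eventuallyEq he
    rwa [← he.self_of_nhds] at this

theorem ParallelAlong.congr {γ : ℝ → M} {V W : ℝ → E} {s : ℝ} (h : ParallelAlong E γ V s)
    (hVW : V =ᶠ[nhds s] W) : ParallelAlong E γ W s :=
  ⟨h.1.congr .rfl hVW, by rw [← covAlong_congr (.refl _ γ) hVW, h.2]⟩

theorem ParallelAlong.add {γ : ℝ → M} {V W : ℝ → E} {s : ℝ} (hV : ParallelAlong E γ V s)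
    (hW : ParallelAlong E γ W s) : ParallelAlong E γ (fun s ↦ V s + W s) s :=
  ⟨hV.1.add hW.1, by rw [covAlong_add hV.1 hW.1, hV.2, hW.2, add_zero]⟩

theorem ParallelAlong.const_smul {γ : ℝ → M} {V : ℝ → E} {s : ℝ} (a : ℝ)
    (hV : ParallelAlong E γ V s) : ParallelAlong E γ (fun s ↦ a • V s) s :=
  ⟨hV.1.smul mdifferentiableAt_const, by rw [covAlong_const_smul a hV.1, hV.2, smul_zero]⟩

theorem tangentInner_eq_of_parallelAlong {γ : ℝ → M} {V W : ℝ → E} {I : Set ℝ} (hI : I.OrdConnected)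
    (hV : ∀ s ∈ I, ParallelAlong E γ V s) (hW : ∀ s ∈ I, ParallelAlong E γ W s) {a b : ℝ}
    (ha : a ∈ I) (hb : b ∈ I) :
    tangentInner E (γ a) (V a) (W a) = tangentInner E (γ b) (V b) (W b) := by
  have hd : ∀ s ∈ I, HasDerivWithinAt (fun s ↦ tangentInner E (γ s) (V s) (W s)) 0 I s := by
    intro s hs
    have h := mvfderiv_tangentInner (hV s hs).1 (hW s hs).1 (1 : ℝ)
    rw [(hV s hs).2, (hW s hs).2, tangentInner_zero_left, tangentInner_zero_right, add_zero,
      mvfderiv_eq_deriv] at h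
    have := (mdifferentiableAt_tangentInner (hV s hs).1 (hW s hs).1).differentiableAt.hasDerivAt
    rw [h] at this
    exact this.hasDerivWithinAt
  have := hI.convex.norm_image_sub_le_of_norm_hasDerivWithin_le (C := 0) hd (by simp) hb ha
  rw [zero_mul, norm_le_zero_iff, sub_eq_zero] at this
  exact this

/-- The difference is parallel, so its length is constant; uniqueness thus holds on any interval,
without a chart covering it. -/
theorem ParallelAlong.eq_of_eq {γ : ℝ → M} {V W : ℝ → E} {I : Set ℝ} (hI : I.OrdConnected)
    (hV : ∀ s ∈ I, ParallelAlong E γ V s) (hW : ∀ s ∈ I, ParallelAlong E γ W s) {a b : ℝ}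
    (ha : a ∈ I) (hb : b ∈ I) (h : V a = W a) : V b = W b := by
  have hU : ∀ s ∈ I, ParallelAlong E γ (fun s ↦ V s + (-1 : ℝ) • W s) s :=
    fun s hs ↦ (hV s hs).add ((hW s hs).const_smul _)
  have := tangentInner_eq_of_parallelAlong hI hU hU ha hb
  rw [h, neg_one_smul, add_neg_cancel, tangentInner_zero_left] at this
  have h0 := tangentInner_self_eq_zero.1 this.symm
  rwa [neg_one_smul, ← sub_eq_add_neg, sub_eq_zero] at h0

/-- Continuation: the set of times reachable from `a` is open and closed. One open interval serves
all initial vectors, which is built into the statement so that the induction closes. -/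
theorem exists_parallelAlong {γ : ℝ → M} (hγ : ContMDiff 𝓘(ℝ, ℝ) 𝓘(ℝ, E) ∞ γ) (a b : ℝ) :
    ∃ I : Set ℝ, IsOpen I ∧ I.OrdConnected ∧ a ∈ I ∧ b ∈ I ∧
      ∀ w : E, ∃ V : ℝ → E, V a = w ∧ ∀ s ∈ I, ParallelAlong E γ V s := by
  set S : Set ℝ := {b | ∃ I : Set ℝ, IsOpen I ∧ I.OrdConnected ∧ a ∈ I ∧ b ∈ I ∧
      ∀ w : E, ∃ V : ℝ → E, V a = w ∧ ∀ s ∈ I, ParallelAlong E γ V s} with hS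
  have haS : a ∈ S := by
    obtain ⟨δ, hδ, h⟩ := exists_parallelAlong_ball hγ a
    have hm : a ∈ Metric.ball a δ := Metric.mem_ball_self hδ
    exact ⟨_, Metric.isOpen_ball, (convex_ball a δ).ordConnected, hm, hm, h a hm⟩
  have hopen : IsOpen S := by
    refine isOpen_iff_mem_nhds.2 ?_
    rintro b ⟨I, h1, h2, h3, h4, h5⟩
    filter_upwards [h1.mem_nhds h4] with c hc using ⟨I, h1, h2, h3, hc, h5⟩
  have hclosed : IsClosed S := by
    refine isClosed_of_closure_subset fun b hb ↦ ?_
    obtain ⟨δ, hδ, h⟩ := exists_parallelAlong_ball hγ b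
    obtain ⟨b', hb', I, h1, h2, h3, h4, h5⟩ := mem_closure_iff.1 hb _ Metric.isOpen_ball
      (Metric.mem_ball_self hδ)
    have hJ : (Metric.ball b δ).OrdConnected := (convex_ball b δ).ordConnected
    refine ⟨I ∪ Metric.ball b δ, h1.union Metric.isOpen_ball,
      (h2.isPreconnected.union b' h4 hb' hJ.isPreconnected).ordConnected, .inl h3,
      .inr (Metric.mem_ball_self hδ), fun w ↦ ?_⟩
    -- The local interval around `b` works for every initial time in it, in particular for the
    -- reachable time `b'`. The local solution started there with value `V b'` agrees with `V` on
    -- the overlap, so the two can be glued.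
    obtain ⟨V, hV, hVp⟩ := h5 w
    obtain ⟨W, hW, hWp⟩ := h b' hb' (V b')
    classical
    have hag : ∀ s ∈ I ∩ Metric.ball b δ, V s = W s := fun s hs ↦
      ParallelAlong.eq_of_eq (h2.inter hJ) (fun u hu ↦ hVp u hu.1) (fun u hu ↦ hWp u hu.2)
        ⟨h4, hb'⟩ hs hW.symm
    refine ⟨fun s ↦ if s ∈ I then V s else W s, by simp [h3, hV], fun s hs ↦ ?_⟩
    rcases hs with hs | hs
    · refine (hVp s hs).congr ?_
      filter_upwards [h1.mem_nhds hs] with u hu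
      simp [hu]
    · refine (hWp s hs).congr ?_
      filter_upwards [Metric.isOpen_ball.mem_nhds hs] with u hu
      by_cases hu' : u ∈ I
      · simp [hu', hag u ⟨hu', hu⟩]
      · simp [hu']
  have : S = Set.univ := IsClopen.eq_univ ⟨hclosed, hopen⟩ ⟨a, haS⟩
  exact (this.symm ▸ Set.mem_univ b : b ∈ S)

variable (E) in
/-- Parallel transport as a linear map of the model space. -/
def parallelTransportModel (γ : ℝ → M) (a b : ℝ) : E →ₗ[ℝ] E := parallelTransport γ a b

/-- The choice in `parallelTransport` is legitimate: evaluation at `b` of the solution with given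
value at `a` is linear by uniqueness. Uniqueness also shows that any parallel field computes the
chosen map. -/
theorem parallelTransportModel_eq {γ : ℝ → M} (hγ : ContMDiff 𝓘(ℝ, ℝ) 𝓘(ℝ, E) ∞ γ) {a b : ℝ}
    {V : ℝ → E} (hV : ∀ s ∈ Set.uIcc a b, ParallelAlong E γ V s) :
    parallelTransportModel E γ a b (V a) = V b := by
  have hI : (Set.uIcc a b).OrdConnected := Set.ordConnected_uIcc
  have ha : a ∈ Set.uIcc a b := Set.left_mem_uIcc
  have hb : b ∈ Set.uIcc a b := Set.right_mem_uIcc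
  have hex : ∀ w : E, ∃ V : ℝ → E, V a = w ∧ ∀ s ∈ Set.uIcc a b, ParallelAlong E γ V s := by
    obtain ⟨I, _, h2, h3, h4, h5⟩ := exists_parallelAlong hγ a b
    intro w
    obtain ⟨V, hV, h⟩ := h5 w
    exact ⟨V, hV, fun s hs ↦ h s (h2.uIcc_subset h3 h4 hs)⟩
  choose U hU hUp using hex
  let T : E →ₗ[ℝ] E :=
    { toFun := fun w ↦ U w b
      map_add' := fun w w' ↦ ParallelAlong.eq_of_eq hI (hUp (w + w'))
        (fun s hs ↦ (hUp w s hs).add (hUp w' s hs)) ha hb (by simp [hU])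
      map_smul' := fun c w ↦ ParallelAlong.eq_of_eq hI (hUp (c • w))
        (fun s hs ↦ (hUp w s hs).const_smul c) ha hb (by simp [hU]) }
  have hspec := Classical.epsilon_spec (p := fun T : TangentSpace 𝓘(ℝ, E) (γ a) →ₗ[ℝ]
    TangentSpace 𝓘(ℝ, E) (γ b) ↦ ∀ v, ∃ V : Π s : ℝ, TangentSpace 𝓘(ℝ, E) (γ s),
      (∀ s ∈ Set.uIcc a b, IsParallelAt γ V s) ∧ V a = v ∧ V b = T v)
    ⟨T, fun v ↦ ⟨U v, fun s hs ↦ (isParallelAt_iff γ _ s).2 (hUp v s hs), hU v, rfl⟩⟩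
  obtain ⟨W, h1, h2, h3⟩ := hspec (V a)
  refine Eq.trans (Eq.symm h3) ?_
  exact ParallelAlong.eq_of_eq hI (fun s hs ↦ (isParallelAt_iff γ W s).1 (h1 s hs)) hV ha hb h2

theorem exists_parallelAlong_uIcc {γ : ℝ → M} (hγ : ContMDiff 𝓘(ℝ, ℝ) 𝓘(ℝ, E) ∞ γ) (a b : ℝ)
    (w : E) : ∃ V : ℝ → E, V a = w ∧ ∀ s ∈ Set.uIcc a b, ParallelAlong E γ V s := by
  obtain ⟨I, _, h2, h3, h4, h5⟩ := exists_parallelAlong hγ a b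
  obtain ⟨V, hV, h⟩ := h5 w
  exact ⟨V, hV, fun s hs ↦ h s (h2.uIcc_subset h3 h4 hs)⟩

theorem parallelTransportModel_symm {γ : ℝ → M} (hγ : ContMDiff 𝓘(ℝ, ℝ) 𝓘(ℝ, E) ∞ γ) (a b : ℝ)
    (w : E) : parallelTransportModel E γ b a (parallelTransportModel E γ a b w) = w := by
  obtain ⟨V, rfl, hV⟩ := exists_parallelAlong_uIcc hγ a b w
  rw [parallelTransportModel_eq hγ hV, parallelTransportModel_eq hγ (Set.uIcc_comm a b ▸ hV)]

theorem tangentInner_parallelTransportModel {γ : ℝ → M} (hγ : ContMDiff 𝓘(ℝ, ℝ) 𝓘(ℝ, E) ∞ γ)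
    (a b : ℝ) (v w : E) : tangentInner E (γ b) (parallelTransportModel E γ a b v)
      (parallelTransportModel E γ a b w) = tangentInner E (γ a) v w := by
  obtain ⟨V, rfl, hV⟩ := exists_parallelAlong_uIcc hγ a b v
  obtain ⟨W, rfl, hW⟩ := exists_parallelAlong_uIcc hγ a b w
  rw [parallelTransportModel_eq hγ hV, parallelTransportModel_eq hγ hW]
  exact (tangentInner_eq_of_parallelAlong Set.ordConnected_uIcc hV hW Set.left_mem_uIcc
    Set.right_mem_uIcc).symm

end Parallel

/-! ### Uniqueness of geodesics. -/

section Geodesics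

variable {E : Type*} [NormedAddCommGroup E] [NormedSpace ℝ E] [FiniteDimensional ℝ E]
  {M : Type*} [TopologicalSpace M] [ChartedSpace E M] [IsManifold 𝓘(ℝ, E) ∞ M]
  [RiemannianBundle (fun x : M ↦ TangentSpace 𝓘(ℝ, E) x)]
  [IsContMDiffRiemannianBundle 𝓘(ℝ, E) ∞ E (fun x : M ↦ TangentSpace 𝓘(ℝ, E) x)]

theorem tangentCoord_velocity_eventuallyEq {γ : ℝ → M} (hγ : ContMDiff 𝓘(ℝ, ℝ) 𝓘(ℝ, E) ∞ γ)
    {s₀ : ℝ} {x₀ : M} (hx : γ s₀ ∈ (chartAt E x₀).source) :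
    (fun s ↦ tangentCoord E x₀ (γ s) (velocityModel E γ s)) =ᶠ[nhds s₀]
      deriv (fun s ↦ chartAt E x₀ (γ s)) := by
  filter_upwards [eventually_mem_chart hγ.continuous.continuousAt hx] with s hs
  exact (tangentCoord_velocity hs (hγ.mdifferentiableAt (by simp))).deriv.symm

theorem mdiffAlong_velocity {γ : ℝ → M} (hγ : ContMDiff 𝓘(ℝ, ℝ) 𝓘(ℝ, E) ∞ γ) (s : ℝ) :
    MDiffAlong E ℝ γ (velocityModel E γ) s := by
  have hx := mem_chart_source E (γ s)
  refine (mdiffAlong_iff hx).2 ⟨hγ.mdifferentiableAt (by simp),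
    mdifferentiableAt_iff_differentiableAt.2 ?_⟩
  exact (((contDiffAt_chart_comp hγ hx).derivWithin (m := 1) (by norm_cast)).differentiableAt
    (by simp)).congr_of_eventuallyEq (tangentCoord_velocity_eventuallyEq hγ hx)

variable (E) in
/-- A smooth curve whose velocity is parallel. -/
structure IsGeodesicCurve (γ : ℝ → M) : Prop where
  contMDiff : ContMDiff 𝓘(ℝ, ℝ) 𝓘(ℝ, E) ∞ γ
  covAlong_velocity (t : ℝ) : covAlong E ℝ γ (velocityModel E γ) t 1 = 0

/-- The vector field on `E × E` of the geodesic equation in the chart at `x₀`. -/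
def geodesicField (x₀ : M) (z : E × E) : E × E :=
  (z.2, -christoffelCoord x₀ ((chartAt E x₀).symm z.1) z.2 z.2)

theorem contDiffAt_geodesicField {x₀ x : M} (hx : x ∈ (chartAt E x₀).source) (v : E) :
    ContDiffAt ℝ 1 (geodesicField x₀) (chartAt E x₀ x, v) := by
  have h1 : ContDiffAt ℝ 1 (fun z : E ↦ christoffelCoord (E := E) x₀ ((chartAt E x₀).symm z))
      (chartAt E x₀ x) := by
    have hc : ContMDiffAt 𝓘(ℝ, E) 𝓘(ℝ, E) 1 (chartAt E x₀).symm (chartAt E x₀ x) :=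
      contMDiffAt_symm_of_mem_maximalAtlas
        (IsManifold.chart_mem_maximalAtlas (I := 𝓘(ℝ, E)) (n := 1) x₀) ((chartAt E x₀).map_source hx)
    refine (ContMDiffAt.comp (chartAt E x₀ x) (contMDiffAt_christoffelCoord ?_) hc).contDiffAt
    rwa [(chartAt E x₀).left_inv hx]
  have h2 : ContDiffAt ℝ 1 (fun z : E × E ↦ christoffelCoord (E := E) x₀
      ((chartAt E x₀).symm z.1)) (chartAt E x₀ x, v) :=
    ContDiffAt.comp (g := fun z : E ↦ christoffelCoord (E := E) x₀ ((chartAt E x₀).symm z))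
      (f := Prod.fst) (chartAt E x₀ x, v) h1 contDiffAt_fst
  exact contDiffAt_snd.prodMk ((h2.clm_apply contDiffAt_snd).clm_apply contDiffAt_snd).neg

theorem IsGeodesicCurve.hasDerivAt {γ : ℝ → M} (hγ : IsGeodesicCurve E γ) {s : ℝ} {x₀ : M}
    (hx : γ s ∈ (chartAt E x₀).source) :
    HasDerivAt (fun s ↦ (chartAt E x₀ (γ s), tangentCoord E x₀ (γ s) (velocityModel E γ s)))
      (geodesicField x₀ (chartAt E x₀ (γ s), tangentCoord E x₀ (γ s) (velocityModel E γ s))) s := by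
  have hm : MDifferentiableAt 𝓘(ℝ, ℝ) 𝓘(ℝ, E) γ s := hγ.contMDiff.mdifferentiableAt (by simp)
  refine (tangentCoord_velocity hx hm).prodMk ?_
  rw [(chartAt E x₀).left_inv hx]
  exact (parallelAlong_iff hm hx).1
    ⟨mdiffAlong_velocity hγ.contMDiff s, hγ.covAlong_velocity s⟩

/-- In a chart, position and velocity satisfy an autonomous equation with a `C¹`, hence locally
Lipschitz, right-hand side. -/
theorem IsGeodesicCurve.eventuallyEq {γ₁ γ₂ : ℝ → M} (h₁ : IsGeodesicCurve E γ₁)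
    (h₂ : IsGeodesicCurve E γ₂) {s : ℝ} (h : γ₁ s = γ₂ s)
    (hv : velocityModel E γ₁ s = velocityModel E γ₂ s) : γ₁ =ᶠ[nhds s] γ₂ := by
  have hx₁ := mem_chart_source E (γ₁ s)
  have hx₂ : γ₂ s ∈ (chartAt E (γ₁ s)).source := h ▸ hx₁
  set x₀ := γ₁ s
  obtain ⟨K, t, ht, hK⟩ := (contDiffAt_geodesicField hx₁
    (tangentCoord E x₀ x₀ (velocityModel E γ₁ s))).exists_lipschitzOnWith
  have key : ∀ γ : ℝ → M, IsGeodesicCurve E γ → γ s = x₀ → velocityModel E γ₁ s = velocityModel E γ s →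
      ∀ᶠ u in nhds s, HasDerivAt
        (fun s ↦ (chartAt E x₀ (γ s), tangentCoord E x₀ (γ s) (velocityModel E γ s)))
        (geodesicField x₀ (chartAt E x₀ (γ u), tangentCoord E x₀ (γ u) (velocityModel E γ u))) u
        ∧ (chartAt E x₀ (γ u), tangentCoord E x₀ (γ u) (velocityModel E γ u)) ∈ t := by
    intro γ hγ hs hγv
    have hx : γ s ∈ (chartAt E x₀).source := hs ▸ hx₁
    have hc := (hγ.hasDerivAt hx).continuousAt
    refine ((eventually_mem_chart hγ.contMDiff.continuous.continuousAt hx).mono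
      fun u hu ↦ hγ.hasDerivAt hu).and (hc.eventually_mem ?_)
    rw [hs, ← hγv]
    exact ht
  have he := ODE_solution_unique_of_eventually (v := fun _ ↦ geodesicField x₀) (s := fun _ ↦ t)
    (.of_forall fun _ ↦ hK) (key γ₁ h₁ rfl rfl) (key γ₂ h₂ h.symm hv)
    (by rw [← h, hv])
  filter_upwards [he, eventually_mem_chart h₁.contMDiff.continuous.continuousAt hx₁,
    eventually_mem_chart h₂.contMDiff.continuous.continuousAt hx₂] with u hu hu₁ hu₂
  exact (chartAt E x₀).injOn hu₁ hu₂ (congrArg Prod.fst hu)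

theorem IsGeodesicCurve.eq {γ₁ γ₂ : ℝ → M} [T2Space M] (h₁ : IsGeodesicCurve E γ₁)
    (h₂ : IsGeodesicCurve E γ₂) {a : ℝ} (h : γ₁ a = γ₂ a)
    (hv : velocityModel E γ₁ a = velocityModel E γ₂ a) : γ₁ = γ₂ := by
  set S : Set ℝ := {s | γ₁ =ᶠ[nhds s] γ₂} with hS
  have hopen : IsOpen S := isOpen_iff_mem_nhds.2 fun s hs ↦ eventually_eventually_nhds.2 hs
  have hclosed : IsClosed S := by
    refine isClosed_of_closure_subset fun s hs ↦ ?_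
    -- Since `M` is Hausdorff, positions agree in the limit. The velocities agree on `S`, hence in
    -- the limit by continuity in a chart, and local uniqueness applies at the limit point.
    have hsub : closure S ⊆ {s | γ₁ s = γ₂ s} := closure_minimal (fun s hs ↦ hs.self_of_nhds)
      (isClosed_eq h₁.contMDiff.continuous h₂.contMDiff.continuous)
    have hes : γ₁ s = γ₂ s := hsub hs
    refine h₁.eventuallyEq h₂ hes ?_
    have hx₁ := mem_chart_source E (γ₁ s)
    have hx₂ : γ₂ s ∈ (chartAt E (γ₁ s)).source := hes ▸ hx₁
    set x₀ := γ₁ s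
    have c₁ := (h₁.hasDerivAt hx₁).continuousAt.snd
    have c₂ := (h₂.hasDerivAt hx₂).continuousAt.snd
    simp only [ContinuousAt] at c₁ c₂
    have : (nhdsWithin s S).NeBot := mem_closure_iff_nhdsWithin_neBot.1 hs
    have hlim := tendsto_nhds_unique_of_eventuallyEq (l := nhdsWithin s S) (c₁.mono_left nhdsWithin_le_nhds)
      (c₂.mono_left nhdsWithin_le_nhds) (by
        filter_upwards [self_mem_nhdsWithin] with u hu
        have e1 : γ₁ u = γ₂ u := Filter.EventuallyEq.eq_of_nhds hu
        have e2 : velocityModel E γ₁ u = velocityModel E γ₂ u :=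
          congrArg (fun L : ℝ →L[ℝ] E ↦ L 1) (Filter.EventuallyEq.mfderiv_eq hu)
        rw [e1, e2])
    rw [← hes] at hlim
    exact tangentCoord_injective hx₁ hlim
  have : S = Set.univ := IsClopen.eq_univ ⟨hclosed, hopen⟩ ⟨a, h₁.eventuallyEq h₂ h hv⟩
  funext s
  exact Filter.EventuallyEq.eq_of_nhds (this.symm ▸ Set.mem_univ s : s ∈ S)

theorem IsGeodesicCurve.parallelTransportModel_velocity {γ : ℝ → M} (hγ : IsGeodesicCurve E γ)
    (a b : ℝ) : parallelTransportModel E γ a b (velocityModel E γ a) = velocityModel E γ b :=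
  parallelTransportModel_eq hγ.contMDiff
    fun s _ ↦ ⟨mdiffAlong_velocity hγ.contMDiff s, hγ.covAlong_velocity s⟩

end Geodesics

/-! ### Isometries preserve the Levi-Civita derivative and geodesics. -/

section Isometries

variable {E : Type*} [NormedAddCommGroup E] [NormedSpace ℝ E] [FiniteDimensional ℝ E]
  {M : Type*} [TopologicalSpace M] [ChartedSpace E M] [IsManifold 𝓘(ℝ, E) ∞ M]
  [RiemannianBundle (fun x : M ↦ TangentSpace 𝓘(ℝ, E) x)]
  [IsContMDiffRiemannianBundle 𝓘(ℝ, E) ∞ E (fun x : M ↦ TangentSpace 𝓘(ℝ, E) x)]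

variable (E) in
/-- A smooth map of `M` to itself whose differential preserves inner products. -/
structure IsLocalIsometry (φ : M → M) : Prop where
  contMDiff : ContMDiff 𝓘(ℝ, E) 𝓘(ℝ, E) ∞ φ
  tangentInner_eq (x : M) (v w : E) : tangentInner E (φ x) (mfderivModel E E φ x v)
    (mfderivModel E E φ x w) = tangentInner E x v w

variable {φ : M → M}

theorem IsLocalIsometry.isInvertible (hφ : IsLocalIsometry E φ) (x : M) :
    (mfderivModel E E φ x).IsInvertible := by
  have hinj : Function.Injective (mfderivModel E E φ x).toLinearMap := by
    refine (injective_iff_map_eq_zero _).2 fun v hv ↦ ?_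
    have hv' : mfderivModel E E φ x v = 0 := hv
    have h := hφ.tangentInner_eq x v v
    rw [hv', tangentInner_zero_left] at h
    exact tangentInner_self_eq_zero.1 h.symm
  exact ⟨(LinearEquiv.ofInjectiveEndo _ hinj).toContinuousLinearEquiv, by ext v; rfl⟩

theorem IsLocalIsometry.mfderivModel_mpullback (hφ : IsLocalIsometry E φ)
    (σ : Π x : M, TangentSpace 𝓘(ℝ, E) x) (x : M) :
    mfderivModel E E φ x (mpullback 𝓘(ℝ, E) 𝓘(ℝ, E) φ σ x) = σ (φ x) := by
  obtain ⟨e, he⟩ := hφ.isInvertible x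
  have h : (mfderivModel E E φ x) ((mfderivModel E E φ x).inverse (σ (φ x))) = σ (φ x) := by
    rw [← he, ContinuousLinearMap.inverse_equiv]
    exact e.apply_symm_apply _
  exact h

theorem IsLocalIsometry.mdifferentiableAt_mpullback (hφ : IsLocalIsometry E φ)
    {σ : Π x : M, TangentSpace 𝓘(ℝ, E) x} {x : M} (hσ : MDiffAt (T% σ) (φ x)) :
    MDiffAt (T% (mpullback 𝓘(ℝ, E) 𝓘(ℝ, E) φ σ)) x := by
  have : IsManifold 𝓘(ℝ, E) 2 M := IsManifold.of_le (n := ∞) (by norm_cast)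
  exact MDifferentiableAt.mpullback_vectorField (n := 2) hσ (hφ.contMDiff.contMDiffAt.of_le (by norm_cast))
    (hφ.isInvertible x) le_rfl

theorem IsLocalIsometry.mlieBracket_mpullback (hφ : IsLocalIsometry E φ)
    {σ ρ : Π x : M, TangentSpace 𝓘(ℝ, E) x} {x : M} (hσ : MDiffAt (T% σ) (φ x))
    (hρ : MDiffAt (T% ρ) (φ x)) :
    mlieBracket 𝓘(ℝ, E) (mpullback 𝓘(ℝ, E) 𝓘(ℝ, E) φ σ) (mpullback 𝓘(ℝ, E) 𝓘(ℝ, E) φ ρ) x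
      = mpullback 𝓘(ℝ, E) 𝓘(ℝ, E) φ (mlieBracket 𝓘(ℝ, E) σ ρ) x := by
  have : IsManifold 𝓘(ℝ, E) (minSmoothness ℝ 2) M :=
    IsManifold.of_le (n := ∞) (by simp only [minSmoothness_of_isRCLikeNormedField]; norm_cast)
  exact (mpullback_mlieBracket (n := ∞) hσ hρ hφ.contMDiff.contMDiffAt
    (by simp only [minSmoothness_of_isRCLikeNormedField]; norm_cast)).symm

theorem IsLocalIsometry.tangentInner_mpullback (hφ : IsLocalIsometry E φ)
    (σ ρ : Π x : M, TangentSpace 𝓘(ℝ, E) x) (x : M) :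
    tangentInner E x (mpullback 𝓘(ℝ, E) 𝓘(ℝ, E) φ σ x) (mpullback 𝓘(ℝ, E) 𝓘(ℝ, E) φ ρ x)
      = tangentInner E (φ x) (σ (φ x)) (ρ (φ x)) := by
  refine (hφ.tangentInner_eq x _ _).symm.trans ?_
  exact congrArg₂ (fun v w : E ↦ tangentInner E (φ x) v w) (hφ.mfderivModel_mpullback σ x)
    (hφ.mfderivModel_mpullback ρ x)

/-- The Koszul expression is assembled from inner products, derivatives of functions and Lie
brackets, each of which is natural under pullback by `φ`. -/
theorem IsLocalIsometry.koszul_mpullback (hφ : IsLocalIsometry E φ)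
    {X Y Z : Π x : M, TangentSpace 𝓘(ℝ, E) x} {x : M} (hX : MDiffAt (T% X) (φ x))
    (hY : MDiffAt (T% Y) (φ x)) (hZ : MDiffAt (T% Z) (φ x)) :
    koszul (mpullback 𝓘(ℝ, E) 𝓘(ℝ, E) φ Y) (mpullback 𝓘(ℝ, E) 𝓘(ℝ, E) φ X)
      (mpullback 𝓘(ℝ, E) 𝓘(ℝ, E) φ Z) x = koszul Y X Z (φ x) := by
  have key : ∀ U V W : Π x : M, TangentSpace 𝓘(ℝ, E) x, MDiffAt (T% U) (φ x) →
      MDiffAt (T% V) (φ x) →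
      mvfderiv 𝓘(ℝ, E) (fun y ↦ ⟪mpullback 𝓘(ℝ, E) 𝓘(ℝ, E) φ U y,
        mpullback 𝓘(ℝ, E) 𝓘(ℝ, E) φ V y⟫_ℝ) x (mpullback 𝓘(ℝ, E) 𝓘(ℝ, E) φ W x)
      = mvfderiv 𝓘(ℝ, E) (fun y ↦ ⟪U y, V y⟫_ℝ) (φ x) (W (φ x)) := by
    intro U V W hU hV
    have h1 : (fun y ↦ ⟪mpullback 𝓘(ℝ, E) 𝓘(ℝ, E) φ U y, mpullback 𝓘(ℝ, E) 𝓘(ℝ, E) φ V y⟫_ℝ)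
        = fun y ↦ (fun z ↦ ⟪U z, V z⟫_ℝ) (φ y) :=
      funext fun y ↦ hφ.tangentInner_mpullback U V y
    rw [h1]
    refine (mvfderiv_fun_comp (mdifferentiableAt_inner hU hV)
      (hφ.contMDiff.mdifferentiableAt (by simp)) _).trans ?_
    exact congrArg (mvfderiv 𝓘(ℝ, E) (fun y ↦ ⟪U y, V y⟫_ℝ) (φ x)) (hφ.mfderivModel_mpullback W x)
  have key2 : ∀ U V W : Π x : M, TangentSpace 𝓘(ℝ, E) x, MDiffAt (T% U) (φ x) →
      MDiffAt (T% V) (φ x) → ⟪mlieBracket 𝓘(ℝ, E) (mpullback 𝓘(ℝ, E) 𝓘(ℝ, E) φ U)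
        (mpullback 𝓘(ℝ, E) 𝓘(ℝ, E) φ V) x, mpullback 𝓘(ℝ, E) 𝓘(ℝ, E) φ W x⟫_ℝ
      = ⟪mlieBracket 𝓘(ℝ, E) U V (φ x), W (φ x)⟫_ℝ := by
    intro U V W hU hV
    rw [hφ.mlieBracket_mpullback hU hV]
    exact hφ.tangentInner_mpullback _ W x
  unfold koszul
  rw [key Y Z X hY hZ, key Z X Y hZ hX, key X Y Z hX hY, key2 X Y Z hX hY, key2 X Z Y hX hZ,
    key2 Y Z X hY hZ]

theorem IsLocalIsometry.mfderivModel_leviCivitaModel (hφ : IsLocalIsometry E φ)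
    {X Y : Π x : M, TangentSpace 𝓘(ℝ, E) x} {x : M} (hX : MDiffAt (T% X) (φ x))
    (hY : MDiffAt (T% Y) (φ x)) :
    mfderivModel E E φ x (leviCivitaModel E (mpullback 𝓘(ℝ, E) 𝓘(ℝ, E) φ Y) x
      (mpullback 𝓘(ℝ, E) 𝓘(ℝ, E) φ X x)) = leviCivitaModel E Y (φ x) (X (φ x)) := by
  refine ext_tangentInner (x := φ x) fun z ↦ ?_
  have hZ := mdifferentiableAt_constField (mem_chart_source E (φ x)) z
  have h := hφ.koszul_mpullback hX hY hZ
  have h1 := inner_leviCivitaModel (hφ.mdifferentiableAt_mpullback hX)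
    (hφ.mdifferentiableAt_mpullback hY) (hφ.mdifferentiableAt_mpullback hZ)
  have h2 := (hφ.tangentInner_eq x _ _).trans
    (h1.trans (h.trans (inner_leviCivitaModel hX hY hZ).symm))
  have hz : mfderivModel E E φ x (mpullback 𝓘(ℝ, E) 𝓘(ℝ, E) φ (constField E (φ x) z) x) = z :=
    (hφ.mfderivModel_mpullback (constField E (φ x) z) x).trans (constField_self (φ x) z)
  have hz' : (constField E (φ x) z (φ x) : E) = z := constField_self (φ x) z
  refine (congrArg (fun w : E ↦ tangentInner E (φ x) _ w) hz).symm.trans (h2.trans ?_)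
  exact congrArg (fun w : E ↦ tangentInner E (φ x) _ w) hz'

theorem IsLocalIsometry.exists_mpullback_constField_eq (hφ : IsLocalIsometry E φ) (x : M) (u : E) :
    ∃ u', (mpullback 𝓘(ℝ, E) 𝓘(ℝ, E) φ (constField E (φ x) u') x : E) = u := by
  refine ⟨mfderivModel E E φ x u, ?_⟩
  obtain ⟨e, he⟩ := hφ.isInvertible x
  have h := (hφ.mfderivModel_mpullback (constField E (φ x) (mfderivModel E E φ x u)) x).trans
    (constField_self (φ x) _)
  have hinj : Function.Injective (mfderivModel E E φ x) := by
    rw [← he]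
    exact e.injective
  exact hinj h

/-- An isometry is an affine map. Since `dφ` is invertible, `u` and `w` extend to pulled-back
fields, for which naturality of the connection makes the two terms of `∇dφ` cancel. -/
theorem IsLocalIsometry.hessianForm_eq_zero (hφ : IsLocalIsometry E φ) (x : M) (u w : E) :
    hessianForm E E φ x u w = 0 := by
  have hx := mem_chart_source E (φ x)
  obtain ⟨u', hu⟩ := hφ.exists_mpullback_constField_eq x u
  obtain ⟨w', hw⟩ := hφ.exists_mpullback_constField_eq x w
  have hU := mdifferentiableAt_constField hx u'
  have hW := mdifferentiableAt_constField hx w'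
  have h := hessianForm_eq hφ.contMDiff.contMDiffAt (hφ.mdifferentiableAt_mpullback hW)
    (mpullback 𝓘(ℝ, E) 𝓘(ℝ, E) φ (constField E (φ x) u') x)
  have h1 : (fun y ↦ mfderivModel E E φ y (mpullback 𝓘(ℝ, E) 𝓘(ℝ, E) φ (constField E (φ x) w') y))
      = fun y ↦ constField E (φ x) w' (φ y) := funext fun y ↦ hφ.mfderivModel_mpullback _ y
  have h2 := covAlong_section_comp hW (hφ.contMDiff.mdifferentiableAt (by simp) (x := x))
    (mpullback 𝓘(ℝ, E) 𝓘(ℝ, E) φ (constField E (φ x) u') x)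
  have h3 : leviCivitaModel E (constField E (φ x) w') (φ x) (mfderivModel E E φ x
      (mpullback 𝓘(ℝ, E) 𝓘(ℝ, E) φ (constField E (φ x) u') x))
      = leviCivitaModel E (constField E (φ x) w') (φ x) (constField E (φ x) u' (φ x)) :=
    congrArg (leviCivitaModel E (constField E (φ x) w') (φ x))
      (hφ.mfderivModel_mpullback (constField E (φ x) u') x)
  refine (congrArg₂ (hessianForm E E φ x) hu hw).symm.trans (h.trans (sub_eq_zero.2 ?_))
  refine Eq.trans ?_ (h2.trans (h3.trans (hφ.mfderivModel_leviCivitaModel hU hW).symm))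
  exact congrArg (fun V : M → E ↦ covAlong E E φ V x _) h1

/-- A local isometry commutes with covariant derivatives along maps. -/
theorem IsLocalIsometry.covAlong_mfderivModel (hφ : IsLocalIsometry E φ)
    {F : Type*} [NormedAddCommGroup F] [NormedSpace ℝ F] {P : Type*} [TopologicalSpace P]
    [ChartedSpace F P] {f : P → M} {V : P → E} {y : P} (hV : MDiffAlong E F f V y) (v : F) :
    covAlong E F (fun z ↦ φ (f z)) (fun z ↦ mfderivModel E E φ (f z) (V z)) y v
      = mfderivModel E E φ (f y) (covAlong E F f V y v) := by
  rw [covAlong_mfderiv hφ.contMDiff.contMDiffAt hV, hφ.hessianForm_eq_zero, zero_add]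

theorem velocityModel_comp {γ : ℝ → M} (hφ : ContMDiff 𝓘(ℝ, E) 𝓘(ℝ, E) ∞ φ)
    (hγ : ContMDiff 𝓘(ℝ, ℝ) 𝓘(ℝ, E) ∞ γ) (s : ℝ) : velocityModel E (fun s ↦ φ (γ s)) s
      = mfderivModel E E φ (γ s) (velocityModel E γ s) :=
  mfderiv_comp_model (hφ.mdifferentiableAt (by simp)) (hγ.mdifferentiableAt (by simp)) 1

theorem IsLocalIsometry.isGeodesicCurve (hφ : IsLocalIsometry E φ) {γ : ℝ → M}
    (hγ : IsGeodesicCurve E γ) : IsGeodesicCurve E (fun s ↦ φ (γ s)) where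
  contMDiff := hφ.contMDiff.comp hγ.contMDiff
  covAlong_velocity t := by
    have h : velocityModel E (fun s ↦ φ (γ s)) = fun s ↦ mfderivModel E E φ (γ s)
      (velocityModel E γ s) := funext fun s ↦ velocityModel_comp hφ.contMDiff hγ.contMDiff s
    rw [h, hφ.covAlong_mfderivModel (mdiffAlong_velocity hγ.contMDiff t), hγ.covAlong_velocity,
      map_zero]

end Isometries

/-! ### Smooth actions and the differentials of orbit maps. -/

section Actions

variable {E : Type*} [NormedAddCommGroup E] [NormedSpace ℝ E]
  {M : Type*} [TopologicalSpace M] [ChartedSpace E M] [IsManifold 𝓘(ℝ, E) ∞ M]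
  {EG : Type*} [NormedAddCommGroup EG] [NormedSpace ℝ EG]
  {G : Type*} [TopologicalSpace G] [ChartedSpace EG G] [Group G] [LieGroup 𝓘(ℝ, EG) ∞ G]
  [MulAction G M] [ContMDiffSMul 𝓘(ℝ, EG) 𝓘(ℝ, E) ∞ G M]

variable (E) in
/-- The differential at `x` of the action of `g`. -/
def smulDiff (g : G) (x : M) : E →L[ℝ] E := mfderivModel E E (fun y : M ↦ g • y) x

variable (E EG G) in
/-- The action field, with values in the model space. -/
def actionFieldModel (p : M) : EG →L[ℝ] E := mfderivModel EG E (fun g : G ↦ g • p) 1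

include EG in
variable (E EG) in
theorem contMDiff_const_smul (g : G) : ContMDiff 𝓘(ℝ, E) 𝓘(ℝ, E) ∞ (fun x : M ↦ g • x) :=
  ContMDiffSMul.contMDiff_const_smul (I := 𝓘(ℝ, EG)) g

variable (E EG) in
theorem contMDiff_smul_const (p : M) : ContMDiff 𝓘(ℝ, EG) 𝓘(ℝ, E) ∞ (fun g : G ↦ g • p) :=
  ContMDiff.smul (n := ∞) contMDiff_id contMDiff_const

theorem smulDiff_one (x : M) (v : E) : smulDiff E (1 : G) x v = v := by
  have h : (fun y : M ↦ (1 : G) • y) = id := funext fun y ↦ one_smul G y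
  unfold smulDiff
  rw [h]
  exact congrArg (fun L : E →L[ℝ] E ↦ L v) mfderiv_id

include EG in
variable (EG) in
theorem smulDiff_mul (g h : G) (x : M) (v : E) :
    smulDiff E (g * h) x v = smulDiff E g (h • x) (smulDiff E h x v) := by
  have e : (fun y : M ↦ (g * h) • y) = fun y ↦ (fun z ↦ g • z) ((fun z ↦ h • z) y) :=
    funext fun y ↦ mul_smul g h y
  unfold smulDiff
  rw [e]
  exact mfderiv_comp_model ((contMDiff_const_smul E EG g).mdifferentiableAt (by simp))
    ((contMDiff_const_smul E EG h).mdifferentiableAt (by simp)) v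

/-- The field `g ↦ g • w` is the tangent map of the action `G × M → M` applied to the smooth family
`(0_g, w)`. -/
theorem mdiffAlong_smulDiff (p : M) (w : E) (g₀ : G) :
    MDiffAlong E EG (fun g : G ↦ g • p) (fun g ↦ smulDiff E g p w) g₀ := by
  let fg : G → TangentBundle 𝓘(ℝ, EG) G := fun g ↦ TotalSpace.mk' EG g 0
  have sfg : ContMDiff 𝓘(ℝ, EG) 𝓘(ℝ, EG).tangent 1 fg := contMDiff_zeroSection _ _
  let fv : G → TangentBundle 𝓘(ℝ, E) M := fun _ ↦ TotalSpace.mk' E p w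
  have sfv : ContMDiff 𝓘(ℝ, EG) 𝓘(ℝ, E).tangent 1 fv := contMDiff_const
  let F₁ : G → (TangentBundle 𝓘(ℝ, EG) G × TangentBundle 𝓘(ℝ, E) M) := fun g ↦ (fg g, fv g)
  have S₁ : ContMDiff 𝓘(ℝ, EG) (𝓘(ℝ, EG).tangent.prod 𝓘(ℝ, E).tangent) 1 F₁ := sfg.prodMk sfv
  let F₂ : (TangentBundle 𝓘(ℝ, EG) G × TangentBundle 𝓘(ℝ, E) M) →
      TangentBundle (𝓘(ℝ, EG).prod 𝓘(ℝ, E)) (G × M) :=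
    (equivTangentBundleProd 𝓘(ℝ, EG) G 𝓘(ℝ, E) M).symm
  have S₂ : ContMDiff (𝓘(ℝ, EG).tangent.prod 𝓘(ℝ, E).tangent) (𝓘(ℝ, EG).prod 𝓘(ℝ, E)).tangent 1 F₂ :=
    contMDiff_equivTangentBundleProd_symm
  have hm : ContMDiff (𝓘(ℝ, EG).prod 𝓘(ℝ, E)) 𝓘(ℝ, E) ∞ (fun q : G × M ↦ q.1 • q.2) :=
    ContMDiffSMul.contMDiff_smul
  let F₃ : TangentBundle (𝓘(ℝ, EG).prod 𝓘(ℝ, E)) (G × M) → TangentBundle 𝓘(ℝ, E) M :=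
    tangentMap (𝓘(ℝ, EG).prod 𝓘(ℝ, E)) 𝓘(ℝ, E) (fun q : G × M ↦ q.1 • q.2)
  have S₃ : ContMDiff (𝓘(ℝ, EG).prod 𝓘(ℝ, E)).tangent 𝓘(ℝ, E).tangent 1 F₃ :=
    hm.contMDiff_tangentMap (m := 1) (by norm_cast)
  have S := ((S₃.comp S₂).comp S₁).mdifferentiableAt (x := g₀) (by simp)
  refine MDifferentiableAt.congr_of_eventuallyEq S (.of_forall fun g ↦ ?_)
  have h := mfderiv_prod_eq_add_apply (p := (g, p)) (v := ((0 : EG), w))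
    (hm.mdifferentiableAt (by simp))
  have h2 : (mfderiv (𝓘(ℝ, EG).prod 𝓘(ℝ, E)) 𝓘(ℝ, E) (fun q : G × M ↦ q.1 • q.2) (g, p)
      ((0 : EG), w) : E) = smulDiff E g p w := by
    refine h.trans ?_
    have h0 : (mfderiv 𝓘(ℝ, EG) 𝓘(ℝ, E) (fun z : G ↦ z • p) g (0 : EG) : E) = 0 := map_zero _
    exact (congrArg (fun z : E ↦ z + smulDiff E g p w) h0).trans (zero_add _)
  exact congrArg (fun z : E ↦ (⟨g • p, z⟩ : TangentBundle 𝓘(ℝ, E) M)) h2.symm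

/-- The differential of the orbit map, on left-invariant vector fields. -/
theorem mfderivModel_smul_const_mulInvariantVectorField (p : M) (X : EG) (g : G) :
    mfderivModel EG E (fun g : G ↦ g • p) g
      (mulInvariantVectorField (show GroupLieAlgebra 𝓘(ℝ, EG) G from X) g)
      = smulDiff E g p (actionFieldModel E EG G p X) := by
  have e : (fun h : G ↦ (fun k : G ↦ k • p) (g * h)) = fun h : G ↦ (fun y : M ↦ g • y) (h • p) :=
    funext fun h ↦ mul_smul g h p
  have hp := contMDiff_smul_const (G := G) E EG p
  have hl : ContMDiff 𝓘(ℝ, EG) 𝓘(ℝ, EG) ∞ (fun h : G ↦ g * h) := contMDiff_mul_left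
  have h1 := mfderiv_comp_model (ψ := fun k : G ↦ k • p) (f := fun h : G ↦ g * h) (y := 1)
    (hp.mdifferentiableAt (by simp)) (hl.mdifferentiableAt (by simp)) X
  have h2 := mfderiv_comp_model (ψ := fun y : M ↦ g • y) (f := fun h : G ↦ h • p) (y := 1)
    ((contMDiff_const_smul E EG g).mdifferentiableAt (by simp)) (hp.mdifferentiableAt (by simp)) X
  rw [one_smul] at h2
  rw [mul_one] at h1
  refine Eq.trans ?_ ((h1.symm.trans (congrArg (fun f ↦ mfderivModel EG E f 1 X) e)).trans h2)
  rfl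

/-- The action maps tangent vectors of orbits to tangent vectors of orbits. -/
theorem exists_smulDiff_actionFieldModel (g : G) (p : M) (X : EG) :
    ∃ Y : EG, smulDiff E g p (actionFieldModel E EG G p X) = actionFieldModel E EG G (g • p) Y := by
  -- Moving `h • p` by `g` is the same as letting the conjugate of `h` act on `g • p`, so `Y` is the
  -- image of `X` under the differential of conjugation.
  have e : (fun h : G ↦ (fun k : G ↦ k • (g • p)) (g * h * g⁻¹))
      = fun h : G ↦ (fun y : M ↦ g • y) (h • p) :=
    funext fun h ↦ by simp [mul_smul]
  have hp := contMDiff_smul_const (G := G) E EG p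
  have hgp := contMDiff_smul_const (G := G) E EG (g • p)
  have hl : ContMDiff 𝓘(ℝ, EG) 𝓘(ℝ, EG) ∞ (fun h : G ↦ g * h * g⁻¹) :=
    (contMDiff_mul_right (a := g⁻¹)).comp (contMDiff_mul_left (a := g))
  have h1 := mfderiv_comp_model (ψ := fun k : G ↦ k • (g • p)) (f := fun h : G ↦ g * h * g⁻¹) (y := 1)
    (hgp.mdifferentiableAt (by simp)) (hl.mdifferentiableAt (by simp)) X
  have h2 := mfderiv_comp_model (ψ := fun y : M ↦ g • y) (f := fun h : G ↦ h • p) (y := 1)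
    ((contMDiff_const_smul E EG g).mdifferentiableAt (by simp)) (hp.mdifferentiableAt (by simp)) X
  rw [one_smul] at h2
  rw [mul_one, mul_inv_cancel] at h1
  exact ⟨_, h2.symm.trans ((congrArg (fun f ↦ mfderivModel EG E f 1 X) e).symm.trans h1)⟩

end Actions

/-! ### Curves in isotropy groups. -/

section Isotropy

variable {E : Type*} [NormedAddCommGroup E] [NormedSpace ℝ E]
  {M : Type*} [TopologicalSpace M] [ChartedSpace E M] [IsManifold 𝓘(ℝ, E) ∞ M]
  {EG : Type*} [NormedAddCommGroup EG] [NormedSpace ℝ EG]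
  {G : Type*} [TopologicalSpace G] [ChartedSpace EG G] [Group G] [LieGroup 𝓘(ℝ, EG) ∞ G]
  [MulAction G M] [ContMDiffSMul 𝓘(ℝ, EG) 𝓘(ℝ, E) ∞ G M]

/-- A curve whose velocity vanishes near a point is constant near that point. -/
theorem eventually_eq_of_velocityModel_eq_zero {γ : ℝ → M} {s₀ : ℝ}
    (hγ : ∀ᶠ s in nhds s₀, MDifferentiableAt 𝓘(ℝ, ℝ) 𝓘(ℝ, E) γ s)
    (h : ∀ᶠ s in nhds s₀, velocityModel E γ s = 0) : ∀ᶠ s in nhds s₀, γ s = γ s₀ := by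
  have hx := mem_chart_source E (γ s₀)
  obtain ⟨δ, hδ, hb⟩ := Metric.eventually_nhds_iff_ball.1 ((hγ.and h).and
    (hγ.self_of_nhds.continuousAt.eventually ((chartAt E (γ s₀)).open_source.mem_nhds hx)))
  have hd : ∀ s ∈ Metric.ball s₀ δ, HasDerivAt (fun s ↦ chartAt E (γ s₀) (γ s)) 0 s := by
    intro s hs
    have := tangentCoord_velocity (hb s hs).2 (hb s hs).1.1
    rwa [(hb s hs).1.2, map_zero] at this
  filter_upwards [Metric.isOpen_ball.mem_nhds (Metric.mem_ball_self hδ)] with s hs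
  refine (chartAt E (γ s₀)).injOn (hb s hs).2 hx ?_
  exact Metric.isOpen_ball.is_const_of_deriv_eq_zero (convex_ball s₀ δ).isPreconnected
    (fun t ht ↦ (hd t ht).differentiableAt.differentiableWithinAt)
    (fun t ht ↦ (hd t ht).deriv) hs (Metric.mem_ball_self hδ)

/-- An element of the Lie algebra whose action field vanishes at `p` is tangent to a curve in the
isotropy group of `p`. -/
theorem exists_isotropy_curve [CompleteSpace EG] {p : M} {X : EG}
    (hX : actionFieldModel E EG G p X = 0) :
    ∃ c : ℝ → G, c 0 = 1 ∧ MDifferentiableAt 𝓘(ℝ, ℝ) 𝓘(ℝ, EG) c 0 ∧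
      mfderivModel ℝ EG c 0 1 = X ∧ ∀ᶠ s in nhds 0, c s • p = p := by
  have : LieGroup 𝓘(ℝ, EG) (minSmoothness ℝ 3) G := by
    rw [minSmoothness_of_isRCLikeNormedField]
    exact LieGroup.of_le (n := ∞) (by norm_cast)
  have hv : ContMDiffAt 𝓘(ℝ, EG) 𝓘(ℝ, EG).tangent 1 (fun g : G ↦
      (⟨g, mulInvariantVectorField (show GroupLieAlgebra 𝓘(ℝ, EG) G from X) g⟩ :
        TangentBundle 𝓘(ℝ, EG) G)) 1 := by
    refine (contMDiffAt_mulInvariantVectorField _).of_le ?_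
    rw [minSmoothness_of_isRCLikeNormedField]
    norm_cast
  -- A local integral curve of the left-invariant field of `X` plays the role of `exp (s X)`. The
  -- velocity of `c s • p` is `c s` applied to `X^*_p = 0`, so this curve stays at `p` near `s = 0`.
  obtain ⟨c, hc0, hc⟩ := exists_isMIntegralCurveAt_of_contMDiffAt_boundaryless 0 hv
  have hcd : ∀ᶠ s in nhds (0 : ℝ), MDifferentiableAt 𝓘(ℝ, ℝ) 𝓘(ℝ, EG) c s ∧
      mfderivModel ℝ EG c s 1
        = mulInvariantVectorField (show GroupLieAlgebra 𝓘(ℝ, EG) G from X) (c s) := by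
    filter_upwards [hc] with s hs
    refine ⟨hs.mdifferentiableAt, ?_⟩
    refine (congrArg (fun L : ℝ →L[ℝ] EG ↦ L 1) hs.mfderiv).trans ?_
    exact one_smul ℝ (show EG from mulInvariantVectorField (show GroupLieAlgebra 𝓘(ℝ, EG) G from X) (c s))
  have hp := contMDiff_smul_const (G := G) E EG p
  refine ⟨c, hc0, hcd.self_of_nhds.1, ?_, ?_⟩
  · rw [hcd.self_of_nhds.2, hc0]
    have h1 : (fun g : G ↦ 1 * g) = id := funext fun g ↦ one_mul g
    unfold mulInvariantVectorField
    rw [h1]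
    exact congrArg (fun L : EG →L[ℝ] EG ↦ L X) mfderiv_id
  · have h := eventually_eq_of_velocityModel_eq_zero (γ := fun s ↦ c s • p) (s₀ := 0) (E := E)
      (hcd.mono fun s hs ↦ (hp.mdifferentiableAt (by simp)).comp s hs.1)
      (hcd.mono fun s hs ↦ by
        refine (mfderiv_comp_model (ψ := fun g : G ↦ g • p) (hp.mdifferentiableAt (by simp)) hs.1 1).trans ?_
        rw [hs.2]
        refine (mfderivModel_smul_const_mulInvariantVectorField p X (c s)).trans ?_
        rw [hX, map_zero])
    filter_upwards [h] with s hs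
    rw [hs, hc0, one_smul]

end Isotropy

/-! ### Derivatives of transported vectors under an isometric action. -/

section IsometricActions

variable {E : Type*} [NormedAddCommGroup E] [NormedSpace ℝ E] [FiniteDimensional ℝ E]
  {M : Type*} [TopologicalSpace M] [ChartedSpace E M] [IsManifold 𝓘(ℝ, E) ∞ M]
  [RiemannianBundle (fun x : M ↦ TangentSpace 𝓘(ℝ, E) x)]
  [IsContMDiffRiemannianBundle 𝓘(ℝ, E) ∞ E (fun x : M ↦ TangentSpace 𝓘(ℝ, E) x)]
  {EG : Type*} [NormedAddCommGroup EG] [NormedSpace ℝ EG]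
  {G : Type*} [TopologicalSpace G] [ChartedSpace EG G] [Group G] [LieGroup 𝓘(ℝ, EG) ∞ G]
  [MulAction G M] [ContMDiffSMul 𝓘(ℝ, EG) 𝓘(ℝ, E) ∞ G M]

theorem IsCohomogeneityOne.isLocalIsometry (hM : IsCohomogeneityOne E M EG G) (g : G) :
    IsLocalIsometry E (fun x : M ↦ g • x) where
  contMDiff := contMDiff_const_smul E EG g
  tangentInner_eq := hM.isometric g

theorem IsCohomogeneityOne.tangentInner_smulDiff (hM : IsCohomogeneityOne E M EG G) (g : G) (x : M)
    (v w : E) : tangentInner E (g • x) (smulDiff E g x v) (smulDiff E g x w)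
      = tangentInner E x v w :=
  hM.isometric g x v w

variable (E EG) in
/-- The covariant derivative, along the orbit map at `p`, of the field obtained by moving `w` with
the group. -/
def orbitCov (G : Type*) [TopologicalSpace G] [ChartedSpace EG G] [Group G] [MulAction G M]
    (p : M) (w : E) : EG →L[ℝ] E :=
  covAlong E EG (fun g : G ↦ g • p) (fun g ↦ smulDiff E g p w) 1

/-- The covariant derivative of the transported fields is skew-symmetric. -/
theorem IsCohomogeneityOne.orbitCov_skew (hM : IsCohomogeneityOne E M EG G) (p : M) (v w : E)
    (X : EG) : tangentInner E p (orbitCov E EG G p v X) w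
      = -tangentInner E p v (orbitCov E EG G p w X) := by
  have h := mvfderiv_tangentInner (mdiffAlong_smulDiff p v (1 : G)) (mdiffAlong_smulDiff p w (1 : G)) X
  -- Skew-symmetry is the derivative at `1` of a function that is constant because `G` acts
  -- isometrically.
  have h1 : (fun g : G ↦ tangentInner E (g • p) (smulDiff E g p v) (smulDiff E g p w))
      = fun _ ↦ tangentInner E p v w := funext fun g ↦ hM.tangentInner_smulDiff g p v w
  have h0 : mvfderiv 𝓘(ℝ, EG) (fun _ : G ↦ tangentInner E p v w) 1 X = 0 := by
    rw [mvfderiv_const]; rfl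
  rw [h1, h0, smulDiff_one, smulDiff_one, one_smul] at h
  exact eq_neg_of_add_eq_zero_left h.symm

/-- The isotropy group of `p` preserves the normal vectors of the orbit. -/
theorem IsCohomogeneityOne.smulDiff_orthogonal (hM : IsCohomogeneityOne E M EG G) {p : M} {ξ : E}
    (hξ : ∀ Y, tangentInner E p ξ (actionFieldModel E EG G p Y) = 0) {g : G} (hg : g • p = p)
    (Y : EG) : tangentInner E p (smulDiff E g p ξ) (actionFieldModel E EG G p Y) = 0 := by
  have hg' : g⁻¹ • p = p := by rw [inv_smul_eq_iff, hg]
  -- The isometry `g⁻¹` moves the inner product back to one of `ξ` with another tangent vector of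
  -- the same orbit.
  obtain ⟨Z, hZ⟩ := exists_smulDiff_actionFieldModel (E := E) g⁻¹ p Y
  rw [hg'] at hZ
  have h := hM.tangentInner_smulDiff g⁻¹ p (smulDiff E g p ξ) (actionFieldModel E EG G p Y)
  have h2 := smulDiff_mul EG g⁻¹ g p ξ
  rw [inv_mul_cancel, smulDiff_one, hg] at h2
  rw [← h2, hZ, hg', hξ] at h
  exact h.symm

theorem covAlong_const {F : Type*} [NormedAddCommGroup F] [NormedSpace ℝ F]
    {P : Type*} [TopologicalSpace P] [ChartedSpace F P] (p : M) (w : E) (y : P) (v : F) :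
    MDiffAlong E F (fun _ : P ↦ p) (fun _ ↦ w) y ∧
    covAlong E F (fun _ : P ↦ p) (fun _ ↦ w) y v = 0 := by
  constructor
  · exact mdifferentiableAt_const
  · have h1 : mvfderiv 𝓘(ℝ, F) (fun _ : P ↦ tangentCoord E p p w) y v = 0 := by
      rw [mvfderiv_const]; rfl
    have h2 : (mfderiv 𝓘(ℝ, F) 𝓘(ℝ, E) (fun _ : P ↦ p) y : F →L[ℝ] E) v = 0 := by
      rw [mfderiv_const]; rfl
    rw [covAlong_apply, h1]
    refine (zero_add _).trans ?_
    exact (congrArg (leviCivitaModel E (constField E p w) p) h2).trans (map_zero _)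

/-- The tangential part of the covariant derivative of a transported normal vector only depends on
the value of the action field. -/
theorem IsCohomogeneityOne.orbitCov_tangential [CompleteSpace EG]
    (hM : IsCohomogeneityOne E M EG G) {p : M} {ξ : E}
    (hξ : ∀ Y, tangentInner E p ξ (actionFieldModel E EG G p Y) = 0) {X : EG}
    (hX : actionFieldModel E EG G p X = 0) (Y : EG) :
    tangentInner E p (orbitCov E EG G p ξ X) (actionFieldModel E EG G p Y) = 0 := by
  -- The derivative in the direction `X` can be taken along `c`. There the base point is constant
  -- and `c s • ξ` remains normal to the orbit, so differentiating its product with the fixed vector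
  -- `Y^*_p` gives zero.
  obtain ⟨c, hc0, hc, hcX, hcp⟩ := exists_isotropy_curve hX
  have hV : MDiffAlong E EG (fun g : G ↦ g • p) (fun g ↦ smulDiff E g p ξ) (c 0) :=
    mdiffAlong_smulDiff p ξ _
  have h1 := covAlong_comp hV hc (1 : ℝ)
  have hV' := hV.comp hc
  have hf : (fun s ↦ c s • p) =ᶠ[nhds 0] fun _ ↦ p := hcp
  have hW := covAlong_const (E := E) p (actionFieldModel E EG G p Y) (0 : ℝ) (1 : ℝ)
  have h2 := mvfderiv_tangentInner (hV'.congr hf .rfl) hW.1 (1 : ℝ)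
  have h3 : (fun s ↦ tangentInner E p (smulDiff E (c s) p ξ) (actionFieldModel E EG G p Y))
      =ᶠ[nhds 0] fun _ ↦ 0 := by
    filter_upwards [hcp] with s hs using hM.smulDiff_orthogonal hξ hs Y
  have h0 : mvfderiv 𝓘(ℝ, ℝ) (fun _ : ℝ ↦ (0 : ℝ)) 0 (1 : ℝ) = 0 := by rw [mvfderiv_const]; rfl
  rw [mvfderiv_congr h3, h0, hW.2, tangentInner_zero_right, add_zero,
    ← covAlong_congr hf .rfl, h1] at h2
  have h4 : (mfderiv 𝓘(ℝ, ℝ) 𝓘(ℝ, EG) c 0 (1 : ℝ) : EG) = X := hcX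
  rw [hc0] at h2
  have h5 := h2.symm
  exact (congrArg (fun Z : EG ↦ tangentInner E p (orbitCov E EG G p ξ Z)
    (actionFieldModel E EG G p Y)) h4).symm.trans h5

end IsometricActions

/-- This provides existence for operators prescribed on action fields: only the vanishing where the
action field vanishes remains to be checked. -/
theorem LinearMap.exists_apply_eq_of_surjective {V W U : Type*} [AddCommGroup V] [Module ℝ V]
    [AddCommGroup W] [Module ℝ W] [AddCommGroup U] [Module ℝ U] {f : V →ₗ[ℝ] W}
    (hf : Function.Surjective f) (g : V →ₗ[ℝ] U) (h : ∀ x, f x = 0 → g x = 0) :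
    ∃ L : W →ₗ[ℝ] U, ∀ x, L (f x) = g x := by
  obtain ⟨s, hs⟩ := f.exists_rightInverse_of_surjective (LinearMap.range_eq_top.2 hf)
  refine ⟨g ∘ₗ s, fun x ↦ ?_⟩
  have h1 : f (s (f x) - x) = 0 := by
    rw [map_sub, sub_eq_zero]
    exact congrArg (fun L : W →ₗ[ℝ] W ↦ L (f x)) hs
  have h2 := h _ h1
  rw [map_sub, sub_eq_zero] at h2
  exact h2

/-! ### Hyperplanes and their unit normals. -/

section Codimension

variable {V : Type*} [NormedAddCommGroup V] [InnerProductSpace ℝ V] [FiniteDimensional ℝ V]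
  {O : Submodule ℝ V} {ξ : V}

theorem eq_smul_of_orthogonal_of_finrank (hO : Module.finrank ℝ O + 1 = Module.finrank ℝ V)
    (hξ : ⟪ξ, ξ⟫_ℝ = 1) (hξO : ∀ w ∈ O, ⟪ξ, w⟫_ℝ = 0) {v : V} (hv : ∀ w ∈ O, ⟪v, w⟫_ℝ = 0) :
    v = ⟪ξ, v⟫_ℝ • ξ := by
  have h1 : Module.finrank ℝ Oᗮ = 1 := by
    have := O.finrank_add_finrank_orthogonal
    omega
  have hξ' : ξ ∈ Oᗮ := (Submodule.mem_orthogonal' _ _).2 hξO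
  have hv' : v ∈ Oᗮ := (Submodule.mem_orthogonal' _ _).2 hv
  have hne : (⟨ξ, hξ'⟩ : Oᗮ) ≠ 0 := by
    intro h
    have h0 : ξ = 0 := congrArg Subtype.val h
    rw [h0, inner_zero_left] at hξ
    exact zero_ne_one hξ
  obtain ⟨c, hc⟩ := (finrank_eq_one_iff_of_nonzero' _ hne).1 h1 ⟨v, hv'⟩
  have hc' : c • ξ = v := congrArg Subtype.val hc
  rw [← hc', inner_smul_right, hξ, mul_one]

theorem mem_of_inner_eq_zero_of_finrank (hO : Module.finrank ℝ O + 1 = Module.finrank ℝ V)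
    (hξ : ⟪ξ, ξ⟫_ℝ = 1) (hξO : ∀ w ∈ O, ⟪ξ, w⟫_ℝ = 0) {v : V} (hv : ⟪ξ, v⟫_ℝ = 0) : v ∈ O := by
  have h := eq_smul_of_orthogonal_of_finrank hO hξ hξO
    (v := v - O.orthogonalProjectionOnto v) fun w hw ↦ by
      rw [real_inner_comm]
      exact (Submodule.mem_orthogonal _ _).1 (O.sub_starProjection_mem_orthogonal v) w hw
  rw [inner_sub_right, hv, hξO _ (O.orthogonalProjectionOnto v).2, sub_zero, zero_smul,
    sub_eq_zero] at h
  rw [h]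
  exact (O.orthogonalProjectionOnto v).2

end Codimension

/-! ### Normal geodesics, the action field homomorphism and the shape operator. -/

section NormalGeodesics

variable {E : Type*} [NormedAddCommGroup E] [NormedSpace ℝ E] [FiniteDimensional ℝ E]
  {M : Type*} [TopologicalSpace M] [ChartedSpace E M] [IsManifold 𝓘(ℝ, E) ∞ M]
  [RiemannianBundle (fun x : M ↦ TangentSpace 𝓘(ℝ, E) x)]
  [IsContMDiffRiemannianBundle 𝓘(ℝ, E) ∞ E (fun x : M ↦ TangentSpace 𝓘(ℝ, E) x)]
  {EG : Type*} [NormedAddCommGroup EG] [NormedSpace ℝ EG]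
  {G : Type*} [TopologicalSpace G] [ChartedSpace EG G] [Group G] [LieGroup 𝓘(ℝ, EG) ∞ G]
  [MulAction G M] [ContMDiffSMul 𝓘(ℝ, EG) 𝓘(ℝ, E) ∞ G M]

theorem IsNormalGeodesic.isGeodesicCurve {γ : ℝ → M} (hγ : IsNormalGeodesic E EG G γ) :
    IsGeodesicCurve E γ :=
  ⟨hγ.contMDiff, fun t ↦ (covDerivAlong_eq_covAlong γ (velocityModel E γ) t (1 : ℝ)).symm.trans
    (hγ.geodesic t)⟩

theorem IsNormalGeodesic.tangentInner_velocity {γ : ℝ → M} (hγ : IsNormalGeodesic E EG G γ) (t : ℝ) :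
    tangentInner E (γ t) (velocityModel E γ t) (velocityModel E γ t) = 1 :=
  hγ.unit_speed t

theorem IsNormalGeodesic.tangentInner_actionField {γ : ℝ → M} (hγ : IsNormalGeodesic E EG G γ)
    (t : ℝ) (X : EG) :
    tangentInner E (γ t) (velocityModel E γ t) (actionFieldModel E EG G (γ t) X) = 0 :=
  hγ.perpendicular t X

theorem IsNormalGeodesic.eq_smul_velocity {γ : ℝ → M} (hγ : IsNormalGeodesic E EG G γ) {t : ℝ}
    (ht : IsHypersurfaceOrbit E EG G (γ t)) {v : E}
    (hv : ∀ X, tangentInner E (γ t) v (actionFieldModel E EG G (γ t) X) = 0) :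
    v = tangentInner E (γ t) (velocityModel E γ t) v • velocityModel E γ t :=
  eq_smul_of_orthogonal_of_finrank (V := TangentSpace 𝓘(ℝ, E) (γ t))
    (O := orbitTangent E EG G (γ t)) (ξ := velocity γ t) ht (hγ.unit_speed t)
    (by rintro _ ⟨X, rfl⟩; exact hγ.perpendicular t X) (by rintro _ ⟨X, rfl⟩; exact hv X)

theorem IsNormalGeodesic.exists_actionField_eq {γ : ℝ → M} (hγ : IsNormalGeodesic E EG G γ) {t : ℝ}
    (ht : IsHypersurfaceOrbit E EG G (γ t)) {v : E}
    (hv : tangentInner E (γ t) (velocityModel E γ t) v = 0) :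
    ∃ X, actionFieldModel E EG G (γ t) X = v :=
  mem_of_inner_eq_zero_of_finrank (V := TangentSpace 𝓘(ℝ, E) (γ t))
    (O := orbitTangent E EG G (γ t)) (ξ := velocity γ t) ht (hγ.unit_speed t)
    (by rintro _ ⟨X, rfl⟩; exact hγ.perpendicular t X) hv

theorem mfderivModel_smul_curve {c : ℝ → G} (hc0 : c 0 = 1)
    (hc : MDifferentiableAt 𝓘(ℝ, ℝ) 𝓘(ℝ, EG) c 0) {X : EG} (hX : mfderivModel ℝ EG c 0 1 = X) (p : M) :
    velocityModel E (fun s ↦ c s • p) 0 = actionFieldModel E EG G p X := by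
  have h := mfderiv_comp_model (ψ := fun g : G ↦ g • p)
    ((contMDiff_smul_const (G := G) E EG p).mdifferentiableAt (by simp)) hc 1
  rwa [hX, hc0] at h

/-- An element of the isotropy algebra of a point of a normal geodesic, on an orbit of codimension
one, belongs to the isotropy algebra of every point of the geodesic. -/
theorem IsNormalGeodesic.actionFieldModel_eq_zero [CompleteSpace EG] [T2Space M]
    (hM : IsCohomogeneityOne E M EG G) {γ : ℝ → M}
    (hγ : IsNormalGeodesic E EG G γ) {a : ℝ} (ha : IsHypersurfaceOrbit E EG G (γ a)) {X : EG}
    (hX : actionFieldModel E EG G (γ a) X = 0) (b : ℝ) : actionFieldModel E EG G (γ b) X = 0 := by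
  obtain ⟨c, hc0, hc, hcX, hcp⟩ := exists_isotropy_curve hX
  set ξ := velocityModel E γ a with hξ
  have hV : MDiffAlong E EG (fun g : G ↦ g • γ a) (fun g ↦ smulDiff E g (γ a) ξ) (c 0) :=
    mdiffAlong_smulDiff _ ξ _
  have hf : (fun s ↦ c s • γ a) =ᶠ[nhds 0] fun _ ↦ γ a := hcp
  have hcont := (mdifferentiableAt_tangentInner (covAlong_const (E := E) (γ a) ξ (0 : ℝ) (1 : ℝ)).1
    ((hV.comp hc).congr hf .rfl)).continuousAt
  -- The isotropy group acts on the normal line by signs. Continuity from the value `1` at `s = 0`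
  -- excludes the reflection of the normal vector.
  have hpos : ∀ᶠ s in nhds 0, 0 < tangentInner E (γ a) ξ (smulDiff E (c s) (γ a) ξ) := by
    refine hcont.eventually (lt_mem_nhds ?_)
    simp only [hc0]
    rw [smulDiff_one, hγ.tangentInner_velocity]
    exact one_pos
  have hfix : ∀ᶠ s in nhds 0, c s • γ b = γ b := by
    filter_upwards [hpos, hcp] with s hs hcs
    have h1 := hγ.eq_smul_velocity ha (hM.smulDiff_orthogonal (hγ.tangentInner_actionField a) hcs)
    rw [← hξ] at h1
    set l := tangentInner E (γ a) ξ (smulDiff E (c s) (γ a) ξ) with hl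
    have h2 := hM.tangentInner_smulDiff (c s) (γ a) ξ ξ
    rw [hcs, h1, tangentInner_smul_left, tangentInner_smul_right, hγ.tangentInner_velocity] at h2
    have h3 : l = 1 := by nlinarith
    rw [h3, one_smul] at h1
    -- The isometry `c s` fixes both the point and the velocity of `γ` at `a`, hence the entire
    -- geodesic. Differentiating `c s • γ b = γ b` at `s = 0` makes the action field vanish at `γ
    -- b`.
    have hv : velocityModel E (fun u ↦ c s • γ u) a = velocityModel E γ a :=
      (velocityModel_comp (contMDiff_const_smul E EG (c s)) hγ.contMDiff a).trans h1
    exact congrFun (((hM.isLocalIsometry (c s)).isGeodesicCurve hγ.isGeodesicCurve).eq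
      hγ.isGeodesicCurve hcs hv) b
  have h1 := mfderivModel_smul_curve (E := E) hc0 hc hcX (γ b)
  have h2 : (fun s ↦ c s • γ b) =ᶠ[nhds 0] fun _ ↦ γ b := hfix
  rw [← h1]
  refine (congrArg (fun L : ℝ →L[ℝ] E ↦ L 1) h2.mfderiv_eq).trans ?_
  exact congrArg (fun L : ℝ →L[ℝ] E ↦ L 1) mfderiv_const

theorem orbitField_surjective (p : M) : Function.Surjective (orbitField E EG G p) :=
  (actionField E EG G p).toLinearMap.surjective_rangeRestrict

/-- The characteristic property of the action field homomorphism. -/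
theorem IsNormalGeodesic.actionFieldHom_orbitField [CompleteSpace EG] [T2Space M]
    (hM : IsCohomogeneityOne E M EG G) {γ : ℝ → M}
    (hγ : IsNormalGeodesic E EG G γ) {a : ℝ} (ha : IsHypersurfaceOrbit E EG G (γ a)) (b : ℝ)
    (X : GroupLieAlgebra 𝓘(ℝ, EG) G) :
    actionFieldHom E EG G γ a b (orbitField E EG G (γ a) X) = orbitField E EG G (γ b) X := by
  have hex := LinearMap.exists_apply_eq_of_surjective (orbitField_surjective (E := E) (EG := EG)
    (G := G) (γ a)) (orbitField E EG G (γ b)) fun X hX ↦ by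
      have h := hγ.actionFieldModel_eq_zero hM ha (X := X) (congrArg Subtype.val hX) b
      exact Subtype.ext h
  exact Classical.epsilon_spec hex X

/-- The shape operator, in terms of action fields. -/
theorem IsCohomogeneityOne.inner_shapeOperator [CompleteSpace EG]
    (hM : IsCohomogeneityOne E M EG G) {p : M} {ξ : E}
    (hξ : ∀ Y, tangentInner E p ξ (actionFieldModel E EG G p Y) = 0) (X Y : EG) :
    ⟪shapeOperator E EG G p ξ (orbitField E EG G p X), orbitField E EG G p Y⟫_ℝ
      = -tangentInner E p (orbitCov E EG G p ξ X) (actionFieldModel E EG G p Y) := by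
  let C : GroupLieAlgebra 𝓘(ℝ, EG) G →ₗ[ℝ] TangentSpace 𝓘(ℝ, E) p :=
    (show EG →ₗ[ℝ] E from (orbitCov E EG G p ξ).toLinearMap)
  have hC : ∀ X, C X = covDerivAlong (fun g : G ↦ g • p)
      (fun g ↦ mfderiv 𝓘(ℝ, E) 𝓘(ℝ, E) (fun y : M ↦ g • y) p ξ) 1 X := fun X ↦
    (covDerivAlong_eq_covAlong (F := EG) (fun g : G ↦ g • p) (fun g ↦ smulDiff E g p ξ) 1 X).symm
  have hex := LinearMap.exists_apply_eq_of_surjective (orbitField_surjective (E := E) (EG := EG)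
    (G := G) p) (-((orbitTangent E EG G p).orthogonalProjectionOnto.toLinearMap ∘ₗ C))
    fun X hX ↦ by
      have h := hM.orbitCov_tangential hξ (X := X) (congrArg Subtype.val hX)
      have h2 : (orbitTangent E EG G p).orthogonalProjectionOnto (C X) = 0 := by
        refine (Submodule.orthogonalProjectionOnto_eq_zero_iff).2 ?_
        refine (Submodule.mem_orthogonal' _ _).2 ?_
        rintro _ ⟨Y, rfl⟩
        exact h Y
      exact neg_eq_zero.2 h2
  have hspec := Classical.epsilon_spec (p := fun S : orbitTangent E EG G p →ₗ[ℝ]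
      orbitTangent E EG G p ↦ ∀ X : GroupLieAlgebra 𝓘(ℝ, EG) G, S (orbitField E EG G p X) =
      -(orbitTangent E EG G p).orthogonalProjectionOnto (covDerivAlong (fun g : G ↦ g • p)
        (fun g ↦ mfderiv 𝓘(ℝ, E) 𝓘(ℝ, E) (fun y : M ↦ g • y) p ξ) 1 X))
    (hex.imp fun S hS X ↦ (hS X).trans (congrArg (fun v ↦
      -(orbitTangent E EG G p).orthogonalProjectionOnto v) (hC X)))
  have h1 : shapeOperator E EG G p ξ (orbitField E EG G p X)
      = -(orbitTangent E EG G p).orthogonalProjectionOnto (C X) :=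
    (hspec X).trans (congrArg (fun v ↦ -(orbitTangent E EG G p).orthogonalProjectionOnto v) (hC X).symm)
  rw [h1, inner_neg_left, neg_inj]
  exact Submodule.inner_orthogonalProjectionOnto_eq_of_mem_right (orbitField E EG G p Y) (C X)

end NormalGeodesics

/-! ### Local sections of submersions. -/

/-- A smooth map whose derivative at a point is surjective has a smooth local section. -/
theorem ContDiffAt.exists_section {V E : Type*} [NormedAddCommGroup V] [NormedSpace ℝ V]
    [NormedAddCommGroup E] [NormedSpace ℝ E] [FiniteDimensional ℝ E] {f : V → E} {v₀ : V}
    (hf : ContDiffAt ℝ ∞ f v₀) (hs : Function.Surjective (fderiv ℝ f v₀)) :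
    ∃ θ : E → V, ContDiffAt ℝ ∞ θ (f v₀) ∧ θ (f v₀) = v₀ ∧ ∀ᶠ y in nhds (f v₀), f (θ y) = y := by
  have : CompleteSpace E := FiniteDimensional.complete ℝ E
  obtain ⟨R, hR⟩ := (fderiv ℝ f v₀).toLinearMap.exists_rightInverse_of_surjective
    (LinearMap.range_eq_top.2 hs)
  let R' : E →L[ℝ] V := R.toContinuousLinearMap
  -- On the affine slice through `v₀` given by a right inverse of the derivative, `f` has derivative
  -- the identity, so the inverse function theorem on `E` suffices.
  let a : E → V := fun y ↦ v₀ + R' (y - f v₀)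
  have ha : ContDiff ℝ ∞ a := contDiff_const.add (R'.contDiff.comp (contDiff_id.sub contDiff_const))
  have ha0 : a (f v₀) = v₀ := by simp [a]
  have had : HasFDerivAt a R' (f v₀) := by
    have h1 : HasFDerivAt (fun y : E ↦ y - f v₀) (ContinuousLinearMap.id ℝ E) (f v₀) :=
      (hasFDerivAt_id (f v₀)).sub_const (f v₀)
    exact (R'.hasFDerivAt.comp (f v₀) h1).const_add v₀
  have hg : ContDiffAt ℝ ∞ (fun y ↦ f (a y)) (f v₀) :=
    ContDiffAt.comp (f v₀) (by rwa [ha0]) ha.contDiffAt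
  have hgd : HasFDerivAt (fun y ↦ f (a y)) ((ContinuousLinearEquiv.refl ℝ E : E ≃L[ℝ] E) : E →L[ℝ] E)
      (f v₀) := by
    have h1 : HasFDerivAt f (fderiv ℝ f v₀) (a (f v₀)) := by
      rw [ha0]
      exact (hf.differentiableAt (by simp)).hasFDerivAt
    have h2 : fderiv ℝ f v₀ ∘L R' = ((ContinuousLinearEquiv.refl ℝ E : E ≃L[ℝ] E) : E →L[ℝ] E) := by
      ext y
      exact congrArg (fun L : E →ₗ[ℝ] E ↦ L y) hR
    exact h2 ▸ h1.comp (f v₀) had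
  have hg0 : f (a (f v₀)) = f v₀ := by rw [ha0]
  have hc := hg.to_localInverse hgd (by simp)
  have hi := hg.localInverse_apply_image hgd (by simp)
  have hr := (hg.hasStrictFDerivAt' hgd (by simp)).eventually_right_inverse
  simp only [hg0] at hc hi hr
  refine ⟨fun y ↦ a (hg.localInverse hgd (by simp) y), ha.contDiffAt.comp _ hc, ?_, hr⟩
  exact (congrArg a hi).trans ha0

section Section

variable {E : Type*} [NormedAddCommGroup E] [NormedSpace ℝ E] [FiniteDimensional ℝ E]
  {M : Type*} [TopologicalSpace M] [ChartedSpace E M] [IsManifold 𝓘(ℝ, E) ∞ M]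

theorem mfderivModel_chartAt {x₀ x : M} (hx : x ∈ (chartAt E x₀).source) :
    mfderivModel E E (chartAt E x₀) x = tangentCoord E x₀ x :=
  mfderiv_chartAt_eq_tangentCoordChange hx

theorem contMDiffAt_chartAt {x₀ x : M} (hx : x ∈ (chartAt E x₀).source) :
    ContMDiffAt 𝓘(ℝ, E) 𝓘(ℝ, E) ∞ (chartAt E x₀) x :=
  contMDiffAt_of_mem_maximalAtlas (IsManifold.chart_mem_maximalAtlas x₀) hx

theorem ContMDiffAt.exists_section {V : Type*} [NormedAddCommGroup V] [NormedSpace ℝ V] {Φ : V → M}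
    {v₀ : V} (hΦ : ContMDiffAt 𝓘(ℝ, V) 𝓘(ℝ, E) ∞ Φ v₀)
    (hs : Function.Surjective (mfderivModel V E Φ v₀)) :
    ∃ θ : M → V, ContMDiffAt 𝓘(ℝ, E) 𝓘(ℝ, V) ∞ θ (Φ v₀) ∧ θ (Φ v₀) = v₀ ∧
      ∀ᶠ x in nhds (Φ v₀), Φ (θ x) = x := by
  have hx := mem_chart_source E (Φ v₀)
  set x₀ := Φ v₀ with hx₀
  have hc := contMDiffAt_chartAt (E := E) hx
  have hf : ContMDiffAt 𝓘(ℝ, V) 𝓘(ℝ, E) ∞ (fun v ↦ chartAt E x₀ (Φ v)) v₀ :=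
    ContMDiffAt.comp v₀ hc hΦ
  have hd : ∀ v, fderiv ℝ (fun v ↦ chartAt E x₀ (Φ v)) v₀ v = mfderivModel V E Φ v₀ v := by
    intro v
    have h := mfderiv_comp_model (ψ := chartAt E x₀) (f := Φ) (y := v₀)
      (hc.mdifferentiableAt (by simp)) (hΦ.mdifferentiableAt (by simp)) v
    rw [mfderivModel_chartAt hx] at h
    refine Eq.trans ?_ (h.trans (tangentCoord_self x₀ _))
    exact (congrArg (fun L : V →L[ℝ] E ↦ L v) mfderiv_eq_fderiv).symm
  obtain ⟨θ, h1, h2, h3⟩ := hf.contDiffAt.exists_section fun w ↦ by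
    obtain ⟨v, hv⟩ := hs w
    exact ⟨v, (hd v).trans hv⟩
  refine ⟨fun x ↦ θ (chartAt E x₀ x), ContMDiffAt.comp x₀ h1.contMDiffAt hc, h2, ?_⟩
  have hθ : ContinuousAt (fun x ↦ θ (chartAt E x₀ x)) x₀ :=
    ContinuousAt.comp h1.continuousAt hc.continuousAt
  have hΦθ : ∀ᶠ x in nhds x₀, Φ (θ (chartAt E x₀ x)) ∈ (chartAt E x₀).source := by
    refine (ContinuousAt.comp (g := Φ) ?_ hθ).eventually ?_
    · simp only [hx₀] at h2 ⊢
      rw [h2]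
      exact hΦ.continuousAt
    · refine (chartAt E x₀).open_source.mem_nhds ?_
      change Φ (θ (chartAt E x₀ x₀)) ∈ _
      rw [hx₀] at h2 ⊢
      rw [h2]
      exact hx
  filter_upwards [hc.continuousAt.eventually h3, hΦθ, (chartAt E x₀).open_source.mem_nhds hx]
    with x hx1 hx2 hx3
  exact (chartAt E x₀).injOn hx2 hx3 hx1

theorem mfderivModel_chartAt_symm_surjective (x : M) :
    Function.Surjective (mfderivModel E E (chartAt E x).symm (chartAt E x x)) := by
  intro v
  have hx := mem_chart_source E x
  have hc := contMDiffAt_chartAt (E := E) hx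
  have hs : ContMDiffAt 𝓘(ℝ, E) 𝓘(ℝ, E) ∞ (chartAt E x).symm (chartAt E x x) :=
    contMDiffAt_symm_of_mem_maximalAtlas (IsManifold.chart_mem_maximalAtlas x)
      ((chartAt E x).map_source hx)
  have h := mfderiv_comp_model (ψ := (chartAt E x).symm) (f := chartAt E x) (y := x)
      (hs.mdifferentiableAt (by simp)) (hc.mdifferentiableAt (by simp)) v
  have he : (fun z ↦ (chartAt E x).symm (chartAt E x z)) =ᶠ[nhds x] id := by
    filter_upwards [(chartAt E x).open_source.mem_nhds hx] with z hz using (chartAt E x).left_inv hz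
  refine ⟨_, h.symm.trans ?_⟩
  refine (congrArg (fun L : E →L[ℝ] E ↦ L v) he.mfderiv_eq).trans ?_
  exact congrArg (fun L : E →L[ℝ] E ↦ L v) mfderiv_id

end Section

/-! ### Traces of bilinear forms. -/

section Trace

variable {V : Type*} [NormedAddCommGroup V] [InnerProductSpace ℝ V]

/-- Both sums are the trace of the operator representing `β`. Symmetry is not required, so the
symmetry of `∇dψ` need not be established. -/
theorem sum_bilinear_orthonormalBasis {ι ι' : Type*} [Fintype ι] [Fintype ι']
    (b : OrthonormalBasis ι ℝ V) (b' : OrthonormalBasis ι' ℝ V) (β : V →ₗ[ℝ] V →ₗ[ℝ] ℝ) :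
    ∑ i, β (b i) (b i) = ∑ j, β (b' j) (b' j) := by
  classical
  let T : V →ₗ[ℝ] V := ∑ i, (β (b i)).smulRight (b i)
  have hT : ∀ u w, ⟪w, T u⟫_ℝ = β w u := by
    intro u w
    have hw : β w u = β (∑ i, ⟪b i, w⟫_ℝ • b i) u := by rw [b.sum_repr']
    rw [hw]
    simp only [T, LinearMap.sum_apply, LinearMap.smulRight_apply, inner_sum, inner_smul_right, map_sum,
      map_smul, LinearMap.smul_apply, smul_eq_mul]
    exact Finset.sum_congr rfl fun i _ ↦ by rw [mul_comm, real_inner_comm]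
  have h1 := LinearMap.trace_eq_sum_inner T b
  have h2 := LinearMap.trace_eq_sum_inner T b'
  simp only [hT] at h1 h2
  rw [← h1, h2]

theorem sum_bilinear_hyperplane [FiniteDimensional ℝ V] {ι : Type*} [Fintype ι] (b : OrthonormalBasis ι ℝ V)
    (β : V →ₗ[ℝ] V →ₗ[ℝ] ℝ) {O : Submodule ℝ V} {ξ : V}
    (hO : Module.finrank ℝ O + 1 = Module.finrank ℝ V)
    (hξ : ⟪ξ, ξ⟫_ℝ = 1) (hξO : ∀ w ∈ O, ⟪ξ, w⟫_ℝ = 0) {n : ℕ} (e : OrthonormalBasis (Fin n) ℝ O) :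
    ∑ i, β (b i) (b i) = ∑ μ, β (e μ) (e μ) + β ξ ξ := by
  classical
  let v : Fin n ⊕ Unit → V := Sum.elim (fun μ ↦ (e μ : V)) fun _ ↦ ξ
  have hv : Orthonormal ℝ v := by
    rw [orthonormal_iff_ite]
    rintro (i | i) (j | j)
    · have := orthonormal_iff_ite.1 e.orthonormal i j
      simpa [v] using this
    · simpa [v] using (real_inner_comm _ _).trans (hξO _ (e i).2)
    · simpa [v] using hξO _ (e j).2
    · simpa [v] using hξ
  have hcard : Fintype.card (Fin n ⊕ Unit) = Module.finrank ℝ V := by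
    rw [← hO, Module.finrank_eq_card_basis e.toBasis]
    simp
  let c := basisOfOrthonormalOfCardEqFinrank hv hcard
  have hc : ⇑c = v := coe_basisOfOrthonormalOfCardEqFinrank hv hcard
  let b' := c.toOrthonormalBasis (by rw [hc]; exact hv)
  have hb' : ⇑b' = v := by rw [← hc]; exact c.coe_toOrthonormalBasis _
  rw [sum_bilinear_orthonormalBasis b b' β, hb', Fintype.sum_sum_type]
  simp [v]

end Trace

/-! ### Smoothness of equivariant maps at orbits of codimension one. -/

section Equivariant

variable {E : Type*} [NormedAddCommGroup E] [NormedSpace ℝ E] [FiniteDimensional ℝ E]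
  {M : Type*} [TopologicalSpace M] [ChartedSpace E M] [IsManifold 𝓘(ℝ, E) ∞ M]
  [RiemannianBundle (fun x : M ↦ TangentSpace 𝓘(ℝ, E) x)]
  [IsContMDiffRiemannianBundle 𝓘(ℝ, E) ∞ E (fun x : M ↦ TangentSpace 𝓘(ℝ, E) x)]
  {EG : Type*} [NormedAddCommGroup EG] [NormedSpace ℝ EG] [FiniteDimensional ℝ EG]
  {G : Type*} [TopologicalSpace G] [ChartedSpace EG G] [Group G] [LieGroup 𝓘(ℝ, EG) ∞ G]
  [MulAction G M] [ContMDiffSMul 𝓘(ℝ, EG) 𝓘(ℝ, E) ∞ G M]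
  {F : Type*} [NormedAddCommGroup F] [NormedSpace ℝ F]
  {N : Type*} [TopologicalSpace N] [ChartedSpace F N]
  {EK : Type*} [NormedAddCommGroup EK] [NormedSpace ℝ EK]
  {K : Type*} [TopologicalSpace K] [ChartedSpace EK K] [Group K]
  [MulAction K N] [ContMDiffSMul 𝓘(ℝ, EK) 𝓘(ℝ, F) ∞ K N]

/-- Near a point of a normal geodesic on an orbit of codimension one, the group and the geodesic give
a smooth parametrization of `M`. -/
theorem IsNormalGeodesic.exists_smul_section {γ : ℝ → M} (hγ : IsNormalGeodesic E EG G γ) {t : ℝ}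
    (ht : IsHypersurfaceOrbit E EG G (γ t)) : ∃ (g : M → G) (s : M → ℝ),
      ContMDiffAt 𝓘(ℝ, E) 𝓘(ℝ, EG) ∞ g (γ t) ∧ ContMDiffAt 𝓘(ℝ, E) 𝓘(ℝ, ℝ) ∞ s (γ t) ∧
      s (γ t) = t ∧ ∀ᶠ x in nhds (γ t), g x • γ (s x) = x := by
  let σ : EG → G := (chartAt EG (1 : G)).symm
  let a₀ : EG := chartAt EG (1 : G) 1
  have hσ : ContMDiffAt 𝓘(ℝ, EG) 𝓘(ℝ, EG) ∞ σ a₀ :=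
    contMDiffAt_symm_of_mem_maximalAtlas (IsManifold.chart_mem_maximalAtlas _)
      ((chartAt EG (1 : G)).map_source (mem_chart_source EG (1 : G)))
  have hσ1 : σ a₀ = 1 := (chartAt EG (1 : G)).left_inv (mem_chart_source EG (1 : G))
  have hfst : ContMDiffAt 𝓘(ℝ, EG × ℝ) 𝓘(ℝ, EG) ∞ (Prod.fst : EG × ℝ → EG) (a₀, t) :=
    contDiff_fst.contMDiff.contMDiffAt
  have hsnd : ContMDiffAt 𝓘(ℝ, EG × ℝ) 𝓘(ℝ, ℝ) ∞ (Prod.snd : EG × ℝ → ℝ) (a₀, t) :=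
    contDiff_snd.contMDiff.contMDiffAt
  have h1 : ContMDiffAt 𝓘(ℝ, EG × ℝ) 𝓘(ℝ, EG) ∞ (fun v : EG × ℝ ↦ σ v.1) (a₀, t) :=
    ContMDiffAt.comp (a₀, t) hσ hfst
  have h2 : ContMDiffAt 𝓘(ℝ, EG × ℝ) 𝓘(ℝ, E) ∞ (fun v : EG × ℝ ↦ γ v.2) (a₀, t) :=
    ContMDiffAt.comp (a₀, t) hγ.contMDiff.contMDiffAt hsnd
  have hΦ : ContMDiffAt 𝓘(ℝ, EG × ℝ) 𝓘(ℝ, E) ∞ (fun v : EG × ℝ ↦ σ v.1 • γ v.2) (a₀, t) :=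
    h1.smul h2
  have hΦ0 : σ (a₀, t).1 • γ (a₀, t).2 = γ t := by simp only [hσ1, one_smul]
  have hd1 : ∀ a, mfderivModel (EG × ℝ) E (fun v : EG × ℝ ↦ σ v.1 • γ v.2) (a₀, t) (a, 0)
      = actionFieldModel E EG G (γ t) (mfderivModel EG EG σ a₀ a) := by
    intro a
    have hin : MDifferentiableAt 𝓘(ℝ, EG) 𝓘(ℝ, EG × ℝ) (fun a : EG ↦ (a, t)) a₀ :=
      (contDiff_id.prodMk contDiff_const : ContDiff ℝ ∞ fun a : EG ↦ (a, t)).contMDiff.mdifferentiable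
        (by simp) a₀
    have e1 := mfderiv_comp_model (ψ := fun v : EG × ℝ ↦ σ v.1 • γ v.2) (f := fun a ↦ (a, t))
      (hΦ.mdifferentiableAt (by simp)) hin a
    have e2 := mfderiv_comp_model (ψ := fun g : G ↦ g • γ t) (f := σ) (y := a₀)
      ((contMDiff_smul_const (G := G) E EG (γ t)).mdifferentiableAt (by simp))
      (hσ.mdifferentiableAt (by simp)) a
    rw [hσ1] at e2
    have e3 : mfderivModel EG (EG × ℝ) (fun a : EG ↦ (a, t)) a₀ a = (a, 0) := by
      have h : HasFDerivAt (fun a : EG ↦ (a, t)) ((ContinuousLinearMap.id ℝ EG).prod 0) a₀ :=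
        (hasFDerivAt_id a₀).prodMk (hasFDerivAt_const t a₀)
      exact congrArg (fun L : EG →L[ℝ] EG × ℝ ↦ L a) (mfderiv_eq_fderiv.trans h.fderiv)
    rw [e3] at e1
    exact e1.symm.trans e2
  have hd2 : mfderivModel (EG × ℝ) E (fun v : EG × ℝ ↦ σ v.1 • γ v.2) (a₀, t) (0, 1)
      = velocityModel E γ t := by
    have hin : MDifferentiableAt 𝓘(ℝ, ℝ) 𝓘(ℝ, EG × ℝ) (fun s : ℝ ↦ (a₀, s)) t :=
      (contDiff_const.prodMk contDiff_id : ContDiff ℝ ∞ fun s : ℝ ↦ (a₀, s)).contMDiff.mdifferentiable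
        (by simp) t
    have e1 := mfderiv_comp_model (ψ := fun v : EG × ℝ ↦ σ v.1 • γ v.2) (f := fun s ↦ (a₀, s))
      (hΦ.mdifferentiableAt (by simp)) hin 1
    have e3 : mfderivModel ℝ (EG × ℝ) (fun s : ℝ ↦ (a₀, s)) t 1 = (0, 1) := by
      have h : HasFDerivAt (fun s : ℝ ↦ (a₀, s))
          ((0 : ℝ →L[ℝ] EG).prod (ContinuousLinearMap.id ℝ ℝ)) t :=
        (hasFDerivAt_const a₀ t).prodMk (hasFDerivAt_id t)
      exact congrArg (fun L : ℝ →L[ℝ] EG × ℝ ↦ L 1) (mfderiv_eq_fderiv.trans h.fderiv)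
    rw [e3] at e1
    simp only [hσ1, one_smul] at e1
    exact e1.symm
  have hs : Function.Surjective
      (mfderivModel (EG × ℝ) E (fun v : EG × ℝ ↦ σ v.1 • γ v.2) (a₀, t)) := by
    intro w
    have hw : tangentInner E (γ t) (velocityModel E γ t)
        (w - tangentInner E (γ t) (velocityModel E γ t) w • velocityModel E γ t) = 0 := by
      rw [sub_eq_add_neg, tangentInner_add_right, tangentInner_neg_right, tangentInner_smul_right,
        hγ.tangentInner_velocity]
      ring
    obtain ⟨X, hX⟩ := hγ.exists_actionField_eq ht hw
    obtain ⟨a, ha⟩ := mfderivModel_chartAt_symm_surjective (E := EG) (1 : G) X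
    -- The real coordinate produces the normal part of `w`; what remains is an action field `X^*`,
    -- with `a` a preimage of `X` under the differential of the parametrization `σ` of `G`.
    refine ⟨(a, 0) + tangentInner E (γ t) (velocityModel E γ t) w • (0, 1), ?_⟩
    rw [map_add, map_smul, hd1, hd2]
    rw [show mfderivModel EG EG σ a₀ a = X from ha, hX, sub_add_cancel]
  obtain ⟨θ, hθ, hθ0, hθe⟩ := hΦ.exists_section hs
  rw [hΦ0] at hθ hθ0 hθe
  refine ⟨fun x ↦ σ (θ x).1, fun x ↦ (θ x).2, ?_, ?_, by simp [hθ0], hθe⟩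
  · rw [← hθ0] at h1
    exact ContMDiffAt.comp (g := fun v : EG × ℝ ↦ σ v.1) (f := θ) (γ t) h1 hθ
  · rw [← hθ0] at hsnd
    exact ContMDiffAt.comp (g := Prod.snd) (f := θ) (γ t) hsnd hθ

variable {A : G →* K} {γ : ℝ → M} {γN : ℝ → N} {D : Set ℝ} {r : ℝ → ℝ} {ψ : M → N} {t : ℝ}

/-- A map which is equivariant and maps a normal geodesic to a reparametrized curve is smooth at
orbits of codimension one. -/
theorem IsNormalGeodesic.contMDiffAt_equivariant (hA : ContMDiff 𝓘(ℝ, EG) 𝓘(ℝ, EK) ∞ A)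
    (hγ : IsNormalGeodesic E EG G γ) (hγN : ContMDiff 𝓘(ℝ, ℝ) 𝓘(ℝ, F) ∞ γN) (hD : IsOpen D)
    (hr : ContDiffOn ℝ ∞ r D) (hψ : ∀ g : G, ∀ s ∈ D, ψ (g • γ s) = A g • γN (r s)) (ht : t ∈ D)
    (hreg : IsHypersurfaceOrbit E EG G (γ t)) : ContMDiffAt 𝓘(ℝ, E) 𝓘(ℝ, F) ∞ ψ (γ t) := by
  obtain ⟨g, s, hg, hs, hst, he⟩ := hγ.exists_smul_section hreg
  have hrt : ContMDiffAt 𝓘(ℝ, ℝ) 𝓘(ℝ, ℝ) ∞ r (s (γ t)) := by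
    rw [hst]
    exact (hr.contDiffAt (hD.mem_nhds ht)).contMDiffAt
  have h1 : ContMDiffAt 𝓘(ℝ, E) 𝓘(ℝ, EK) ∞ (fun x ↦ A (g x)) (γ t) :=
    hA.contMDiffAt.comp (γ t) hg
  have h2 : ContMDiffAt 𝓘(ℝ, E) 𝓘(ℝ, F) ∞ (fun x ↦ γN (r (s x))) (γ t) :=
    hγN.contMDiffAt.comp (γ t) (ContMDiffAt.comp (γ t) hrt hs)
  refine (h1.smul h2).congr_of_eventuallyEq ?_
  have hsD : ∀ᶠ x in nhds (γ t), s x ∈ D :=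
    hs.continuousAt.eventually (hD.mem_nhds (by rwa [hst]))
  filter_upwards [he, hsD] with x hx hxD
  -- With the local section, equivariance gives a formula for `ψ` composed of smooth maps.
  change ψ x = A (g x) • γN (r (s x))
  rw [← hψ (g x) (s x) hxD, hx]

end Equivariant

/-! ### The second fundamental form of an equivariant map. -/

section Equivariant

variable {E : Type*} [NormedAddCommGroup E] [NormedSpace ℝ E] [FiniteDimensional ℝ E]
  {M : Type*} [TopologicalSpace M] [ChartedSpace E M] [IsManifold 𝓘(ℝ, E) ∞ M]
  [RiemannianBundle (fun x : M ↦ TangentSpace 𝓘(ℝ, E) x)]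
  [IsContMDiffRiemannianBundle 𝓘(ℝ, E) ∞ E (fun x : M ↦ TangentSpace 𝓘(ℝ, E) x)]
  {EG : Type*} [NormedAddCommGroup EG] [NormedSpace ℝ EG]
  {G : Type*} [TopologicalSpace G] [ChartedSpace EG G] [Group G] [LieGroup 𝓘(ℝ, EG) ∞ G]
  [MulAction G M] [ContMDiffSMul 𝓘(ℝ, EG) 𝓘(ℝ, E) ∞ G M]
  {F : Type*} [NormedAddCommGroup F] [NormedSpace ℝ F] [FiniteDimensional ℝ F]
  {N : Type*} [TopologicalSpace N] [ChartedSpace F N] [IsManifold 𝓘(ℝ, F) ∞ N]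
  [RiemannianBundle (fun x : N ↦ TangentSpace 𝓘(ℝ, F) x)]
  [IsContMDiffRiemannianBundle 𝓘(ℝ, F) ∞ F (fun x : N ↦ TangentSpace 𝓘(ℝ, F) x)]
  {EK : Type*} [NormedAddCommGroup EK] [NormedSpace ℝ EK]
  {K : Type*} [TopologicalSpace K] [ChartedSpace EK K] [Group K] [LieGroup 𝓘(ℝ, EK) ∞ K]
  [MulAction K N] [ContMDiffSMul 𝓘(ℝ, EK) 𝓘(ℝ, F) ∞ K N]

theorem ContMDiffAt.eventually_mdifferentiableAt {ψ : M → N} {p : M}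
    (hψ : ContMDiffAt 𝓘(ℝ, E) 𝓘(ℝ, F) ∞ ψ p) :
    ∀ᶠ x in nhds p, MDifferentiableAt 𝓘(ℝ, E) 𝓘(ℝ, F) ψ x :=
  ((contMDiffAt_iff_contMDiffAt_nhds (n := 1) (by simp)).1 (hψ.of_le (by norm_cast))).mono
    fun _ hx ↦ hx.mdifferentiableAt (by simp)

theorem velocityModel_comp_real {γ : ℝ → N} {r : ℝ → ℝ} {s : ℝ}
    (hγ : MDifferentiableAt 𝓘(ℝ, ℝ) 𝓘(ℝ, F) γ (r s)) (hr : DifferentiableAt ℝ r s) :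
    velocityModel F (fun s ↦ γ (r s)) s = deriv r s • velocityModel F γ (r s) := by
  have h := mfderiv_comp_model hγ hr.mdifferentiableAt (1 : ℝ)
  have h2 : mfderivModel ℝ ℝ r s 1 = deriv r s • (1 : ℝ) := by
    rw [smul_eq_mul, mul_one]
    exact mvfderiv_eq_deriv r s
  rw [h2, map_smul] at h
  exact h

variable {γ : ℝ → M} {γN : ℝ → N} {r : ℝ → ℝ} {ψ : M → N} {t : ℝ}

theorem mfderivModel_velocity_eventuallyEq (hγ : ContMDiff 𝓘(ℝ, ℝ) 𝓘(ℝ, E) ∞ γ)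
    (hγN : ContMDiff 𝓘(ℝ, ℝ) 𝓘(ℝ, F) ∞ γN) (hr : ContDiffAt ℝ ∞ r t)
    (hψs : ContMDiffAt 𝓘(ℝ, E) 𝓘(ℝ, F) ∞ ψ (γ t)) (hψ : ∀ᶠ s in nhds t, ψ (γ s) = γN (r s)) :
    (fun s ↦ mfderivModel E F ψ (γ s) (velocityModel E γ s)) =ᶠ[nhds t]
      fun s ↦ deriv r s • velocityModel F γN (r s) := by
  have hrd : ∀ᶠ s in nhds t, DifferentiableAt ℝ r s :=
    (contMDiffAt_iff_contMDiffAt_nhds (n := 1) (by simp)).1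
      ((hr.of_le (by norm_cast)).contMDiffAt (n := 1)) |>.mono
        fun s hs ↦ hs.contDiffAt.differentiableAt (by simp)
  filter_upwards [hγ.continuous.continuousAt.eventually hψs.eventually_mdifferentiableAt, hrd,
    eventually_eventually_nhds.2 hψ] with s h1 h2 h3
  have h4 := mfderiv_comp_model h1 (hγ.mdifferentiableAt (by simp) (x := s)) (1 : ℝ)
  have h5 : (fun s ↦ ψ (γ s)) =ᶠ[nhds s] fun s ↦ γN (r s) := h3
  have h6 := velocityModel_comp_real (hγN.mdifferentiableAt (by simp)) h2
  refine h4.symm.trans (Eq.trans ?_ h6)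
  exact congrArg (fun L : ℝ →L[ℝ] F ↦ L 1) h5.mfderiv_eq

/-- The second fundamental form of `ψ` in the direction of a geodesic which is mapped to a
reparametrized geodesic. -/
theorem hessianForm_velocity (hγ : IsGeodesicCurve E γ) (hγN : IsGeodesicCurve F γN)
    (hr : ContDiffAt ℝ ∞ r t) (hψs : ContMDiffAt 𝓘(ℝ, E) 𝓘(ℝ, F) ∞ ψ (γ t))
    (hψ : ∀ᶠ s in nhds t, ψ (γ s) = γN (r s)) :
    hessianForm E F ψ (γ t) (velocityModel E γ t) (velocityModel E γ t)
      = deriv (deriv r) t • velocityModel F γN (r t) := by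
  have h1 := covAlong_mfderiv hψs (mdiffAlong_velocity hγ.contMDiff t) (1 : ℝ)
  rw [hγ.covAlong_velocity, map_zero, add_zero] at h1
  refine h1.symm.trans ?_
  have h2 := mfderivModel_velocity_eventuallyEq hγ.contMDiff hγN.contMDiff hr hψs hψ
  have hψ' : (fun s ↦ ψ (γ s)) =ᶠ[nhds t] fun s ↦ γN (r s) := hψ
  rw [covAlong_congr hψ' h2]
  have hr1 : MDifferentiableAt 𝓘(ℝ, ℝ) 𝓘(ℝ, ℝ) r t :=
    (hr.differentiableAt (by simp)).mdifferentiableAt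
  have hr2 : MDifferentiableAt 𝓘(ℝ, ℝ) 𝓘(ℝ, ℝ) (deriv r) t :=
    ((hr.derivWithin (m := 1) (by norm_cast)).differentiableAt (by simp)).mdifferentiableAt
  have hV := mdiffAlong_velocity hγN.contMDiff (r t)
  have h3 := covAlong_comp hV hr1 (1 : ℝ)
  -- In the product rule for `r' • γN'(r)`, the term that differentiates `γN'` vanishes since `γN`
  -- is a geodesic; only `r''` survives.
  rw [covAlong_smul (hV.comp hr1) hr2, h3, mvfderiv_eq_deriv]
  have h4 : (mfderiv 𝓘(ℝ, ℝ) 𝓘(ℝ, ℝ) r t (1 : ℝ) : ℝ) = deriv r t • (1 : ℝ) := by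
    rw [smul_eq_mul, mul_one]
    exact mvfderiv_eq_deriv r t
  have h5 : covAlong F ℝ γN (velocityModel F γN) (r t) (mfderiv 𝓘(ℝ, ℝ) 𝓘(ℝ, ℝ) r t (1 : ℝ)) = 0 := by
    refine (congrArg (covAlong F ℝ γN (velocityModel F γN) (r t)) h4).trans ?_
    rw [map_smul, hγN.covAlong_velocity, smul_zero]
  rw [h5, smul_zero, zero_add]

variable {A : G →* K}

/-- Differentiate `ψ (g h • p) = A g • (A h • q)` in `h` at the identity. Keeping `g` free
identifies the whole image field along the orbit map, which can then be differentiated again. -/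
theorem mfderivModel_smulDiff (hA : ContMDiff 𝓘(ℝ, EG) 𝓘(ℝ, EK) ∞ A) {p : M} {q : N}
    (hψ : ∀ g : G, ψ (g • p) = A g • q) {g : G}
    (hψg : MDifferentiableAt 𝓘(ℝ, E) 𝓘(ℝ, F) ψ (g • p)) (X : EG) :
    mfderivModel E F ψ (g • p) (smulDiff E g p (actionFieldModel E EG G p X))
      = smulDiff F (A g) q (actionFieldModel F EK K q (mfderivModel EG EK A 1 X)) := by
  have e : (fun h : G ↦ (fun x ↦ ψ x) (g • (h • p))) = fun h ↦ (fun y : N ↦ A g • y) (A h • q) := by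
    funext h
    change ψ (g • (h • p)) = A g • (A h • q)
    rw [← mul_smul, ← mul_smul, ← map_mul]
    exact hψ (g * h)
  have hfp := (contMDiff_smul_const (G := G) E EG p).mdifferentiableAt (by simp) (x := 1)
  have hfq := (contMDiff_smul_const (G := K) F EK q).mdifferentiableAt (by simp) (x := A 1)
  have hA1 := hA.mdifferentiableAt (by simp) (x := 1)
  have hg := fun x ↦ (contMDiff_const_smul E EG g : ContMDiff _ _ _ fun x : M ↦ g • x).mdifferentiableAt
    (by simp) (x := x)
  have hAg := fun x ↦ (contMDiff_const_smul F EK (A g) : ContMDiff _ _ _ fun x : N ↦ A g • x).mdifferentiableAt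
    (by simp) (x := x)
  have h1 := mfderiv_comp_model (ψ := fun x : M ↦ g • x) (f := fun h : G ↦ h • p) (hg _) hfp X
  have h2 := mfderiv_comp_model (ψ := ψ) (f := fun h : G ↦ g • (h • p)) (y := 1)
    (by rw [one_smul]; exact hψg) ((hg _).comp 1 hfp) X
  have h3 := mfderiv_comp_model (ψ := fun k : K ↦ k • q) (f := A) hfq hA1 X
  have h4 := mfderiv_comp_model (ψ := fun y : N ↦ A g • y) (f := fun h : G ↦ A h • q) (hAg _)
    (hfq.comp 1 hA1) X
  rw [h1, one_smul] at h2
  rw [h3, map_one, one_smul] at h4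
  exact h2.symm.trans ((congrArg (fun f ↦ mfderivModel EG F f 1 X) e).trans h4)

theorem mfderivModel_actionFieldModel (hA : ContMDiff 𝓘(ℝ, EG) 𝓘(ℝ, EK) ∞ A) {p : M} {q : N}
    (hψ : ∀ g : G, ψ (g • p) = A g • q) (hψp : MDifferentiableAt 𝓘(ℝ, E) 𝓘(ℝ, F) ψ p) (X : EG) :
    mfderivModel E F ψ p (actionFieldModel E EG G p X)
      = actionFieldModel F EK K q (mfderivModel EG EK A 1 X) := by
  have h := mfderivModel_smulDiff hA hψ (g := 1) (by rwa [one_smul]) X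
  rwa [map_one, smulDiff_one, smulDiff_one, one_smul] at h

/-- The second fundamental form of an equivariant map in the direction of an orbit. -/
theorem hessianForm_actionFieldModel (hA : ContMDiff 𝓘(ℝ, EG) 𝓘(ℝ, EK) ∞ A) {p : M} {q : N}
    (hψ : ∀ g : G, ψ (g • p) = A g • q) (hψp : ContMDiffAt 𝓘(ℝ, E) 𝓘(ℝ, F) ∞ ψ p) (X : EG) :
    hessianForm E F ψ p (actionFieldModel E EG G p X) (actionFieldModel E EG G p X)
      = orbitCov F EK K q (actionFieldModel F EK K q (mfderivModel EG EK A 1 X))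
          (mfderivModel EG EK A 1 X)
        - mfderivModel E F ψ p (orbitCov E EG G p (actionFieldModel E EG G p X) X) := by
  set w := actionFieldModel F EK K q (mfderivModel EG EK A 1 X) with hw
  have hfp := contMDiff_smul_const (G := G) E EG p
  -- The chosen extension of `X^*_p` is `g ↦ g • X^*_p` along the orbit map. Its image under `dψ`
  -- factors through `A`, so the chain rule turns the derivative into `orbitCov` for `K`.
  have h1 := covAlong_mfderiv (f := fun g : G ↦ g • p) (y := 1) (by simpa using hψp)
    (mdiffAlong_smulDiff p (actionFieldModel E EG G p X) 1) X
  have hV : MDiffAlong F EK (fun k : K ↦ k • q) (fun k ↦ smulDiff F k q w) (A 1) :=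
    mdiffAlong_smulDiff q w _
  have h2 := covAlong_comp hV (hA.mdifferentiableAt (by simp) (x := 1)) X
  have hev : ∀ᶠ g in nhds (1 : G), MDifferentiableAt 𝓘(ℝ, E) 𝓘(ℝ, F) ψ (g • p) := by
    refine hfp.continuous.continuousAt.eventually ?_
    simp only [one_smul]
    exact hψp.eventually_mdifferentiableAt
  have hfield : (fun g : G ↦ mfderivModel E F ψ (g • p) (smulDiff E g p (actionFieldModel E EG G p X)))
      =ᶠ[nhds 1] fun g ↦ smulDiff F (A g) q w := by
    filter_upwards [hev] with g hg using mfderivModel_smulDiff hA hψ hg X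
  have hmap : (fun g : G ↦ ψ (g • p)) =ᶠ[nhds 1] fun g ↦ A g • q := .of_forall hψ
  rw [covAlong_congr hmap hfield, h2, smulDiff_one, one_smul, map_one] at h1
  exact (sub_eq_of_eq_add h1).symm

end Equivariant

/-- The coefficients `c μ i` are the coordinates of `(dA E_μ)^*`, so the double sum over the basis
is a quadratic form evaluated at that single vector. -/
theorem sum_sum_mul_inner {V ι : Type*} [NormedAddCommGroup V] [InnerProductSpace ℝ V] [Fintype ι]
    (f : OrthonormalBasis ι ℝ V) (T : V →ₗ[ℝ] V) (u : V) {c : ι → ℝ} (hc : ∀ i, c i = ⟪u, f i⟫_ℝ) :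
    ∑ i, ∑ j, c i * c j * ⟪T (f i), f j⟫_ℝ = ⟪T u, u⟫_ℝ := by
  have hu : u = ∑ i, c i • f i := by
    conv_lhs => rw [← f.sum_repr' u]
    exact Finset.sum_congr rfl fun i _ ↦ by rw [hc, real_inner_comm]
  conv_rhs => rw [hu]
  simp only [map_sum, map_smul, sum_inner, inner_sum, inner_smul_left, inner_smul_right,
    RCLike.conj_to_real, mul_assoc, Finset.mul_sum]
  rw [Finset.sum_comm]
  exact Finset.sum_congr rfl fun i _ ↦ Finset.sum_congr rfl fun j _ ↦ by ring

/-! ### Parallel transport between tangent spaces of orbits. -/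

section Transport

variable {E : Type*} [NormedAddCommGroup E] [NormedSpace ℝ E] [FiniteDimensional ℝ E]
  {M : Type*} [TopologicalSpace M] [ChartedSpace E M] [IsManifold 𝓘(ℝ, E) ∞ M]
  [RiemannianBundle (fun x : M ↦ TangentSpace 𝓘(ℝ, E) x)]
  [IsContMDiffRiemannianBundle 𝓘(ℝ, E) ∞ E (fun x : M ↦ TangentSpace 𝓘(ℝ, E) x)]
  {EG : Type*} [NormedAddCommGroup EG] [NormedSpace ℝ EG]
  {G : Type*} [TopologicalSpace G] [ChartedSpace EG G] [Group G] [LieGroup 𝓘(ℝ, EG) ∞ G]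
  [MulAction G M] [ContMDiffSMul 𝓘(ℝ, EG) 𝓘(ℝ, E) ∞ G M]
  {γ : ℝ → M} {a : ℝ}

/-- Transport preserves inner products and the velocity, so a vector perpendicular to `γ'` stays
perpendicular. At `γ a` the perpendicular vectors are exactly the tangent vectors of the orbit, and
the projection has no effect. The orbit through `γ b` may be singular. -/
theorem IsNormalGeodesic.coe_orbitTransport (hγ : IsNormalGeodesic E EG G γ)
    (ha : IsHypersurfaceOrbit E EG G (γ a)) (b : ℝ) (v : orbitTangent E EG G (γ b)) :
    (orbitTransport E EG G γ b a v : TangentSpace 𝓘(ℝ, E) (γ a))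
      = parallelTransport γ b a (v : TangentSpace 𝓘(ℝ, E) (γ b)) := by
  obtain ⟨X, hX⟩ := v.2
  have h : tangentInner E (γ a) (velocityModel E γ a) (parallelTransportModel E γ b a
      (actionFieldModel E EG G (γ b) X)) = 0 := by
    rw [← hγ.isGeodesicCurve.parallelTransportModel_velocity b a,
      tangentInner_parallelTransportModel hγ.contMDiff]
    exact hγ.tangentInner_actionField b X
  obtain ⟨Y, hY⟩ := hγ.exists_actionField_eq ha h
  have hmem : parallelTransport γ b a (v : TangentSpace 𝓘(ℝ, E) (γ b)) ∈ orbitTangent E EG G (γ a) := by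
    refine ⟨Y, ?_⟩
    rw [← hX]
    exact hY
  exact congrArg Subtype.val ((orbitTangent E EG G (γ a)).orthogonalProjectionOnto_mem_subspace_eq_self
    ⟨_, hmem⟩)

/-- The round trip starts at the possibly singular orbit, so it returns to a vector already tangent
to that orbit and the final projection is harmless. The opposite round trip could lose information.
-/
theorem IsNormalGeodesic.orbitTransport_orbitTransport (hγ : IsNormalGeodesic E EG G γ)
    (ha : IsHypersurfaceOrbit E EG G (γ a)) (b : ℝ) (v : orbitTangent E EG G (γ b)) :
    orbitTransport E EG G γ a b (orbitTransport E EG G γ b a v) = v := by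
  have h : parallelTransport γ a b (orbitTransport E EG G γ b a v : TangentSpace 𝓘(ℝ, E) (γ a)) = v := by
    rw [hγ.coe_orbitTransport ha]
    exact parallelTransportModel_symm hγ.contMDiff b a _
  refine (congrArg (orbitTangent E EG G (γ b)).orthogonalProjectionOnto h).trans ?_
  exact (orbitTangent E EG G (γ b)).orthogonalProjectionOnto_mem_subspace_eq_self v

theorem IsNormalGeodesic.inner_orbitTransport (hγ : IsNormalGeodesic E EG G γ)
    (ha : IsHypersurfaceOrbit E EG G (γ a)) (b : ℝ) (v w : orbitTangent E EG G (γ b)) :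
    ⟪orbitTransport E EG G γ b a v, orbitTransport E EG G γ b a w⟫_ℝ = ⟪v, w⟫_ℝ := by
  rw [Submodule.coe_inner, Submodule.coe_inner, hγ.coe_orbitTransport ha, hγ.coe_orbitTransport ha]
  exact tangentInner_parallelTransportModel hγ.contMDiff b a _ _

/-- The transported quadratic form of an endomorphism of the tangent space of another orbit, on
action fields. -/
theorem IsNormalGeodesic.inner_actionEndomorphism [CompleteSpace EG] [T2Space M]
    (hM : IsCohomogeneityOne E M EG G) (hγ : IsNormalGeodesic E EG G γ)
    (ha : IsHypersurfaceOrbit E EG G (γ a)) (b : ℝ)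
    (S : orbitTangent E EG G (γ b) →ₗ[ℝ] orbitTangent E EG G (γ b))
    (X : GroupLieAlgebra 𝓘(ℝ, EG) G) :
    ⟪((actionEndomorphism E EG G γ a b).adjoint ∘ₗ orbitTransport E EG G γ b a ∘ₗ S ∘ₗ
        orbitTransport E EG G γ a b ∘ₗ actionEndomorphism E EG G γ a b) (orbitField E EG G (γ a) X),
      orbitField E EG G (γ a) X⟫_ℝ
      = ⟪S (orbitField E EG G (γ b) X), orbitField E EG G (γ b) X⟫_ℝ := by
  -- Once the adjoint is moved to the other side, both arguments contain `J X^*_a`, which is the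
  -- transport of `X^*_b`; inverse transports cancel and the outer transport preserves the inner
  -- product.
  have hJ : actionEndomorphism E EG G γ a b (orbitField E EG G (γ a) X)
      = orbitTransport E EG G γ b a (orbitField E EG G (γ b) X) := by
    rw [← hγ.actionFieldHom_orbitField hM ha b X]
    rfl
  rw [LinearMap.comp_apply, LinearMap.adjoint_inner_left]
  simp only [LinearMap.comp_apply]
  rw [hJ, hγ.orbitTransport_orbitTransport ha, hγ.inner_orbitTransport ha]

end Transport

/-! ### The normal component of the tension field. -/

section Tension

variable {E : Type*} [NormedAddCommGroup E] [NormedSpace ℝ E] [FiniteDimensional ℝ E]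
  {M : Type*} [TopologicalSpace M] [ChartedSpace E M] [IsManifold 𝓘(ℝ, E) ∞ M]
  [RiemannianBundle (fun x : M ↦ TangentSpace 𝓘(ℝ, E) x)]
  [IsContMDiffRiemannianBundle 𝓘(ℝ, E) ∞ E (fun x : M ↦ TangentSpace 𝓘(ℝ, E) x)]
  {EG : Type*} [NormedAddCommGroup EG] [NormedSpace ℝ EG]
  {G : Type*} [TopologicalSpace G] [ChartedSpace EG G] [Group G] [LieGroup 𝓘(ℝ, EG) ∞ G]
  [MulAction G M] [ContMDiffSMul 𝓘(ℝ, EG) 𝓘(ℝ, E) ∞ G M]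
  {F : Type*} [NormedAddCommGroup F] [NormedSpace ℝ F] [FiniteDimensional ℝ F]
  {N : Type*} [TopologicalSpace N] [ChartedSpace F N] [IsManifold 𝓘(ℝ, F) ∞ N]
  [RiemannianBundle (fun x : N ↦ TangentSpace 𝓘(ℝ, F) x)]
  [IsContMDiffRiemannianBundle 𝓘(ℝ, F) ∞ F (fun x : N ↦ TangentSpace 𝓘(ℝ, F) x)]
  {EK : Type*} [NormedAddCommGroup EK] [NormedSpace ℝ EK]
  {K : Type*} [TopologicalSpace K] [ChartedSpace EK K] [Group K] [LieGroup 𝓘(ℝ, EK) ∞ K]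
  [MulAction K N] [ContMDiffSMul 𝓘(ℝ, EK) 𝓘(ℝ, F) ∞ K N]

theorem inner_tangentCast {x y : N} (h : x = y) (v : TangentSpace 𝓘(ℝ, F) x)
    (w : TangentSpace 𝓘(ℝ, F) y) : ⟪tangentCast h v, w⟫_ℝ = tangentInner F y v w := by
  subst h
  rfl

variable {γ : ℝ → M} {γN : ℝ → N} {r : ℝ → ℝ} {ψ : M → N} {t : ℝ} {A : G →* K}

/-- The tension field at a point of an orbit of codimension one, as a sum over an orthonormal basis
of the tangent space of the orbit and the normal vector. -/
theorem IsNormalGeodesic.tangentInner_tensionField (hγ : IsNormalGeodesic E EG G γ)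
    (ht : IsHypersurfaceOrbit E EG G (γ t)) (hψ : ContMDiffAt 𝓘(ℝ, E) 𝓘(ℝ, F) ∞ ψ (γ t))
    {n : ℕ} (e : OrthonormalBasis (Fin n) ℝ (orbitTangent E EG G (γ t))) (y : N) (η : F) :
    tangentInner F y (tensionField (E := E) (F := F) ψ (γ t)) η
      = ∑ μ, tangentInner F y (hessianForm E F ψ (γ t)
          (e μ : TangentSpace 𝓘(ℝ, E) (γ t)) (e μ : TangentSpace 𝓘(ℝ, E) (γ t))) η
        + tangentInner F y (hessianForm E F ψ (γ t) (velocityModel E γ t) (velocityModel E γ t)) η := by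
  let β' : E →ₗ[ℝ] E →ₗ[ℝ] ℝ := LinearMap.mk₂ ℝ
    (fun u w : E ↦ tangentInner F y (hessianForm E F ψ (γ t) u w) η)
    (fun u u' w ↦ by rw [hessianForm_add_left, tangentInner_add_left])
    (fun c u w ↦ by rw [hessianForm_smul_left, tangentInner_smul_left, smul_eq_mul])
    (fun u w w' ↦ by rw [hessianForm_add_right hψ, tangentInner_add_left])
    (fun c u w ↦ by rw [hessianForm_smul_right hψ, tangentInner_smul_left, smul_eq_mul])
  let β : TangentSpace 𝓘(ℝ, E) (γ t) →ₗ[ℝ] TangentSpace 𝓘(ℝ, E) (γ t) →ₗ[ℝ] ℝ := β'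
  have h := sum_bilinear_hyperplane (stdOrthonormalBasis ℝ (TangentSpace 𝓘(ℝ, E) (γ t))) β
    (O := orbitTangent E EG G (γ t)) (ξ := velocity γ t) ht (hγ.unit_speed t)
    (by rintro _ ⟨X, rfl⟩; exact hγ.perpendicular t X) e
  refine Eq.trans ?_ h
  let L : F →ₗ[ℝ] ℝ :=
    { toFun := fun v ↦ tangentInner F y v η
      map_add' := fun v w ↦ tangentInner_add_left y v w η
      map_smul' := fun c v ↦ tangentInner_smul_left y c v η }
  refine (map_sum L (fun i ↦ (hessianMap (F := F) ψ (γ t)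
    (stdOrthonormalBasis ℝ (TangentSpace 𝓘(ℝ, E) (γ t)) i) : F)) Finset.univ).trans ?_
  exact Finset.sum_congr rfl fun i _ ↦ congrArg L (hessianMap_eq_hessianForm ψ (γ t) _)

/-- The shape operator, as the normal component of the derivative of a transported action field. -/
theorem IsNormalGeodesic.inner_shapeOperator_velocity [CompleteSpace EG]
    (hM : IsCohomogeneityOne E M EG G) (hγ : IsNormalGeodesic E EG G γ) (s : ℝ) (X : EG) :
    ⟪shapeOperator E EG G (γ s) (velocity γ s) (orbitField E EG G (γ s) X),
        orbitField E EG G (γ s) X⟫_ℝ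
      = tangentInner E (γ s) (velocityModel E γ s)
          (orbitCov E EG G (γ s) (actionFieldModel E EG G (γ s) X) X) := by
  have h := hM.inner_shapeOperator (ξ := velocityModel E γ s) (hγ.tangentInner_actionField s) X X
  rw [hM.orbitCov_skew, neg_neg] at h
  exact h

/-- Split `u` into an action field and a multiple of the velocity. The first is mapped to an action
field of `K`, perpendicular to `γN'`, and the second is stretched by `r'` along `γN'`. -/
theorem IsNormalGeodesic.tangentInner_mfderivModel (hA : ContMDiff 𝓘(ℝ, EG) 𝓘(ℝ, EK) ∞ A)
    (hγ : IsNormalGeodesic E EG G γ) (hγN : IsNormalGeodesic F EK K γN)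
    (ht : IsHypersurfaceOrbit E EG G (γ t)) (hr : ContDiffAt ℝ ∞ r t)
    (hψt : ContMDiffAt 𝓘(ℝ, E) 𝓘(ℝ, F) ∞ ψ (γ t)) (hψs : ∀ᶠ s in nhds t, ψ (γ s) = γN (r s))
    (hψ : ∀ g : G, ψ (g • γ t) = A g • γN (r t)) (u : E) :
    tangentInner F (γN (r t)) (mfderivModel E F ψ (γ t) u) (velocityModel F γN (r t))
      = deriv r t * tangentInner E (γ t) (velocityModel E γ t) u := by
  set l := tangentInner E (γ t) (velocityModel E γ t) u with hl
  have hu : tangentInner E (γ t) (velocityModel E γ t) (u + (-l) • velocityModel E γ t) = 0 := by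
    rw [tangentInner_add_right, tangentInner_smul_right, hγ.tangentInner_velocity]
    ring
  obtain ⟨X, hX⟩ := hγ.exists_actionField_eq ht hu
  have hu' : u = actionFieldModel E EG G (γ t) X + l • velocityModel E γ t := by
    rw [hX, neg_smul, neg_add_cancel_right]
  have h1 := (mfderivModel_velocity_eventuallyEq hγ.contMDiff hγN.contMDiff hr hψt hψs).eq_of_nhds
  rw [hu', map_add, map_smul, h1,
    mfderivModel_actionFieldModel hA hψ (hψt.mdifferentiableAt (by simp)), tangentInner_add_left,
    tangentInner_smul_left, tangentInner_smul_left, hγN.tangentInner_velocity,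
    tangentInner_comm, hγN.tangentInner_actionField]
  ring

/-- The normal component of the second fundamental form of `ψ` in the direction of an action
field. -/
theorem IsNormalGeodesic.tangentInner_hessianForm_actionField [CompleteSpace EG] [CompleteSpace EK]
    (hM : IsCohomogeneityOne E M EG G) (hN : IsCohomogeneityOne F N EK K)
    (hA : ContMDiff 𝓘(ℝ, EG) 𝓘(ℝ, EK) ∞ A)
    (hγ : IsNormalGeodesic E EG G γ) (hγN : IsNormalGeodesic F EK K γN)
    (ht : IsHypersurfaceOrbit E EG G (γ t)) (hr : ContDiffAt ℝ ∞ r t)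
    (hψt : ContMDiffAt 𝓘(ℝ, E) 𝓘(ℝ, F) ∞ ψ (γ t)) (hψs : ∀ᶠ s in nhds t, ψ (γ s) = γN (r s))
    (hψ : ∀ g : G, ψ (g • γ t) = A g • γN (r t)) (X : GroupLieAlgebra 𝓘(ℝ, EG) G) :
    tangentInner F (γN (r t)) (hessianForm E F ψ (γ t) (actionFieldModel E EG G (γ t) X)
        (actionFieldModel E EG G (γ t) X)) (velocityModel F γN (r t))
      = ⟪shapeOperator F EK K (γN (r t)) (velocity γN (r t))
            (orbitField F EK K (γN (r t)) (lieDifferential EG EK A X)),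
          orbitField F EK K (γN (r t)) (lieDifferential EG EK A X)⟫_ℝ
        - deriv r t * ⟪shapeOperator E EG G (γ t) (velocity γ t) (orbitField E EG G (γ t) X),
            orbitField E EG G (γ t) X⟫_ℝ := by
  obtain ⟨X, rfl⟩ : ∃ Y : EG, (Y : GroupLieAlgebra 𝓘(ℝ, EG) G) = X := ⟨X, rfl⟩
  have h1 := congrArg (fun v : F ↦ tangentInner F (γN (r t)) v (velocityModel F γN (r t)))
    (hessianForm_actionFieldModel hA hψ hψt X)
  simp only [tangentInner_sub_left] at h1
  rw [hγ.tangentInner_mfderivModel hA hγN ht hr hψt hψs hψ] at h1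
  refine h1.trans ?_
  exact congrArg₂ (fun a b : ℝ ↦ a - deriv r t * b)
    ((tangentInner_comm ..).trans
      (hγN.inner_shapeOperator_velocity hN (r t) (mfderivModel EG EK A 1 X)).symm)
    (hγ.inner_shapeOperator_velocity hM t X).symm

end Tension

/-! ### The formula for the tension field. -/

theorem mainTheorem3
    -- the Riemannian manifold `M` with the action of `G`
    {E : Type*} [NormedAddCommGroup E] [NormedSpace ℝ E] [FiniteDimensional ℝ E]
    {M : Type*} [TopologicalSpace M] [T2Space M] [ConnectedSpace M]
    [ChartedSpace E M] [IsManifold 𝓘(ℝ, E) ∞ M]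
    [RiemannianBundle (fun x : M ↦ TangentSpace 𝓘(ℝ, E) x)]
    [IsContMDiffRiemannianBundle 𝓘(ℝ, E) ∞ E (fun x : M ↦ TangentSpace 𝓘(ℝ, E) x)]
    {EG : Type*} [NormedAddCommGroup EG] [NormedSpace ℝ EG] [FiniteDimensional ℝ EG]
    {G : Type*} [TopologicalSpace G] [T2Space G] [CompactSpace G] [ChartedSpace EG G] [Group G]
    [LieGroup 𝓘(ℝ, EG) ∞ G] [MulAction G M] [ContMDiffSMul 𝓘(ℝ, EG) 𝓘(ℝ, E) ∞ G M]
    (hM : IsCohomogeneityOne E M EG G)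
    -- the Riemannian manifold `N` with the action of `K`
    {F : Type*} [NormedAddCommGroup F] [NormedSpace ℝ F] [FiniteDimensional ℝ F]
    {N : Type*} [TopologicalSpace N] [T2Space N] [ConnectedSpace N]
    [ChartedSpace F N] [IsManifold 𝓘(ℝ, F) ∞ N]
    [RiemannianBundle (fun x : N ↦ TangentSpace 𝓘(ℝ, F) x)]
    [IsContMDiffRiemannianBundle 𝓘(ℝ, F) ∞ F (fun x : N ↦ TangentSpace 𝓘(ℝ, F) x)]
    {EK : Type*} [NormedAddCommGroup EK] [NormedSpace ℝ EK] [FiniteDimensional ℝ EK]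
    {K : Type*} [TopologicalSpace K] [T2Space K] [CompactSpace K] [ChartedSpace EK K] [Group K]
    [LieGroup 𝓘(ℝ, EK) ∞ K] [MulAction K N] [ContMDiffSMul 𝓘(ℝ, EK) 𝓘(ℝ, F) ∞ K N]
    (hN : IsCohomogeneityOne F N EK K)
    -- the homomorphism, the normal geodesics and the equivariant map
    (A : G →* K) (hA : ContMDiff 𝓘(ℝ, EG) 𝓘(ℝ, EK) ∞ A)
    (γ : ℝ → M) (hγ : IsNormalGeodesic E EG G γ)
    (γN : ℝ → N) (hγN : IsNormalGeodesic F EK K γN)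
    (D : Set ℝ) (hD : IsOpen D) (hDreg : ∀ s ∈ D, IsHypersurfaceOrbit E EG G (γ s))
    (r : ℝ → ℝ) (hr : ContDiffOn ℝ ∞ r D)
    (ψ : M → N) (hψ : ∀ g : G, ∀ s ∈ D, ψ (g • γ s) = A g • γN (r s))
    -- the point and the orthonormal bases
    (t : ℝ) (ht : t ∈ D) (htN : IsHypersurfaceOrbit F EK K (γN t))
    {n m : ℕ} (e : OrthonormalBasis (Fin n) ℝ (orbitTangent E EG G (γ t)))
    (Ev : Fin n → GroupLieAlgebra 𝓘(ℝ, EG) G)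
    (hEv : ∀ μ, orbitField E EG G (γ t) (Ev μ) = e μ)
    (f : OrthonormalBasis (Fin m) ℝ (orbitTangent F EK K (γN t)))
    (c : Fin n → Fin m → ℝ)
    (hc : ∀ μ i, c μ i = ⟪orbitField F EK K (γN t) (lieDifferential EG EK A (Ev μ)), f i⟫_ℝ) :
    ⟪tangentCast (equivariant_apply_geodesic hψ ht) (tensionField (E := E) (F := F) ψ (γ t)),
        velocity γN (r t)⟫_ℝ =
      deriv (deriv r) t
        - deriv r t * LinearMap.trace ℝ _ (shapeOperator E EG G (γ t) (velocity γ t))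
        + ∑ μ, ∑ i, ∑ j, c μ i * c μ j *
          ⟪((actionEndomorphism F EK K γN t (r t)).adjoint ∘ₗ orbitTransport F EK K γN (r t) t ∘ₗ
              shapeOperator F EK K (γN (r t)) (velocity γN (r t)) ∘ₗ
              orbitTransport F EK K γN t (r t) ∘ₗ actionEndomorphism F EK K γN t (r t)) (f i),
            f j⟫_ℝ := by
  have : CompleteSpace EG := FiniteDimensional.complete ℝ EG
  have : CompleteSpace EK := FiniteDimensional.complete ℝ EK
  have hψt := hγ.contMDiffAt_equivariant hA hγN.contMDiff hD hr hψ ht (hDreg t ht)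
  have hr' : ContDiffAt ℝ ∞ r t := hr.contDiffAt (hD.mem_nhds ht)
  have hψs : ∀ᶠ s in nhds t, ψ (γ s) = γN (r s) :=
    Filter.mem_of_superset (hD.mem_nhds ht) fun s hs ↦ equivariant_apply_geodesic hψ hs
  have hn : tangentInner F (γN (r t)) (hessianForm E F ψ (γ t) (velocityModel E γ t)
      (velocityModel E γ t)) (velocityModel F γN (r t)) = deriv (deriv r) t := by
    rw [hessianForm_velocity hγ.isGeodesicCurve hγN.isGeodesicCurve hr' hψt hψs,
      tangentInner_smul_left, hγN.tangentInner_velocity, mul_one]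
  have he : ∀ μ, tangentInner F (γN (r t)) (hessianForm E F ψ (γ t)
      (e μ : TangentSpace 𝓘(ℝ, E) (γ t)) (e μ : TangentSpace 𝓘(ℝ, E) (γ t)))
        (velocityModel F γN (r t))
      = ⟪shapeOperator F EK K (γN (r t)) (velocity γN (r t))
            (orbitField F EK K (γN (r t)) (lieDifferential EG EK A (Ev μ))),
          orbitField F EK K (γN (r t)) (lieDifferential EG EK A (Ev μ))⟫_ℝ
        - deriv r t * ⟪e μ, shapeOperator E EG G (γ t) (velocity γ t) (e μ)⟫_ℝ := fun μ ↦ by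
    rw [real_inner_comm _ (e μ), ← hEv]
    exact hγ.tangentInner_hessianForm_actionField hM hN hA hγN (hDreg t ht) hr' hψt hψs
      (fun g ↦ hψ g t ht) (Ev μ)
  rw [inner_tangentCast, LinearMap.trace_eq_sum_inner _ e]
  refine (hγ.tangentInner_tensionField (hDreg t ht) hψt e _ (velocityModel F γN (r t))).trans ?_
  refine (congrArg₂ (· + ·) (Finset.sum_congr rfl fun μ _ ↦ he μ) hn).trans ?_
  -- For each `μ` the double sum collapses to the transported quadratic form at `(dA E_μ)^*`, which
  -- equals that of `Ŝ` on the action field at `γN (r t)`.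
  rw [Finset.sum_sub_distrib, ← Finset.mul_sum,
    Finset.sum_congr rfl fun μ _ ↦ (sum_sum_mul_inner f _ _ (hc μ)).trans
      (hγN.inner_actionEndomorphism hN htN (r t) _ _)]
  ring

end
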